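/- Let $\mathcal{A}$ be the mod 2 Steenrod algebra, graded by $|\mathrm{Sq}^i| = i$, and let $\mathcal{A}_1 \subset \mathcal{A}$ be the graded subalgebra generated by $\mathrm{Sq}^1$ and $\mathrm{Sq}^2$. Let $\mathrm{StMod}_{\mathcal{A}_1}$ be the stable module category of $\mathcal{A}_1$, that is, the compact objects of the category of $\mathbb{Z}$-graded left $\mathcal{A}_1$-modules with degree-preserving maps, where maps are identified if their difference factors through a projective module; its cofiber sequences are those isomorphic to images of short exact sequences of modules, and $X[1]$ is the cofiber of $X \to 0$. Let $\mathrm{tw}$ be the twist functor on it, $\mathrm{tw}(M) = M(1)$ with $M(1)_\ell = M_{\ell-1}$. For objects $X, Y$ let $\delta(X,Y) \in \mathbb{N} \cup \{\infty\}$ be the least $\ell$ such that $Y$ is a retract of some $Y_\ell$ having a filtration $0 = Y_0 \to Y_1 \to \cdots \to Y_\ell$ with $\mathrm{cofib}(Y_{i-1} \to Y_i) \simeq X[n_i]$, $n_i \in \mathbb{Z}$, for all $i$ ($\infty$ if there is none). An object $G$ is a generator if the smallest thick subcategory containing $G$ is the whole category. For an exact endofunctor $F$ and a generator $G$ put $$h_{\mathrm{cat}}(F)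 = \lim_{n\to\infty} \frac{\log \delta(G, F^n G)}{n}, \qquad h_{\mathrm{pol}}(F) = \limsup_{n\to\infty} \frac{\log \delta(G, F^n G) - n\, h_{\mathrm{cat}}(F)}{\log n}.$$ Then $\mathrm{StMod}_{\mathcal{A}_1}$ has a generator, and for every generator $G$ the limit defining $h_{\mathrm{cat}}(\mathrm{tw})$ exists and the categorical polynomial entropy of the twist functor satisfies $$h_{\mathrm{pol}}(\mathrm{tw}) \leq 1 .$$ -/

import Mathlib

open CategoryTheory Filter Topology

/-! ## The mod 2 Steenrod algebra and its subalgebra generated by `Sq¹` and `Sq²` -/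

namespace Steenrod

/-- The defining relations of the mod 2 Steenrod algebra on generators `Sq⁰, Sq¹, Sq², …`:
`Sq⁰ = 1`, and the Adem relations
`Sqᵃ Sqᵇ = ∑_{c ≤ a/2} (b - c - 1 choose a - 2c) Sqᵃ⁺ᵇ⁻ᶜ Sqᶜ` for `0 < a < 2b`
(no natural number subtraction below truncates, since `c ≤ a/2 < b`). -/
inductive AdemRel : FreeAlgebra (ZMod 2) ℕ → FreeAlgebra (ZMod 2) ℕ → Prop
  | sq_zero : AdemRel (FreeAlgebra.ι (ZMod 2) 0) 1
  | adem (a b : ℕ) (ha : 0 < a) (hab : a < 2 * b) :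
      AdemRel (FreeAlgebra.ι (ZMod 2) a * FreeAlgebra.ι (ZMod 2) b)
        (∑ c ∈ Finset.range (a / 2 + 1), (((b - c - 1).choose (a - 2 * c) : ℕ) : ZMod 2) •
          (FreeAlgebra.ι (ZMod 2) (a + b - c) * FreeAlgebra.ι (ZMod 2) c))

/-- The mod 2 Steenrod algebra `𝒜`. -/
abbrev SteenrodAlgebra : Type := RingQuot AdemRel

/-- The Steenrod square `Sqⁿ`. -/
noncomputable def Sq (n : ℕ) : SteenrodAlgebra :=
  RingQuot.mkAlgHom (ZMod 2) AdemRel (FreeAlgebra.ι (ZMod 2) n)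

/-- The homogeneous part of `𝒜` of degree `n`: the additive span (over `𝔽₂`, this is the same as the
linear span) of all monomials `Sq^{i₁} ⋯ Sq^{iᵣ}` with `i₁ + ⋯ + iᵣ = n`. -/
def SteenrodAlgebra.degree (n : ℕ) : AddSubgroup SteenrodAlgebra :=
  AddSubgroup.closure {x | ∃ l : List ℕ, l.sum = n ∧ x = (l.map Sq).prod}

/-- `𝒜₁`, the subalgebra of the mod 2 Steenrod algebra generated by `Sq¹` and `Sq²`. -/
abbrev A1 : Subalgebra (ZMod 2) SteenrodAlgebra := Algebra.adjoin (ZMod 2) {Sq 1, Sq 2}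

/-- The grading of `𝒜₁` induced by that of the Steenrod algebra. -/
def A1.degree (n : ℕ) : AddSubgroup A1 :=
  (SteenrodAlgebra.degree n).comap (A1.val : A1 →+ SteenrodAlgebra)

end Steenrod

/-! ## Graded modules -/

/-- A `ℤ`-graded left module over the ring `A` with homogeneous parts `𝒜 n`, `n ≥ 0`. -/
structure GrMod {A : Type} [Ring A] (𝒜 : ℕ → AddSubgroup A) where
  carrier : Type
  [addCommGroup : AddCommGroup carrier]
  [module : Module A carrier]
  /-- the homogeneous parts -/
  deg : ℤ → AddSubgroup carrier
  isInternal : DirectSum.IsInternal deg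
  smul_mem : ∀ {i : ℕ} {j : ℤ} {a : A} {m : carrier},
    a ∈ 𝒜 i → m ∈ deg j → a • m ∈ deg (i + j)

namespace GrMod

attribute [instance] GrMod.addCommGroup GrMod.module

variable {A : Type} [Ring A] {𝒜 : ℕ → AddSubgroup A}

/-- Morphisms of graded modules: module maps that preserve degrees. -/
@[ext]
structure Hom (M N : GrMod 𝒜) where
  toLin : M.carrier →ₗ[A] N.carrier
  map_deg : ∀ (i : ℤ) (m : M.carrier), m ∈ M.deg i → toLin m ∈ N.deg i

instance : Category (GrMod 𝒜) where
  Hom M N := Hom M N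
  id M := ⟨LinearMap.id, fun _ _ h => h⟩
  comp f g := ⟨g.toLin ∘ₗ f.toLin, fun i m h => g.map_deg i _ (f.map_deg i m h)⟩

/-- The underlying module map of a morphism of graded modules. -/
def lin {M N : GrMod 𝒜} (f : M ⟶ N) : M.carrier →ₗ[A] N.carrier := Hom.toLin f

/-- Constructor for morphisms of graded modules. -/
def mkHom {M N : GrMod 𝒜} (φ : M.carrier →ₗ[A] N.carrier)
    (h : ∀ (i : ℤ) (m : M.carrier), m ∈ M.deg i → φ m ∈ N.deg i) : M ⟶ N :=
  Hom.mk φ h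

theorem hom_ext {M N : GrMod 𝒜} {f g : M ⟶ N} (h : lin f = lin g) : f = g :=
  Hom.ext h

theorem lin_mem {M N : GrMod 𝒜} (f : M ⟶ N) {i : ℤ} {m : M.carrier} (h : m ∈ M.deg i) :
    lin f m ∈ N.deg i :=
  Hom.map_deg f i m h

/-- A graded module is projective if morphisms out of it lift along surjections. -/
def IsProj (P : GrMod 𝒜) : Prop :=
  ∀ (X Y : GrMod 𝒜) (p : X ⟶ Y) (f : P ⟶ Y), Function.Surjective (lin p) →
    ∃ g : P ⟶ X, g ≫ p = f

/-- `0 → M → N → L → 0` is a short exact sequence of graded modules. -/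
def IsShortExact {M N L : GrMod 𝒜} (i : M ⟶ N) (p : N ⟶ L) : Prop :=
  Function.Injective (lin i) ∧ Function.Exact (lin i) (lin p) ∧ Function.Surjective (lin p)

theorem isInternal_iff {M : Type} [AddCommGroup M] (D : ℤ → AddSubgroup M) :
    DirectSum.IsInternal D ↔ iSupIndep D ∧ iSup D = ⊤ := by
  have h1 : DirectSum.IsInternal D ↔
      DirectSum.IsInternal (fun i => AddSubgroup.toIntSubmodule (D i)) := Iff.rfl
  rw [h1, DirectSum.isInternal_submodule_iff_iSupIndep_and_iSup_eq_top]
  refine and_congr (iSupIndep_map_orderIso_iff AddSubgroup.toIntSubmodule) ?_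
  rw [← OrderIso.map_iSup, map_eq_top_iff]

/-- The twist `M(a)`, with `M(a)_ℓ = M_{ℓ - a}`. -/
def twist (a : ℤ) (M : GrMod 𝒜) : GrMod 𝒜 where
  carrier := M.carrier
  deg i := M.deg (i - a)
  isInternal := by
    obtain ⟨h1, h2⟩ := (isInternal_iff M.deg).1 M.isInternal
    exact (isInternal_iff _).2 ⟨h1.comp (sub_left_injective (b := a)),
      ((Equiv.subRight a).iSup_comp (g := M.deg)).trans h2⟩
  smul_mem {i j b m} hb hm := by
    have := M.smul_mem hb hm
    rwa [← add_sub_assoc] at this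

/-- The homogeneous part of degree `j` of a direct sum. -/
def directSumDeg {ι : Type} (N : ι → GrMod 𝒜) (j : ℤ) :
    AddSubgroup (DirectSum ι fun i => (N i).carrier) where
  carrier := {x | ∀ i, x i ∈ (N i).deg j}
  add_mem' hx hy i := ((N i).deg j).add_mem (hx i) (hy i)
  zero_mem' i := ((N i).deg j).zero_mem
  neg_mem' hx i := ((N i).deg j).neg_mem (hx i)

/-- The direct sum of a family of graded modules. -/
def directSum {ι : Type} (N : ι → GrMod 𝒜) : GrMod 𝒜 where
  carrier := DirectSum ι fun i => (N i).carrier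
  deg := directSumDeg N
  isInternal := by
    classical
    rw [isInternal_iff]
    constructor
    · intro j
      rw [AddSubgroup.disjoint_def]
      intro x hx hx'
      refine DFinsupp.ext fun i => ?_
      have hd := ((isInternal_iff _).1 (N i).isInternal).1 j
      rw [AddSubgroup.disjoint_def] at hd
      refine hd (hx i) ?_
      let ev : (DirectSum ι fun i => (N i).carrier) →+ (N i).carrier := DFinsupp.evalAddMonoidHom i
      have hle : (⨆ l, ⨆ (_ : l ≠ j), directSumDeg N l) ≤
          AddSubgroup.comap ev (⨆ l, ⨆ (_ : l ≠ j), (N i).deg l) :=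
        iSup₂_le fun l hl y hy =>
          AddSubgroup.mem_comap.2 ((le_iSup₂_of_le l hl le_rfl :
            (N i).deg l ≤ ⨆ l, ⨆ (_ : l ≠ j), (N i).deg l) (hy i))
      exact hle hx'
    · rw [eq_top_iff]
      intro x _
      induction x using DirectSum.induction_on with
      | zero => exact zero_mem _
      | add x y hx hy => exact add_mem (hx trivial) (hy trivial)
      | of i m =>
        have hm : m ∈ ⨆ l, (N i).deg l := by
          rw [((isInternal_iff _).1 (N i).isInternal).2]; trivial
        suffices h : (⨆ l, (N i).deg l) ≤ AddSubgroup.comap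
            (DirectSum.of (fun i => (N i).carrier) i) (⨆ l, directSumDeg N l) from h hm
        refine iSup_le fun l y hy => AddSubgroup.mem_comap.2 (AddSubgroup.mem_iSup_of_mem l ?_)
        intro i'
        by_cases h : i = i'
        · subst h
          rw [DirectSum.of_eq_same]
          exact hy
        · rw [DirectSum.of_eq_of_ne _ _ _ (Ne.symm h)]
          exact zero_mem _
  smul_mem hb hx i := (N i).smul_mem hb (hx i)

/-- The projection from a direct sum to a summand. -/
def directSumProj {ι : Type} (N : ι → GrMod 𝒜) (i : ι) : directSum N ⟶ N i :=
  mkHom (M := directSum N) (DirectSum.component A ι (fun i => (N i).carrier) i) fun _ _ h => h i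

/-- The twist of a morphism. -/
def twistMap (a : ℤ) {M N : GrMod 𝒜} (f : M ⟶ N) : twist a M ⟶ twist a N :=
  mkHom (M := twist a M) (N := twist a N) (lin (M := M) (N := N) f)
    fun _ _ hm => lin_mem (M := M) (N := N) f hm

/-- The functor `M ↦ M(a)` on graded modules. -/
def twistFunctor (a : ℤ) : GrMod 𝒜 ⥤ GrMod 𝒜 where
  obj M := twist a M
  map f := twistMap a f
  map_id _ := rfl
  map_comp _ _ := rfl

/-- A morphism `M(a) ⟶ N` is the same as a morphism `M ⟶ N(-a)`. -/
def untwist (a : ℤ) {M N : GrMod 𝒜} (f : twist a M ⟶ N) : M ⟶ twist (-a) N :=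
  mkHom (M := M) (N := twist (-a) N) (lin (M := twist a M) (N := N) f) fun i m hm =>
    lin_mem (M := twist a M) (N := N) f (i := i - -a)
      (show m ∈ M.deg (i - -a - a) by simpa using hm)

/-- A morphism `M ⟶ N(-a)` is the same as a morphism `M(a) ⟶ N`. -/
def retwist (a : ℤ) {M N : GrMod 𝒜} (f : M ⟶ twist (-a) N) : twist a M ⟶ N :=
  mkHom (M := twist a M) (N := N) (lin (M := M) (N := twist (-a) N) f) fun i m hm => by
    have h : lin f m ∈ N.deg (i - a - -a) := lin_mem (M := M) (N := twist (-a) N) f (i := i - a) hm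
    rwa [sub_neg_eq_add, sub_add_cancel] at h

theorem IsProj.twist {P : GrMod 𝒜} (hP : IsProj P) (a : ℤ) : IsProj (twist a P) := by
  intro X Y p f hp
  obtain ⟨g, hg⟩ := hP _ _ (twistMap (-a) p) (untwist a f) hp
  have h := congrArg Hom.toLin hg
  exact ⟨retwist a g, hom_ext h⟩

/-! ## The stable module category -/

/-- Two morphisms are stably equal if their difference factors through a projective module. -/
def stableRel (𝒜 : ℕ → AddSubgroup A) : HomRel (GrMod 𝒜) := fun M N f g =>
  ∃ (P : GrMod 𝒜) (_ : IsProj P) (u : M ⟶ P) (v : P ⟶ N), lin f - lin g = lin (u ≫ v)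

end GrMod

open GrMod

section Stable

variable {A : Type} [Ring A]

/-- The (homotopy category of the) big stable module category: graded modules, with morphisms
taken modulo those which factor through a projective. -/
abbrev StModBig (𝒜 : ℕ → AddSubgroup A) : Type 1 := CategoryTheory.Quotient (stableRel 𝒜)

/-- The functor from graded modules to the big stable module category. -/
abbrev toSt (𝒜 : ℕ → AddSubgroup A) : GrMod 𝒜 ⥤ StModBig 𝒜 := CategoryTheory.Quotient.functor (stableRel 𝒜)

variable {𝒜 : ℕ → AddSubgroup A}

/-- Compact objects of the big stable module category: every morphism from `X` to a coproduct
(which is the direct sum of modules) comes from a finite subsum. This is surjectivity of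
`⨁ᵢ Hom(X, Nᵢ) → Hom(X, ⨁ᵢ Nᵢ)`; injectivity is automatic. -/
def IsCompactObj : ObjectProperty (StModBig 𝒜) := fun X =>
  ∀ (ι : Type) (N : ι → GrMod 𝒜) (f : X ⟶ (toSt 𝒜).obj (directSum N)),
    ∃ (s : Finset ι) (g : X.as ⟶ directSum N), (toSt 𝒜).map g = f ∧
      ∀ i, i ∉ s → lin (g ≫ directSumProj N i) = 0

/-- The (small) stable module category: the compact objects of the big one. -/
abbrev StMod (𝒜 : ℕ → AddSubgroup A) : Type 1 :=
  (IsCompactObj : ObjectProperty (StModBig 𝒜)).FullSubcategory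

/-- Twisting on the big stable module category. -/
def twBig (𝒜 : ℕ → AddSubgroup A) (a : ℤ) : StModBig 𝒜 ⥤ StModBig 𝒜 :=
  CategoryTheory.Quotient.lift _ (twistFunctor a ⋙ toSt 𝒜) (by
    rintro M N f g ⟨P, hP, u, v, h⟩
    exact CategoryTheory.Quotient.sound _ ⟨twist a P, hP.twist a, twistMap a u, twistMap a v, h⟩)

theorem isCompactObj_twBig (a : ℤ) (X : StModBig 𝒜) (hX : IsCompactObj X) :
    IsCompactObj ((twBig 𝒜 a).obj X) := by
  intro ι N f
  obtain ⟨f, rfl⟩ : ∃ f' : twist a X.as ⟶ directSum N, (toSt 𝒜).map f' = f :=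
    (toSt 𝒜).map_surjective f
  let F : (directSum fun i => twist (-a) (N i)) ⟶ twist (-a) (directSum N) :=
    mkHom (M := directSum fun i => twist (-a) (N i)) (N := twist (-a) (directSum N))
      LinearMap.id fun i m hm j => hm j
  let F' : twist (-a) (directSum N) ⟶ (directSum fun i => twist (-a) (N i)) :=
    mkHom (N := directSum fun i => twist (-a) (N i)) (M := twist (-a) (directSum N))
      LinearMap.id fun i m hm j => hm j
  let e : twist a (twist (-a) (directSum N)) ⟶ directSum N :=
    retwist a (𝟙 (twist (-a) (directSum N)))
  obtain ⟨s, g, hg, hs⟩ := hX ι (fun i => twist (-a) (N i)) ((toSt 𝒜).map (untwist a f ≫ F'))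
  refine ⟨s, twistMap a (g ≫ F) ≫ e, ?_, fun i hi => hs i hi⟩
  exact congrArg (fun q => (twBig 𝒜 a).map (q ≫ (toSt 𝒜).map F) ≫ (toSt 𝒜).map e) hg

/-- The twist functor `tw : M ↦ M(1)` on the stable module category. -/
def tw (𝒜 : ℕ → AddSubgroup A) : StMod 𝒜 ⥤ StMod 𝒜 :=
  ObjectProperty.lift _ (ObjectProperty.ι _ ⋙ twBig 𝒜 1)
    fun X => isCompactObj_twBig 1 X.obj X.property

/-! ## Cofiber sequences, complexity, and categorical entropy -/

/-- `X → Y → Z` is a cofiber sequence in the stable module category: it is isomorphic to the image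
of a short exact sequence of modules. -/
def IsCofiberSeq {X Y Z : StMod 𝒜} (f : X ⟶ Y) (g : Y ⟶ Z) : Prop :=
  ∃ (M N L : GrMod 𝒜) (i : M ⟶ N) (p : N ⟶ L)
    (eX : (toSt 𝒜).obj M ≅ X.obj) (eY : (toSt 𝒜).obj N ≅ Y.obj) (eZ : (toSt 𝒜).obj L ≅ Z.obj),
    IsShortExact i p ∧ (toSt 𝒜).map i ≫ eY.hom = eX.hom ≫ f.hom ∧
      (toSt 𝒜).map p ≫ eZ.hom = eY.hom ≫ g.hom

/-- `Z ≃ X[1]`: there is a cofiber sequence `X → 0 → Z`. -/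
def IsSuspension (X Z : StMod 𝒜) : Prop :=
  ∃ (O : StMod 𝒜) (f : X ⟶ O) (g : O ⟶ Z), Limits.IsZero O ∧ IsCofiberSeq f g

/-- `IsShift X n Z` means `Z ≃ X[n]`, for `n : ℤ`. -/
inductive IsShift (X : StMod 𝒜) : ℤ → StMod 𝒜 → Prop
  | iso {Z : StMod 𝒜} (e : X ≅ Z) : IsShift X 0 Z
  | up {n : ℤ} {Y Z : StMod 𝒜} : IsShift X n Y → IsSuspension Y Z → IsShift X (n + 1) Z
  | down {n : ℤ} {Y Z : StMod 𝒜} : IsShift X n Y → IsSuspension Z Y → IsShift X (n - 1) Z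

/-- `HasFiltration X ℓ Y` means that there is a filtration `0 = Y₀ → Y₁ → ⋯ → Y_ℓ = Y` such that the
cofiber of each `Yᵢ₋₁ → Yᵢ` is equivalent to `X[nᵢ]` for some integer `nᵢ`. -/
inductive HasFiltration (X : StMod 𝒜) : ℕ → StMod 𝒜 → Prop
  | zero {Y : StMod 𝒜} (h : Limits.IsZero Y) : HasFiltration X 0 Y
  | succ {ℓ : ℕ} {Y Y' Z : StMod 𝒜} (f : Y ⟶ Y') (g : Y' ⟶ Z) (n : ℤ) :
      HasFiltration X ℓ Y → IsCofiberSeq f g → IsShift X n Z → HasFiltration X (ℓ + 1) Y'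

/-- The complexity `δ(X, Y)`: the least length of a filtration with subquotients shifts of `X` of an
object of which `Y` is a retract, and `∞` if there is none. -/
noncomputable def complexity (X Y : StMod 𝒜) : ℕ∞ :=
  ⨅ ℓ ∈ {ℓ : ℕ | ∃ W, HasFiltration X ℓ W ∧ Nonempty (Retract Y W)}, (ℓ : ℕ∞)

/-- Thick subcategories: they contain the zero objects, are closed under retracts (in particular
under isomorphisms), and with two terms of a cofiber sequence contain the third (in particular
they are closed under shifts). -/
structure IsThick (P : ObjectProperty (StMod 𝒜)) : Prop where
  zero : ∀ X, Limits.IsZero X → P X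
  retract : ∀ X Y, Nonempty (Retract X Y) → P Y → P X
  third : ∀ {X Y Z : StMod 𝒜} (f : X ⟶ Y) (g : Y ⟶ Z), IsCofiberSeq f g → P X → P Y → P Z
  second : ∀ {X Y Z : StMod 𝒜} (f : X ⟶ Y) (g : Y ⟶ Z), IsCofiberSeq f g → P X → P Z → P Y
  first : ∀ {X Y Z : StMod 𝒜} (f : X ⟶ Y) (g : Y ⟶ Z), IsCofiberSeq f g → P Y → P Z → P X

/-- `G` is a generator: the thick subcategory it generates is everything. -/
def IsGenerator (G : StMod 𝒜) : Prop :=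
  ∀ P : ObjectProperty (StMod 𝒜), IsThick P → P G → ∀ X, P X

/-- `log δ(G, Fⁿ G)`. -/
noncomputable def logComplexity (F : StMod 𝒜 ⥤ StMod 𝒜) (G : StMod 𝒜) (n : ℕ) : EReal :=
  ENNReal.log (complexity G (F.obj^[n] G) : ENNReal)

/-- The categorical entropy of `F`, computed with the generator `G` (written as an upper limit, so
that it is always defined). -/
noncomputable def catEntropy (F : StMod 𝒜 ⥤ StMod 𝒜) (G : StMod 𝒜) : EReal :=
  limsup (fun n : ℕ => logComplexity F G n / (n : EReal)) atTop

/-- The categorical polynomial entropy of `F`, computed with the generator `G`. -/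
noncomputable def polEntropy (F : StMod 𝒜 ⥤ StMod 𝒜) (G : StMod 𝒜) : EReal :=
  limsup (fun n : ℕ => (logComplexity F G n - (n : EReal) * catEntropy F G) /
    ((Real.log n : ℝ) : EReal)) atTop

end Stable

namespace Steenrod

/-- The stable module category of `𝒜₁`. -/
abbrev StModA1 : Type 1 := StMod A1.degree

/-- The twist functor on the stable module category of `𝒜₁`. -/
noncomputable abbrev twA1 : StModA1 ⥤ StModA1 := tw A1.degree

end Steenrod

/-! ## Elementary constructions with graded modules -/

namespace GrMod

variable {A : Type} [Ring A] {𝒜 : ℕ → AddSubgroup A}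

@[simp] theorem lin_comp {M N L : GrMod 𝒜} (f : M ⟶ N) (g : N ⟶ L) :
    lin (f ≫ g) = lin g ∘ₗ lin f := rfl

theorem hom_ext_apply {M N : GrMod 𝒜} {f g : M ⟶ N} (h : ∀ x, lin f x = lin g x) : f = g :=
  hom_ext (LinearMap.ext h)

theorem iSup_deg (M : GrMod 𝒜) : ⨆ i, M.deg i = ⊤ := ((isInternal_iff _).1 M.isInternal).2

theorem hom_induction {M : GrMod 𝒜} {p : M.carrier → Prop} (x : M.carrier)
    (hom : ∀ i, ∀ x ∈ M.deg i, p x) (zero : p 0) (add : ∀ x y, p x → p y → p (x + y)) : p x := by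
  have hx : x ∈ ⨆ i, M.deg i := by rw [iSup_deg]; trivial
  exact AddSubgroup.iSup_induction (C := p) M.deg hx hom zero add

/-- The decomposition of a graded module as a direct sum. -/
noncomputable def decomp (M : GrMod 𝒜) : (DirectSum ℤ fun i => M.deg i) ≃+ M.carrier :=
  AddEquiv.ofBijective (DirectSum.coeAddMonoidHom M.deg) M.isInternal

theorem decomp_of (M : GrMod 𝒜) (i : ℤ) (x : M.deg i) :
    M.decomp (DirectSum.of (fun i => M.deg i) i x) = x :=
  DirectSum.coeAddMonoidHom_of M.deg i x

theorem decomp_symm_apply (M : GrMod 𝒜) {i : ℤ} {x : M.carrier} (hx : x ∈ M.deg i) :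
    M.decomp.symm x = DirectSum.of (fun i => M.deg i) i ⟨x, hx⟩ := by
  rw [AddEquiv.symm_apply_eq, decomp_of]

/-- The homogeneous components of an element. -/
noncomputable def comp (M : GrMod 𝒜) (i : ℤ) : M.carrier →+ M.carrier :=
  (M.deg i).subtype.comp ((DFinsupp.evalAddMonoidHom i).comp M.decomp.symm.toAddMonoidHom)

theorem comp_apply (M : GrMod 𝒜) (i : ℤ) (x : M.carrier) : M.comp i x = (M.decomp.symm x) i := rfl

theorem comp_mem (M : GrMod 𝒜) (i : ℤ) (x : M.carrier) : M.comp i x ∈ M.deg i :=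
  ((M.decomp.symm x) i).2

theorem comp_of_mem (M : GrMod 𝒜) {i : ℤ} {x : M.carrier} (hx : x ∈ M.deg i) :
    M.comp i x = x := by
  rw [comp_apply, decomp_symm_apply M hx, DirectSum.of_eq_same]

theorem comp_of_mem_ne (M : GrMod 𝒜) {i j : ℤ} {x : M.carrier} (hx : x ∈ M.deg i) (h : j ≠ i) :
    M.comp j x = 0 := by
  rw [comp_apply, decomp_symm_apply M hx, DirectSum.of_eq_of_ne _ _ _ h]; rfl

theorem exists_sum_comp (M : GrMod 𝒜) (x : M.carrier) :
    ∃ s : Finset ℤ, x = ∑ i ∈ s, M.comp i x := by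
  classical
  refine ⟨(M.decomp.symm x).support, ?_⟩
  conv_lhs => rw [← M.decomp.apply_symm_apply x]
  exact DirectSum.coeAddMonoidHom_eq_dfinsuppSum M.deg _

theorem mem_of_comp_mem {M : GrMod 𝒜} {S : Type} [SetLike S M.carrier]
    [AddSubmonoidClass S M.carrier] (K : S) {x : M.carrier} (h : ∀ i, M.comp i x ∈ K) : x ∈ K := by
  obtain ⟨s, hs⟩ := M.exists_sum_comp x
  rw [hs]
  exact sum_mem fun i _ => h i

theorem eq_zero_of_comp {M : GrMod 𝒜} {x : M.carrier} (h : ∀ i, M.comp i x = 0) : x = 0 :=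
  mem_of_comp_mem (⊥ : AddSubgroup M.carrier) h

theorem map_comp_apply {M N : GrMod 𝒜} (f : M ⟶ N) (i : ℤ) (x : M.carrier) :
    lin f (M.comp i x) = N.comp i (lin f x) := by
  refine hom_induction (p := fun x => lin f (M.comp i x) = N.comp i (lin f x)) x (fun j x hx => ?_) 
    (by simp only [map_zero])
    (fun x y hx hy => by simp only [map_add, hx, hy])
  by_cases h : i = j
  · subst h
    rw [comp_of_mem _ hx, comp_of_mem _ (lin_mem f hx)]
  · rw [comp_of_mem_ne _ hx h, comp_of_mem_ne _ (lin_mem f hx) h, map_zero]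

theorem exists_addMonoidHom {M : GrMod 𝒜} {X : Type} [AddCommGroup X] (φ : ∀ i, M.deg i →+ X) :
    ∃ ψ : M.carrier →+ X, ∀ i x (h : x ∈ M.deg i), ψ x = φ i ⟨x, h⟩ := by
  refine ⟨(DirectSum.toAddMonoid φ).comp M.decomp.symm.toAddMonoidHom, fun i x h => ?_⟩
  change DirectSum.toAddMonoid φ (M.decomp.symm x) = _
  rw [decomp_symm_apply M h, DirectSum.toAddMonoid_of]

theorem mem_deg_of_injective {M N : GrMod 𝒜} {f : M ⟶ N} (hf : Function.Injective (lin f)) {i : ℤ}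
    {x : M.carrier} (hx : lin f x ∈ N.deg i) : x ∈ M.deg i := by
  have : M.comp i x = x := hf (by rw [map_comp_apply, comp_of_mem _ hx])
  exact this ▸ comp_mem _ _ _

theorem exists_mem_deg_of_surjective {M N : GrMod 𝒜} {f : M ⟶ N}
    (hf : Function.Surjective (lin f)) {i : ℤ} {y : N.carrier} (hy : y ∈ N.deg i) :
    ∃ x ∈ M.deg i, lin f x = y := by
  obtain ⟨x, rfl⟩ := hf y
  exact ⟨M.comp i x, comp_mem _ _ _, by rw [map_comp_apply, comp_of_mem _ hy]⟩

/-- A criterion for being a grading. -/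
theorem isInternal_of_comp {M : Type} [AddCommGroup M] (D : ℤ → AddSubgroup M) (π : ℤ → M →+ M)
    (h1 : ∀ i, ∀ x ∈ D i, π i x = x) (h2 : ∀ i j, j ≠ i → ∀ x ∈ D i, π j x = 0)
    (h3 : ⨆ i, D i = ⊤) : DirectSum.IsInternal D := by
  refine (isInternal_iff D).2 ⟨fun i => ?_, h3⟩
  rw [AddSubgroup.disjoint_def]
  intro x hx hx'
  rw [← h1 i x hx]
  have : (⨆ j, ⨆ (_ : j ≠ i), D j) ≤ (π i).ker :=
    iSup₂_le fun j hj y hy => h2 j i hj.symm y hy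
  exact this hx'

/-- The zero module. -/
def zero (𝒜 : ℕ → AddSubgroup A) : GrMod 𝒜 where
  carrier := PUnit
  deg _ := ⊤
  isInternal := isInternal_of_comp _ (fun _ => 0) (fun _ _ _ => rfl) (fun _ _ _ _ _ => rfl) (by simp)
  smul_mem _ _ := trivial

/-- A homogeneous submodule, as a graded module. -/
noncomputable def sub (M : GrMod 𝒜) (K : Submodule A M.carrier)
    (hK : ∀ i, ∀ x ∈ K, M.comp i x ∈ K) : GrMod 𝒜 where
  carrier := K
  deg i := (M.deg i).comap K.subtype.toAddMonoidHom
  isInternal := by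
    refine isInternal_of_comp _
      (fun i => ((M.comp i).comp K.subtype.toAddMonoidHom).codRestrict K.toAddSubgroup
        fun x => hK i x.1 x.2)
      (fun i x hx => Subtype.ext (M.comp_of_mem hx))
      (fun i j hij x hx => Subtype.ext (M.comp_of_mem_ne hx hij)) ?_
    rw [eq_top_iff]
    intro x _
    obtain ⟨s, hs⟩ := M.exists_sum_comp x.1
    have : x = ∑ i ∈ s, (⟨M.comp i x.1, hK i x.1 x.2⟩ : K) := Subtype.ext (by simpa using hs)
    rw [this]
    exact sum_mem fun i _ => AddSubgroup.mem_iSup_of_mem i (M.comp_mem i x.1)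
  smul_mem ha hm := M.smul_mem ha hm

/-- The inclusion of a homogeneous submodule. -/
noncomputable def subι (M : GrMod 𝒜) (K : Submodule A M.carrier)
    (hK : ∀ i, ∀ x ∈ K, M.comp i x ∈ K) : M.sub K hK ⟶ M :=
  mkHom (M := M.sub K hK) K.subtype fun _ _ h => h

theorem subι_injective (M : GrMod 𝒜) (K : Submodule A M.carrier)
    (hK : ∀ i, ∀ x ∈ K, M.comp i x ∈ K) : Function.Injective (lin (M.subι K hK)) :=
  Subtype.val_injective

/-- The quotient by a homogeneous submodule, as a graded module. -/
noncomputable def quot (M : GrMod 𝒜) (K : Submodule A M.carrier)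
    (hK : ∀ i, ∀ x ∈ K, M.comp i x ∈ K) : GrMod 𝒜 where
  carrier := M.carrier ⧸ K
  deg i := (M.deg i).map K.mkQ.toAddMonoidHom
  isInternal := by
    refine (isInternal_iff _).2 ⟨fun i => ?_, ?_⟩
    · rw [AddSubgroup.disjoint_def]
      rintro _ ⟨x, hx, rfl⟩ h
      simp only [← AddSubgroup.map_iSup] at h
      obtain ⟨y, hy, hxy⟩ := h
      have hy0 : M.comp i y = 0 := by
        have : (⨆ j, ⨆ (_ : j ≠ i), M.deg j) ≤ (M.comp i).ker :=
          iSup₂_le fun j hj z hz => M.comp_of_mem_ne hz hj.symm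
        exact this hy
      have hm : x - y ∈ K := ((Submodule.Quotient.eq K).1 hxy.symm)
      have := hK i _ hm
      rw [map_sub, hy0, sub_zero, M.comp_of_mem hx] at this
      exact (Submodule.Quotient.mk_eq_zero K).2 this
    · rw [← AddSubgroup.map_iSup, iSup_deg, ← AddMonoidHom.range_eq_map,
        AddMonoidHom.range_eq_top]
      exact K.mkQ_surjective
  smul_mem := by
    rintro i j a _ ha ⟨x, hx, rfl⟩
    exact ⟨a • x, M.smul_mem ha hx, rfl⟩

/-- The projection to the quotient by a homogeneous submodule. -/
noncomputable def quotπ (M : GrMod 𝒜) (K : Submodule A M.carrier)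
    (hK : ∀ i, ∀ x ∈ K, M.comp i x ∈ K) : M ⟶ M.quot K hK :=
  mkHom (N := M.quot K hK) K.mkQ fun _ x h => ⟨x, h, rfl⟩

theorem quotπ_surjective (M : GrMod 𝒜) (K : Submodule A M.carrier)
    (hK : ∀ i, ∀ x ∈ K, M.comp i x ∈ K) : Function.Surjective (lin (M.quotπ K hK)) :=
  K.mkQ_surjective

/-- The direct sum of two graded modules. -/
noncomputable def prod (M N : GrMod 𝒜) : GrMod 𝒜 where
  carrier := M.carrier × N.carrier
  deg i := (M.deg i).prod (N.deg i)
  isInternal := by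
    refine isInternal_of_comp _ (fun i => (M.comp i).prodMap (N.comp i))
      (fun i x hx => Prod.ext (M.comp_of_mem hx.1) (N.comp_of_mem hx.2))
      (fun i j hij x hx => Prod.ext (M.comp_of_mem_ne hx.1 hij) (N.comp_of_mem_ne hx.2 hij)) ?_
    rw [eq_top_iff]
    rintro ⟨x, y⟩ _
    have h1 : (x, (0 : N.carrier)) ∈ ⨆ i, (M.deg i).prod (N.deg i) := by
      refine hom_induction (p := fun x => (x, (0 : N.carrier)) ∈ ⨆ i, (M.deg i).prod (N.deg i)) x
        (fun i x hx => ?_) (zero_mem _) fun x y hx hy => ?_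
      · exact AddSubgroup.mem_iSup_of_mem i ⟨hx, zero_mem _⟩
      · simpa using add_mem hx hy
    have h2 : ((0 : M.carrier), y) ∈ ⨆ i, (M.deg i).prod (N.deg i) := by
      refine hom_induction (p := fun y => ((0 : M.carrier), y) ∈ ⨆ i, (M.deg i).prod (N.deg i)) y
        (fun i x hx => ?_) (zero_mem _) fun x y hx hy => ?_
      · exact AddSubgroup.mem_iSup_of_mem i ⟨zero_mem _, hx⟩
      · simpa using add_mem hx hy
    simpa using add_mem h1 h2
  smul_mem ha hm := ⟨M.smul_mem ha hm.1, N.smul_mem ha hm.2⟩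

/-- The first inclusion. -/
noncomputable def prodInl (M N : GrMod 𝒜) : M ⟶ M.prod N :=
  mkHom (N := M.prod N) (LinearMap.inl A M.carrier N.carrier) fun _ _ h => ⟨h, zero_mem _⟩

/-- The second inclusion. -/
noncomputable def prodInr (M N : GrMod 𝒜) : N ⟶ M.prod N :=
  mkHom (N := M.prod N) (LinearMap.inr A M.carrier N.carrier) fun _ _ h => ⟨zero_mem _, h⟩

/-- The first projection. -/
noncomputable def prodFst (M N : GrMod 𝒜) : M.prod N ⟶ M :=
  mkHom (M := M.prod N) (LinearMap.fst A M.carrier N.carrier) fun _ _ h => h.1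

/-- The second projection. -/
noncomputable def prodSnd (M N : GrMod 𝒜) : M.prod N ⟶ N :=
  mkHom (M := M.prod N) (LinearMap.snd A M.carrier N.carrier) fun _ _ h => h.2

/-- The morphism to a direct sum with given components. -/
noncomputable def prodLift {X M N : GrMod 𝒜} (f : X ⟶ M) (g : X ⟶ N) : X ⟶ M.prod N :=
  mkHom (N := M.prod N) ((lin f).prod (lin g)) fun _ _ h => ⟨lin_mem f h, lin_mem g h⟩

/-- The morphism from a direct sum with given components. -/
noncomputable def prodDesc {X M N : GrMod 𝒜} (f : M ⟶ X) (g : N ⟶ X) : M.prod N ⟶ X :=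
  mkHom (M := M.prod N) ((lin f).coprod (lin g)) fun _ _ h =>
    add_mem (lin_mem f h.1) (lin_mem g h.2)

/-- The direct sum of two morphisms. -/
noncomputable def prodMap {M N M' N' : GrMod 𝒜} (f : M ⟶ M') (g : N ⟶ N') :
    M.prod N ⟶ M'.prod N' :=
  mkHom (M := M.prod N) (N := M'.prod N') ((lin f).prodMap (lin g)) fun _ _ h =>
    ⟨lin_mem f h.1, lin_mem g h.2⟩

/-- The negative of a morphism. -/
def negHom {M N : GrMod 𝒜} (f : M ⟶ N) : M ⟶ N :=
  mkHom (-lin f) fun _ _ h => neg_mem (lin_mem f h)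

/-- The difference of two morphisms. -/
def subHom {M N : GrMod 𝒜} (f g : M ⟶ N) : M ⟶ N :=
  mkHom (lin f - lin g) fun _ _ h => sub_mem (lin_mem f h) (lin_mem g h)

/-- The zero morphism. -/
def zeroHom (M N : GrMod 𝒜) : M ⟶ N :=
  mkHom 0 fun _ _ _ => zero_mem _

/-! ### Short exact sequences -/

theorem comp_mem_ker {M N : GrMod 𝒜} (f : M ⟶ N) (i : ℤ) (x : M.carrier)
    (hx : x ∈ LinearMap.ker (lin f)) : M.comp i x ∈ LinearMap.ker (lin f) := by
  rw [LinearMap.mem_ker] at *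
  rw [map_comp_apply, hx, map_zero]

theorem comp_mem_range {M N : GrMod 𝒜} (f : M ⟶ N) (i : ℤ) (y : N.carrier)
    (hy : y ∈ LinearMap.range (lin f)) : N.comp i y ∈ LinearMap.range (lin f) := by
  obtain ⟨x, rfl⟩ := hy
  exact ⟨M.comp i x, map_comp_apply _ _ _⟩

/-- The kernel of a morphism. -/
noncomputable def ker {M N : GrMod 𝒜} (f : M ⟶ N) : GrMod 𝒜 :=
  M.sub (LinearMap.ker (lin f)) (comp_mem_ker f)

/-- The inclusion of the kernel of a morphism. -/
noncomputable def kerι {M N : GrMod 𝒜} (f : M ⟶ N) : ker f ⟶ M :=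
  M.subι (LinearMap.ker (lin f)) (comp_mem_ker f)

/-- The cokernel of a morphism. -/
noncomputable def coker {M N : GrMod 𝒜} (f : M ⟶ N) : GrMod 𝒜 :=
  N.quot (LinearMap.range (lin f)) (comp_mem_range f)

/-- The projection to the cokernel of a morphism. -/
noncomputable def cokerπ {M N : GrMod 𝒜} (f : M ⟶ N) : N ⟶ coker f :=
  N.quotπ (LinearMap.range (lin f)) (comp_mem_range f)

theorem isShortExact_ker {M N : GrMod 𝒜} (f : M ⟶ N) (hf : Function.Surjective (lin f)) :
    IsShortExact (kerι f) f := by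
  refine ⟨M.subι_injective _ _, fun x => ⟨fun h => ⟨⟨x, h⟩, rfl⟩, ?_⟩, hf⟩
  rintro ⟨y, rfl⟩
  exact y.2

theorem isShortExact_coker {M N : GrMod 𝒜} (f : M ⟶ N) (hf : Function.Injective (lin f)) :
    IsShortExact f (cokerπ f) :=
  ⟨hf, fun _ => Submodule.Quotient.mk_eq_zero (LinearMap.range (lin f)), N.quotπ_surjective _ _⟩

section

variable {M N L : GrMod 𝒜} {i : M ⟶ N} {p : N ⟶ L}

theorem IsShortExact.apply_apply (h : IsShortExact i p) (x : M.carrier) : lin p (lin i x) = 0 :=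
  (h.2.1 _).2 ⟨x, rfl⟩

theorem IsShortExact.exists_lift (h : IsShortExact i p) {X : GrMod 𝒜} (g : X ⟶ N)
    (hg : ∀ x, lin p (lin g x) = 0) : ∃ g' : X ⟶ M, ∀ x, lin i (lin g' x) = lin g x := by
  have hr : ∀ x, lin g x ∈ LinearMap.range (lin i) := fun x => (h.2.1 _).1 (hg x)
  let φ := (LinearEquiv.ofInjective (lin i) h.1).symm.toLinearMap ∘ₗ (lin g).codRestrict _ hr
  have hφ : ∀ x, lin i (φ x) = lin g x := fun x => by
    have := (LinearEquiv.ofInjective (lin i) h.1).apply_symm_apply ((lin g).codRestrict _ hr x)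
    exact congrArg Subtype.val this
  exact ⟨mkHom φ fun j x hx => mem_deg_of_injective h.1 (hφ x ▸ lin_mem g hx), hφ⟩

theorem IsShortExact.exists_desc (h : IsShortExact i p) {X : GrMod 𝒜} (g : N ⟶ X)
    (hg : ∀ x, lin g (lin i x) = 0) : ∃ g' : L ⟶ X, ∀ x, lin g' (lin p x) = lin g x := by
  have hk : LinearMap.ker (lin p) ≤ LinearMap.ker (lin g) := fun x hx => by
    obtain ⟨y, rfl⟩ := (h.2.1 _).1 hx
    exact hg y
  let φ := (LinearMap.ker (lin p)).liftQ (lin g) hk ∘ₗ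
    ((lin p).quotKerEquivOfSurjective h.2.2).symm.toLinearMap
  have hφ : ∀ x, φ (lin p x) = lin g x := fun x => by
    have : ((lin p).quotKerEquivOfSurjective h.2.2).symm (lin p x) =
      (LinearMap.ker (lin p)).mkQ x := by
      rw [LinearEquiv.symm_apply_eq]; rfl
    change (LinearMap.ker (lin p)).liftQ (lin g) hk
      (((lin p).quotKerEquivOfSurjective h.2.2).symm (lin p x)) = _
    rw [this]; rfl
  refine ⟨mkHom φ fun j y hy => ?_, hφ⟩
  obtain ⟨x, hx, rfl⟩ := exists_mem_deg_of_surjective h.2.2 hy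
  exact hφ x ▸ lin_mem g hx

end

/-- There is a short exact sequence `0 → M → N → L → 0`. -/
def SES (M N L : GrMod 𝒜) : Prop := ∃ (i : M ⟶ N) (p : N ⟶ L), IsShortExact i p

theorem SES.prod {M N L M' N' L' : GrMod 𝒜} (h : SES M N L) (h' : SES M' N' L') :
    SES (M.prod M') (N.prod N') (L.prod L') := by
  obtain ⟨i, p, h⟩ := h
  obtain ⟨i', p', h'⟩ := h'
  refine ⟨prodMap i i', prodMap p p', h.1.prodMap h'.1, ?_, h.2.2.prodMap h'.2.2⟩
  rintro ⟨x, y⟩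
  constructor
  · intro hxy
    obtain ⟨a, rfl⟩ := (h.2.1 x).1 (congrArg Prod.fst hxy)
    obtain ⟨b, rfl⟩ := (h'.2.1 y).1 (congrArg Prod.snd hxy)
    exact ⟨(a, b), rfl⟩
  · rintro ⟨⟨a, b⟩, hab⟩
    rw [← hab]
    exact Prod.ext (h.apply_apply a) (h'.apply_apply b)

theorem SES.split (M N : GrMod 𝒜) : SES M (M.prod N) N := by
  refine ⟨prodInl M N, prodSnd M N, fun x y h => congrArg Prod.fst h, fun x => ⟨fun h => ?_, ?_⟩,
    fun x => ⟨((0 : M.carrier), x), rfl⟩⟩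
  · exact ⟨x.1, Prod.ext rfl h.symm⟩
  · rintro ⟨y, rfl⟩
    rfl

theorem SES.of_bijective {M N : GrMod 𝒜} (f : M ⟶ N) (hf : Function.Bijective (lin f)) :
    SES M N (zero 𝒜) :=
  ⟨f, zeroHom _ _, hf.1, fun x => ⟨fun _ => hf.2 x, fun _ => rfl⟩, fun _ => ⟨0, rfl⟩⟩

theorem SES.left_zero (M : GrMod 𝒜) : SES (zero 𝒜) M M :=
  ⟨zeroHom _ _, 𝟙 M, fun _ _ _ => rfl,
    fun x => ⟨fun h => ⟨0, (map_zero _).trans h.symm⟩, by rintro ⟨y, rfl⟩; rfl⟩, fun x => ⟨x, rfl⟩⟩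

theorem SES.right_zero (M : GrMod 𝒜) : SES M M (zero 𝒜) :=
  SES.of_bijective (𝟙 M) Function.bijective_id

/-- A filtration of the quotient is pulled back to the middle term. -/
theorem SES.exists_ker {M N L L₀ S : GrMod 𝒜} (h : SES M N L) (h' : SES L₀ L S) :
    ∃ N₀, SES M N₀ L₀ ∧ SES N₀ N S := by
  obtain ⟨i, p, h⟩ := h
  obtain ⟨j, q, h'⟩ := h'
  have hpq : Function.Surjective (lin (p ≫ q)) := h'.2.2.comp h.2.2
  have hk := isShortExact_ker (p ≫ q) hpq
  refine ⟨ker (p ≫ q), ?_, _, _, hk⟩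
  obtain ⟨i', hi'⟩ := hk.exists_lift i fun x => by
    rw [lin_comp, LinearMap.comp_apply, h.apply_apply, map_zero]
  obtain ⟨p', hp'⟩ := h'.exists_lift (kerι (p ≫ q) ≫ p) fun x => x.2
  refine ⟨i', p', fun x y hxy => h.1 (by rw [← hi', hxy, hi']), fun x => ⟨fun hx => ?_, ?_⟩,
    fun y => ?_⟩
  · have : lin p (lin (kerι (p ≫ q)) x) = 0 := by
      have := hp' x
      rw [hx, map_zero] at this
      exact this.symm
    obtain ⟨m, hm⟩ := (h.2.1 _).1 this
    exact ⟨m, hk.1 (by rw [hi', hm])⟩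
  · rintro ⟨m, rfl⟩
    refine h'.1 ?_
    rw [hp', map_zero, lin_comp, LinearMap.comp_apply, hi', h.apply_apply]
  · obtain ⟨x, hx⟩ := h.2.2 (lin j y)
    have hx' : lin (p ≫ q) x = 0 := by
      rw [lin_comp, LinearMap.comp_apply, hx, h'.apply_apply]
    exact ⟨⟨x, hx'⟩, h'.1 ((hp' _).trans hx)⟩

/-- A filtration of the submodule is pushed forward to the middle term. -/
theorem SES.exists_coker {M N L M₀ S : GrMod 𝒜} (h : SES M N L) (h' : SES M₀ M S) :
    ∃ Z, SES M₀ N Z ∧ SES S Z L := by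
  obtain ⟨i, p, h⟩ := h
  obtain ⟨j, q, h'⟩ := h'
  have hc := isShortExact_coker (j ≫ i) (h.1.comp h'.1)
  refine ⟨coker (j ≫ i), ⟨_, _, hc⟩, ?_⟩
  obtain ⟨u, hu⟩ := h'.exists_desc (i ≫ cokerπ (j ≫ i)) fun x => hc.apply_apply x
  obtain ⟨v, hv⟩ := hc.exists_desc p fun x => by
    rw [lin_comp, LinearMap.comp_apply, h.apply_apply]
  refine ⟨u, v, ?_, fun z => ⟨fun hz => ?_, ?_⟩, fun l => ?_⟩
  · rw [injective_iff_map_eq_zero]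
    intro y hy
    obtain ⟨m, rfl⟩ := h'.2.2 y
    rw [hu] at hy
    obtain ⟨m₀, hm₀⟩ := (hc.2.1 _).1 hy
    have : lin j m₀ = m := h.1 hm₀
    rw [← this, h'.apply_apply]
  · obtain ⟨n, rfl⟩ := hc.2.2 z
    rw [hv] at hz
    obtain ⟨m, rfl⟩ := (h.2.1 _).1 hz
    exact ⟨lin q m, hu m⟩
  · rintro ⟨y, rfl⟩
    obtain ⟨m, rfl⟩ := h'.2.2 y
    rw [hu, lin_comp, LinearMap.comp_apply, hv, h.apply_apply]
  · obtain ⟨n, rfl⟩ := h.2.2 l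
    exact ⟨_, hv n⟩

theorem SES.twist {M N L : GrMod 𝒜} (h : SES M N L) (a : ℤ) :
    SES (twist a M) (twist a N) (twist a L) := by
  obtain ⟨i, p, h⟩ := h
  exact ⟨twistMap a i, twistMap a p, h⟩

end GrMod

/-! ## `𝒜₁` and its regular representation -/

namespace Steenrod

/-- The degrees of the basis `1, s, t, st, ts, sts, tst, stst` of `𝒜₁`, `s = Sq¹`, `t = Sq²`. -/
def basisDeg : Fin 8 → ℕ := ![0, 1, 2, 3, 3, 4, 5, 6]

/-- The pairs `(i, j)` for which `Sqⁿ` of the `j`-th basis vector contains the `i`-th one. -/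
def sqEntries : ℕ → List (Fin 8 × Fin 8)
  | 0 => [(0, 0), (1, 1), (2, 2), (3, 3), (4, 4), (5, 5), (6, 6), (7, 7)]
  | 1 => [(1, 0), (3, 2), (5, 4), (7, 6)]
  | 2 => [(2, 0), (4, 1), (5, 2), (6, 3), (7, 5)]
  | 3 => [(3, 0), (5, 1), (7, 3)]
  | 4 => [(6, 1)]
  | 5 => [(7, 1)]
  | 6 => [(7, 0)]
  | _ => []

/-- The matrix of `Sqⁿ` in an action of the Steenrod algebra that extends the regular representation
of `𝒜₁`. -/
def sqMat (n : ℕ) : Matrix (Fin 8) (Fin 8) (ZMod 2) :=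
  Matrix.of fun i j => if (i, j) ∈ sqEntries n then 1 else 0

/-- A matrix which raises degrees by `n`. -/
def MatDeg (n : ℕ) (m : Matrix (Fin 8) (Fin 8) (ZMod 2)) : Prop :=
  ∀ i j, m i j ≠ 0 → basisDeg i = basisDeg j + n

theorem matDeg_sqMat (n : ℕ) : MatDeg n (sqMat n) := by
  have key : ∀ i j, (i, j) ∈ sqEntries n → basisDeg i = basisDeg j + n := by
    match n with
    | 0 => decide
    | 1 => decide
    | 2 => decide
    | 3 => decide
    | 4 => decide
    | 5 => decide
    | 6 => decide
    | n + 7 => simp [sqEntries]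
  exact fun i j h => key i j (by by_contra h'; exact h (by simp [sqMat, h']))

theorem MatDeg.mul {n n' : ℕ} {m m' : Matrix (Fin 8) (Fin 8) (ZMod 2)} (h : MatDeg n m)
    (h' : MatDeg n' m') : MatDeg (n + n') (m * m') := by
  intro i j hij
  rw [Matrix.mul_apply] at hij
  obtain ⟨k, -, hk⟩ := Finset.exists_ne_zero_of_sum_ne_zero hij
  have h1 := h i k (left_ne_zero_of_mul hk)
  have h2 := h' k j (right_ne_zero_of_mul hk)
  omega

theorem basisDeg_le (i : Fin 8) : basisDeg i ≤ 6 := by revert i; decide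

theorem MatDeg.eq_zero {n : ℕ} {m : Matrix (Fin 8) (Fin 8) (ZMod 2)} (h : MatDeg n m)
    (hn : 6 < n) : m = 0 := by
  ext i j
  by_contra hij
  have := h i j hij
  have := basisDeg_le i
  omega

theorem sqMat_adem (a b : ℕ) (ha : 0 < a) (hab : a < 2 * b) :
    sqMat a * sqMat b = ∑ c ∈ Finset.range (a / 2 + 1),
      (((b - c - 1).choose (a - 2 * c) : ℕ) : ZMod 2) • (sqMat (a + b - c) * sqMat c) := by
  by_cases h : 6 < a + b
  · rw [((matDeg_sqMat a).mul (matDeg_sqMat b)).eq_zero h, Finset.sum_eq_zero]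
    intro c hc
    rw [Finset.mem_range] at hc
    rw [((matDeg_sqMat (a + b - c)).mul (matDeg_sqMat c)).eq_zero (by omega), smul_zero]
  · have hb : b ≤ 6 := by omega
    have ha : a ≤ 6 := by omega
    interval_cases b <;> interval_cases a <;> first | omega | decide +kernel

/-- An action of the Steenrod algebra which extends the regular representation of `𝒜₁`. -/
noncomputable def rep : SteenrodAlgebra →ₐ[ZMod 2] Matrix (Fin 8) (Fin 8) (ZMod 2) :=
  RingQuot.liftAlgHom (ZMod 2) ⟨FreeAlgebra.lift (ZMod 2) sqMat, by
    intro x y h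
    induction h with
    | sq_zero =>
      rw [FreeAlgebra.lift_ι_apply, map_one]
      decide +kernel
    | adem a b ha hab =>
      simp only [map_mul, map_sum, map_smul, FreeAlgebra.lift_ι_apply]
      exact sqMat_adem a b ha hab⟩

@[simp] theorem rep_Sq (n : ℕ) : rep (Sq n) = sqMat n := by
  simp [rep, Sq]

/-- The augmentation of the Steenrod algebra. -/
noncomputable def aug : SteenrodAlgebra →ₐ[ZMod 2] ZMod 2 :=
  RingQuot.liftAlgHom (ZMod 2) ⟨FreeAlgebra.lift (ZMod 2) fun n => if n = 0 then 1 else 0, by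
    intro x y h
    induction h with
    | sq_zero => simp
    | adem a b ha hab =>
      simp only [map_mul, map_sum, map_smul, FreeAlgebra.lift_ι_apply]
      rw [if_neg ha.ne', zero_mul, Finset.sum_eq_zero]
      intro c hc
      rw [Finset.mem_range] at hc
      rw [if_neg (by omega), zero_mul, smul_zero]⟩

@[simp] theorem aug_Sq (n : ℕ) : aug (Sq n) = if n = 0 then 1 else 0 := by
  simp [aug, Sq]

theorem matDeg_rep {n : ℕ} {x : SteenrodAlgebra} (hx : x ∈ SteenrodAlgebra.degree n) :
    MatDeg n (rep x) := by
  induction hx using AddSubgroup.closure_induction with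
  | mem x hx =>
    obtain ⟨l, rfl, rfl⟩ := hx
    induction l with
    | nil =>
      simp only [List.map_nil, List.prod_nil, map_one, List.sum_nil]
      exact fun i j hij => by rw [not_imp_comm.1 Matrix.one_apply_ne hij, add_zero]
    | cons a l ih =>
      simp only [List.map_cons, List.prod_cons, List.sum_cons, map_mul, rep_Sq]
      exact (matDeg_sqMat a).mul ih
  | zero => intro i j h; simp at h
  | add x y _ _ hx hy =>
    intro i j h
    by_cases hxij : rep x i j = 0
    · exact hy i j fun h0 => h (by rw [map_add, Matrix.add_apply, hxij, h0, add_zero])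
    · exact hx i j hxij
  | neg x _ hx => intro i j h; exact hx i j fun h0 => h (by simp [h0])

theorem aug_eq_zero {n : ℕ} (hn : n ≠ 0) {x : SteenrodAlgebra}
    (hx : x ∈ SteenrodAlgebra.degree n) : aug x = 0 := by
  induction hx using AddSubgroup.closure_induction with
  | mem x hx =>
    obtain ⟨l, rfl, rfl⟩ := hx
    rw [map_list_prod, List.prod_eq_zero_iff]
    by_contra h
    refine hn (List.sum_eq_zero fun a ha => ?_)
    by_contra ha0
    exact h (List.mem_map.2 ⟨Sq a, List.mem_map.2 ⟨a, ha, rfl⟩, by simp [ha0]⟩)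
  | zero => exact map_zero _
  | add x y _ _ hx hy => rw [map_add, hx, hy, add_zero]
  | neg x _ hx => rw [map_neg, hx, neg_zero]

/-- `Sq¹`, as an element of `𝒜₁`. -/
noncomputable def sq1 : A1 := ⟨Sq 1, Algebra.subset_adjoin (by simp)⟩

/-- `Sq²`, as an element of `𝒜₁`. -/
noncomputable def sq2 : A1 := ⟨Sq 2, Algebra.subset_adjoin (by simp)⟩

theorem Sq_zero : Sq 0 = 1 := by
  rw [Sq, RingQuot.mkAlgHom_rel (ZMod 2) AdemRel.sq_zero, map_one]

theorem Sq_adem (a b : ℕ) (ha : 0 < a) (hab : a < 2 * b) :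
    Sq a * Sq b = ∑ c ∈ Finset.range (a / 2 + 1),
      (((b - c - 1).choose (a - 2 * c) : ℕ) : ZMod 2) • (Sq (a + b - c) * Sq c) := by
  have := RingQuot.mkAlgHom_rel (ZMod 2) (AdemRel.adem a b ha hab)
  simp only [map_mul, map_sum, map_smul] at this
  exact this

theorem sq1_mul_sq1 : sq1 * sq1 = 0 := by
  refine Subtype.ext ((Sq_adem 1 1 (by norm_num) (by norm_num)).trans ?_)
  simp

theorem sq2_mul_sq2 : sq2 * sq2 = sq1 * sq2 * sq1 := by
  have h1 : Sq 1 * Sq 2 = Sq 3 := by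
    rw [Sq_adem 1 2 (by norm_num) (by norm_num)]
    simp [Sq_zero]
  have h2 : Sq 2 * Sq 2 = Sq 3 * Sq 1 := by
    rw [Sq_adem 2 2 (by norm_num) (by norm_num)]
    simp [Finset.sum_range_succ]
  refine Subtype.ext (h2.trans ?_)
  rw [← h1]; rfl

theorem sq1_mem : sq1 ∈ A1.degree 1 :=
  AddSubgroup.subset_closure ⟨[1], by simp, by simp [sq1]⟩

theorem sq2_mem : sq2 ∈ A1.degree 2 :=
  AddSubgroup.subset_closure ⟨[2], by simp, by simp [sq2]⟩

theorem A1_induction {p : A1 → Prop} (a : A1) (h1 : p sq1) (h2 : p sq2)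
    (h0 : ∀ r : ZMod 2, p (algebraMap (ZMod 2) A1 r)) (add : ∀ a b, p a → p b → p (a + b))
    (mul : ∀ a b, p a → p b → p (a * b)) : p a := by
  obtain ⟨a, ha⟩ := a
  induction ha using Algebra.adjoin_induction with
  | mem x hx =>
    rcases hx with rfl | rfl
    · exact h1
    · exact h2
  | algebraMap r => exact h0 r
  | add x y hx hy ihx ihy => exact add ⟨x, hx⟩ ⟨y, hy⟩ ihx ihy
  | mul x y hx hy ihx ihy => exact mul ⟨x, hx⟩ ⟨y, hy⟩ ihx ihy

end Steenrod

/-! ## The trace and relatively projective modules -/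

namespace Steenrod

open GrMod

/-- Graded modules over `𝒜₁`. -/
abbrev GrModA1 : Type 1 := GrMod A1.degree

section Smul

variable {M : Type} [AddCommGroup M] [Module A1 M]

@[simp] theorem sq1_sq1_smul (x : M) : sq1 • sq1 • x = 0 := by
  rw [← mul_smul, sq1_mul_sq1, zero_smul]

@[simp] theorem sq2_sq2_smul (x : M) : sq2 • sq2 • x = sq1 • sq2 • sq1 • x := by
  simp only [← mul_smul, sq2_mul_sq2, mul_assoc]

@[simp] theorem sq2_sq1_sq2_sq1_smul (x : M) :
    sq2 • sq1 • sq2 • sq1 • x = sq1 • sq2 • sq1 • sq2 • x := by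
  rw [← sq2_sq2_smul, sq2_sq2_smul]

theorem zmod_cases (r : ZMod 2) : r = 0 ∨ r = 1 := by revert r; decide

theorem add_self_eq_zero (x : M) : x + x = 0 := by
  have h : (2 : A1) = 0 := by
    have := map_ofNat (algebraMap (ZMod 2) A1) 2
    rw [← this, show (OfNat.ofNat 2 : ZMod 2) = 0 from rfl, map_zero]
  rw [← two_smul A1 x, h, zero_smul]

theorem two_nsmul_eq_zero (x : M) : 2 • x = 0 := by rw [two_nsmul, add_self_eq_zero]

theorem map_smul_of_sq {N : Type} [AddCommGroup N] [Module A1 N] (f : M →+ N)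
    (h1 : ∀ x, f (sq1 • x) = sq1 • f x) (h2 : ∀ x, f (sq2 • x) = sq2 • f x) (a : A1) (x : M) :
    f (a • x) = a • f x := by
  refine A1_induction (p := fun a => ∀ x, f (a • x) = a • f x) a h1 h2 (fun r x => ?_)
    (fun a b ha hb x => ?_) (fun a b ha hb x => ?_) x
  · rcases zmod_cases r with rfl | rfl <;> simp
  · rw [add_smul, map_add, ha, hb, add_smul]
  · rw [mul_smul, ha, hb, mul_smul]

/-- An additive map that commutes with `Sq¹` and `Sq²` is linear. -/
def linOfSq {N : Type} [AddCommGroup N] [Module A1 N] (f : M →+ N)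
    (h1 : ∀ x, f (sq1 • x) = sq1 • f x) (h2 : ∀ x, f (sq2 • x) = sq2 • f x) : M →ₗ[A1] N where
  toFun := f
  map_add' := map_add f
  map_smul' := map_smul_of_sq f h1 h2

end Smul

theorem mem_deg_of_eq {M : GrModA1} {i j : ℤ} {x : M.carrier} (hx : x ∈ M.deg i) (h : i = j) :
    x ∈ M.deg j := h ▸ hx

theorem sq1_smul_mem {M : GrModA1} {i j : ℤ} {x : M.carrier} (hx : x ∈ M.deg i)
    (h : i + 1 = j := by ring) : sq1 • x ∈ M.deg j :=
  mem_deg_of_eq (M.smul_mem sq1_mem hx) (by push_cast; omega)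

theorem sq2_smul_mem {M : GrModA1} {i j : ℤ} {x : M.carrier} (hx : x ∈ M.deg i)
    (h : i + 2 = j := by ring) : sq2 • x ∈ M.deg j :=
  mem_deg_of_eq (M.smul_mem sq2_mem hx) (by push_cast; omega)

/-- Additive maps of degree `d`. -/
def IsDeg {M N : GrModA1} (d : ℤ) (θ : M.carrier →+ N.carrier) : Prop :=
  ∀ i, ∀ x ∈ M.deg i, θ x ∈ N.deg (i + d)

/-- The trace of an additive map of degree `-6`, with respect to the Frobenius form of `𝒜₁`. -/
noncomputable def trLin {M N : Type} [AddCommGroup M] [Module A1 M] [AddCommGroup N] [Module A1 N]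
    (θ : M →+ N) : M →ₗ[A1] N :=
  linOfSq
    { toFun m := θ (sq1 • sq2 • sq1 • sq2 • m) + sq1 • sq2 • sq1 • sq2 • θ m +
        sq1 • θ (sq2 • sq1 • sq2 • m) + sq2 • sq1 • sq2 • θ (sq1 • m) +
        sq2 • θ (sq1 • sq2 • sq1 • m) + sq1 • sq2 • sq1 • θ (sq2 • m) +
        sq1 • sq2 • θ (sq1 • sq2 • m) + sq2 • sq1 • θ (sq2 • sq1 • m)
      map_zero' := by simp
      map_add' x y := by simp only [smul_add, map_add]; abel }
    (fun x => by
      simp only [AddMonoidHom.coe_mk, ZeroHom.coe_mk, smul_add, sq1_sq1_smul,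
        sq2_sq1_sq2_sq1_smul, smul_zero, map_zero]
      abel)
    (fun x => by
      simp only [AddMonoidHom.coe_mk, ZeroHom.coe_mk, smul_add, sq1_sq1_smul, sq2_sq2_smul,
        sq2_sq1_sq2_sq1_smul, smul_zero, map_zero]
      abel)

theorem trLin_apply {M N : Type} [AddCommGroup M] [Module A1 M] [AddCommGroup N] [Module A1 N]
    (θ : M →+ N) (m : M) : trLin θ m = θ (sq1 • sq2 • sq1 • sq2 • m) +
        sq1 • sq2 • sq1 • sq2 • θ m +
        sq1 • θ (sq2 • sq1 • sq2 • m) + sq2 • sq1 • sq2 • θ (sq1 • m) +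
        sq2 • θ (sq1 • sq2 • sq1 • m) + sq1 • sq2 • sq1 • θ (sq2 • m) +
        sq1 • sq2 • θ (sq1 • sq2 • m) + sq2 • sq1 • θ (sq2 • sq1 • m) := rfl

/-- The trace, as a morphism of graded modules. -/
noncomputable def tr {M N : GrModA1} (θ : M.carrier →+ N.carrier) (h : IsDeg (-6) θ) : M ⟶ N :=
  mkHom (trLin θ) fun i m hm => by
    rw [trLin_apply]
    have a1 := sq1_smul_mem (j := i + 1) hm
    have a2 := sq2_smul_mem (j := i + 2) hm
    have a12 := sq1_smul_mem (j := i + 3) a2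
    have a21 := sq2_smul_mem (j := i + 3) a1
    have a121 := sq1_smul_mem (j := i + 4) a21
    have a212 := sq2_smul_mem (j := i + 5) a12
    have a1212 := sq1_smul_mem (j := i + 6) a212
    have b0 := h _ _ a1212
    have b1 := sq1_smul_mem (j := i) (h _ _ a212)
    have b2 := sq2_smul_mem (j := i) (h _ _ a121)
    have b12 := sq1_smul_mem (j := i) (sq2_smul_mem (j := i - 1) (h _ _ a12))
    have b21 := sq2_smul_mem (j := i) (sq1_smul_mem (j := i - 2) (h _ _ a21))
    have b121 := sq1_smul_mem (j := i) (sq2_smul_mem (j := i - 1)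
      (sq1_smul_mem (j := i - 3) (h _ _ a2)))
    have b212 := sq2_smul_mem (j := i) (sq1_smul_mem (j := i - 2)
      (sq2_smul_mem (j := i - 3) (h _ _ a1)))
    have b1212 := sq1_smul_mem (j := i) (sq2_smul_mem (j := i - 1)
      (sq1_smul_mem (j := i - 3) (sq2_smul_mem (j := i - 4) (h _ _ hm))))
    rw [add_neg_cancel_right] at b0
    exact add_mem (add_mem (add_mem (add_mem (add_mem (add_mem (add_mem b0 b1212) b1) b212) b2)
      b121) b12) b21

@[simp] theorem lin_tr {M N : GrModA1} (θ : M.carrier →+ N.carrier) (h : IsDeg (-6) θ) :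
    lin (tr θ h) = trLin θ := rfl

theorem map_trLin {M N L : Type} [AddCommGroup M] [Module A1 M] [AddCommGroup N] [Module A1 N]
    [AddCommGroup L] [Module A1 L] (θ : M →+ N) (g : N →ₗ[A1] L) (m : M) :
    g (trLin θ m) = trLin (g.toAddMonoidHom.comp θ) m := by
  simp [trLin_apply]

theorem trLin_map {M N L : Type} [AddCommGroup M] [Module A1 M] [AddCommGroup N] [Module A1 N]
    [AddCommGroup L] [Module A1 L] (θ : M →+ N) (f : L →ₗ[A1] M) (m : L) :
    trLin θ (f m) = trLin (θ.comp f.toAddMonoidHom) m := by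
  simp [trLin_apply]

theorem trLin_add {M N : Type} [AddCommGroup M] [Module A1 M] [AddCommGroup N] [Module A1 N]
    (θ θ' : M →+ N) : trLin (θ + θ') = trLin θ + trLin θ' := by
  ext m
  simp only [trLin_apply, LinearMap.add_apply, AddMonoidHom.add_apply, smul_add]
  abel

theorem IsDeg.of_eq {M N : GrModA1} {d e : ℤ} {θ : M.carrier →+ N.carrier} (h : IsDeg d θ)
    (hde : d = e := by norm_num) : IsDeg (M := M) (N := N) e θ := hde ▸ h

theorem IsDeg.comp {M N L : GrModA1} {d e : ℤ} {θ : M.carrier →+ N.carrier}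
    {η : N.carrier →+ L.carrier} (hη : IsDeg (M := N) (N := L) e η) (hθ : IsDeg d θ) :
    IsDeg (M := M) (N := L) (d + e) (η.comp θ) := fun i x hx =>
  mem_deg_of_eq (hη _ _ (hθ _ _ hx)) (by omega)

theorem isDeg_lin {M N : GrModA1} (f : M ⟶ N) : IsDeg 0 (lin f).toAddMonoidHom := fun i x hx => by
  rw [add_zero]
  exact lin_mem f hx

/-! ### Graded sections and retractions -/

theorem exists_addSection {X Y : Type} [AddCommGroup X] [AddCommGroup Y] (hX : ∀ x : X, 2 • x = 0)
    (hY : ∀ y : Y, 2 • y = 0) (f : X →+ Y) (hf : Function.Surjective f) :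
    ∃ g : Y →+ X, ∀ y, f (g y) = y := by
  let _ := AddCommGroup.zmodModule hX
  let _ := AddCommGroup.zmodModule hY
  obtain ⟨g, hg⟩ := (f.toZModLinearMap 2).exists_rightInverse_of_surjective
    (LinearMap.range_eq_top.2 hf)
  exact ⟨g.toAddMonoidHom, fun y => LinearMap.congr_fun hg y⟩

theorem exists_addRetraction {X Y : Type} [AddCommGroup X] [AddCommGroup Y]
    (hX : ∀ x : X, 2 • x = 0) (hY : ∀ y : Y, 2 • y = 0) (f : X →+ Y) (hf : Function.Injective f) :
    ∃ g : Y →+ X, ∀ x, g (f x) = x := by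
  let _ := AddCommGroup.zmodModule hX
  let _ := AddCommGroup.zmodModule hY
  obtain ⟨g, hg⟩ := (f.toZModLinearMap 2).exists_leftInverse_of_injective
    (LinearMap.ker_eq_bot.2 hf)
  exact ⟨g.toAddMonoidHom, fun y => LinearMap.congr_fun hg y⟩

/-- The restriction of a morphism to homogeneous parts. -/
def degMap {M N : GrModA1} (f : M ⟶ N) (i : ℤ) : M.deg i →+ N.deg i :=
  ((lin f).toAddMonoidHom.comp (M.deg i).subtype).codRestrict (N.deg i) fun x => lin_mem f x.2

theorem two_nsmul_deg {M : GrModA1} {i : ℤ} (x : M.deg i) : 2 • x = 0 :=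
  Subtype.ext (two_nsmul_eq_zero (x : M.carrier))

theorem exists_gradedSection {M N : GrModA1} (f : M ⟶ N) (hf : Function.Surjective (lin f)) :
    ∃ g : N.carrier →+ M.carrier, IsDeg 0 g ∧ ∀ y, lin f (g y) = y := by
  have h : ∀ i, ∃ g : N.deg i →+ M.deg i, ∀ y, degMap f i (g y) = y := fun i =>
    exists_addSection two_nsmul_deg two_nsmul_deg _ fun y => by
      obtain ⟨x, hx, hxy⟩ := exists_mem_deg_of_surjective hf y.2
      exact ⟨⟨x, hx⟩, Subtype.ext hxy⟩
  choose g hg using h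
  obtain ⟨ψ, hψ⟩ := exists_addMonoidHom fun i => (M.deg i).subtype.comp (g i)
  refine ⟨ψ, fun i y hy => ?_, fun y => ?_⟩
  · rw [hψ i y hy, add_zero]
    exact (g i ⟨y, hy⟩).2
  · refine hom_induction (p := fun y => lin f (ψ y) = y) y (fun i y hy => ?_) (by simp)
      fun x y hx hy => by simp only [map_add, hx, hy]
    rw [hψ i y hy]
    exact congrArg Subtype.val (hg i ⟨y, hy⟩)

theorem exists_gradedRetraction {M N : GrModA1} (f : M ⟶ N) (hf : Function.Injective (lin f)) :
    ∃ g : N.carrier →+ M.carrier, IsDeg 0 g ∧ ∀ x, g (lin f x) = x := by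
  have h : ∀ i, ∃ g : N.deg i →+ M.deg i, ∀ y, g (degMap f i y) = y := fun i =>
    exists_addRetraction two_nsmul_deg two_nsmul_deg _ fun x y hxy =>
      Subtype.ext (hf (congrArg Subtype.val hxy))
  choose g hg using h
  obtain ⟨ψ, hψ⟩ := exists_addMonoidHom fun i => (M.deg i).subtype.comp (g i)
  refine ⟨ψ, fun i y hy => ?_, fun x => ?_⟩
  · rw [hψ i y hy, add_zero]
    exact (g i ⟨y, hy⟩).2
  · refine hom_induction (p := fun x => ψ (lin f x) = x) x (fun i x hx => ?_) (by simp)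
      fun x y hx hy => by simp only [map_add, hx, hy]
    rw [hψ i _ (lin_mem f hx)]
    exact congrArg Subtype.val (hg i ⟨x, hx⟩)

/-! ### Induced modules -/

/-- The underlying type of `𝒜₁ ⊗ M`, in coordinates. -/
def IndCarrier (M : GrModA1) : Type := Fin 8 → M.carrier

instance (M : GrModA1) : AddCommGroup (IndCarrier M) :=
  inferInstanceAs (AddCommGroup (Fin 8 → M.carrier))

@[ext] theorem IndCarrier.ext {M : GrModA1} {v w : IndCarrier M} (h : ∀ i, v i = w i) : v = w :=
  funext h

@[simp] theorem IndCarrier.add_apply {M : GrModA1} (v w : IndCarrier M) (i : Fin 8) :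
    (v + w) i = v i + w i := rfl

@[simp] theorem IndCarrier.zero_apply {M : GrModA1} (i : Fin 8) : (0 : IndCarrier M) i = 0 := rfl

noncomputable instance (M : GrModA1) : SMul A1 (IndCarrier M) where
  smul a v := fun i => ∑ j, algebraMap (ZMod 2) A1 (rep a i j) • v j

theorem ind_smul_apply {M : GrModA1} (a : A1) (v : IndCarrier M) (i : Fin 8) :
    (a • v) i = ∑ j, algebraMap (ZMod 2) A1 (rep a i j) • v j := rfl

noncomputable instance (M : GrModA1) : Module A1 (IndCarrier M) where
  one_smul v := by
    refine IndCarrier.ext fun i => (Finset.sum_eq_single i (fun j _ hj => ?_) (by simp)).trans ?_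
    · simp [Matrix.one_apply_ne hj.symm]
    · simp
  mul_smul a b v := by
    refine IndCarrier.ext fun i => ?_
    simp only [ind_smul_apply, Subalgebra.coe_mul, map_mul, Matrix.mul_apply, map_sum,
      Finset.sum_smul, Finset.smul_sum, mul_smul]
    exact Finset.sum_comm
  smul_zero a := IndCarrier.ext fun i => Finset.sum_eq_zero fun j _ => smul_zero _
  smul_add a v w := by
    refine IndCarrier.ext fun i => ?_
    simp only [ind_smul_apply, IndCarrier.add_apply, smul_add, Finset.sum_add_distrib]
  add_smul a b v := by
    refine IndCarrier.ext fun i => ?_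
    simp only [ind_smul_apply, IndCarrier.add_apply, Subalgebra.coe_add, map_add, Matrix.add_apply,
      add_smul, Finset.sum_add_distrib]
  zero_smul v := IndCarrier.ext fun i => Finset.sum_eq_zero fun j _ => by simp

theorem IndCarrier.ext8 {M : GrModA1} {v w : IndCarrier M} (h0 : v 0 = w 0) (h1 : v 1 = w 1)
    (h2 : v 2 = w 2) (h3 : v 3 = w 3) (h4 : v 4 = w 4) (h5 : v 5 = w 5) (h6 : v 6 = w 6)
    (h7 : v 7 = w 7) : v = w := by
  refine IndCarrier.ext fun i => ?_
  fin_cases i <;> assumption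

/-- A vector of the induced module. -/
def indMk {M : GrModA1} (v : Fin 8 → M.carrier) : IndCarrier M := v

@[simp] theorem indMk_apply {M : GrModA1} (v : Fin 8 → M.carrier) (i : Fin 8) :
    indMk v i = v i := rfl

@[simp] theorem ind_sq1_smul {M : GrModA1} (v : IndCarrier M) :
    (sq1 • v) 0 = 0 ∧ (sq1 • v) 1 = v 0 ∧ (sq1 • v) 2 = 0 ∧ (sq1 • v) 3 = v 2 ∧
    (sq1 • v) 4 = 0 ∧ (sq1 • v) 5 = v 4 ∧ (sq1 • v) 6 = 0 ∧ (sq1 • v) 7 = v 6 := by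
  simp only [ind_smul_apply, sq1, rep_Sq, Fin.sum_univ_eight]
  simp [sqMat, sqEntries]

@[simp] theorem ind_sq2_smul {M : GrModA1} (v : IndCarrier M) :
    (sq2 • v) 0 = 0 ∧ (sq2 • v) 1 = 0 ∧ (sq2 • v) 2 = v 0 ∧ (sq2 • v) 3 = 0 ∧
    (sq2 • v) 4 = v 1 ∧ (sq2 • v) 5 = v 2 ∧ (sq2 • v) 6 = v 3 ∧ (sq2 • v) 7 = v 5 := by
  simp only [ind_smul_apply, sq2, rep_Sq, Fin.sum_univ_eight]
  simp [sqMat, sqEntries]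

/-- The induced module `𝒜₁ ⊗ M`. -/
noncomputable def ind (M : GrModA1) : GrModA1 where
  carrier := IndCarrier M
  deg i :=
    { carrier := {v | ∀ k, v k ∈ M.deg (i - basisDeg k)}
      add_mem' := fun hv hw k => add_mem (hv k) (hw k)
      zero_mem' := fun k => zero_mem _
      neg_mem' := fun hv k => neg_mem (hv k) }
  isInternal := by
    refine isInternal_of_comp _
      (fun i => ⟨⟨fun v k => M.comp (i - basisDeg k) (v k), IndCarrier.ext fun k => map_zero _⟩,
        fun v w => IndCarrier.ext fun k => map_add _ _ _⟩)
      (fun i v hv => IndCarrier.ext fun k => M.comp_of_mem (hv k))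
      (fun i j hij v hv => IndCarrier.ext fun k => M.comp_of_mem_ne (hv k) (by omega)) ?_
    rw [eq_top_iff]
    intro v _
    have hv : v = ∑ k, (Pi.single k (v k) : Fin 8 → M.carrier) :=
      (Finset.univ_sum_single (M := fun _ : Fin 8 => M.carrier) v).symm
    rw [hv]
    refine sum_mem fun k _ => ?_
    refine hom_induction (M := M) (p := fun x => (Pi.single k x : Fin 8 → M.carrier) ∈ _) (v k)
      (fun i x hx => ?_) ?_ fun x y hx hy => ?_
    · refine AddSubgroup.mem_iSup_of_mem (i + basisDeg k) fun l => ?_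
      by_cases h : l = k
      · subst h
        rw [Pi.single_eq_same]
        exact mem_deg_of_eq hx (by omega)
      · rw [Pi.single_eq_of_ne h]
        exact zero_mem _
    · rw [Pi.single_zero]; exact zero_mem _
    · rw [Pi.single_add]; exact add_mem hx hy
  smul_mem := by
    intro n j a v ha hv k
    rw [ind_smul_apply]
    refine sum_mem fun l _ => ?_
    rcases zmod_cases (rep a k l) with h | h
    · rw [h, map_zero, zero_smul]; exact zero_mem _
    · have := matDeg_rep ha k l fun h0 => one_ne_zero (h.symm.trans h0)
      rw [h, map_one, one_smul]
      exact mem_deg_of_eq (hv l) (by omega)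

/-- The universal embedding of a module into an induced one. -/
noncomputable def indι (M : GrModA1) : twist 6 M ⟶ ind M :=
  mkHom (M := twist 6 M) (N := ind M)
    (linOfSq (M := M.carrier) (N := IndCarrier M)
      { toFun m := indMk ![sq1 • sq2 • sq1 • sq2 • m, sq2 • sq1 • sq2 • m, sq1 • sq2 • sq1 • m,
          sq1 • sq2 • m, sq2 • sq1 • m, sq2 • m, sq1 • m, m]
        map_zero' := by apply IndCarrier.ext8 <;> simp
        map_add' x y := by apply IndCarrier.ext8 <;> simp }
      (fun x => by apply IndCarrier.ext8 <;> simp)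
      (fun x => by apply IndCarrier.ext8 <;> simp)) <| by
    intro i m (hm : m ∈ M.deg (i - 6))
    have a1 := sq1_smul_mem (j := i - 5) hm
    have a2 := sq2_smul_mem (j := i - 4) hm
    have a12 := sq1_smul_mem (j := i - 3) a2
    have a21 := sq2_smul_mem (j := i - 3) a1
    have a121 := sq1_smul_mem (j := i - 2) a21
    have a212 := sq2_smul_mem (j := i - 1) a12
    have a1212 := sq1_smul_mem (j := i) a212
    intro k
    fin_cases k
    · exact mem_deg_of_eq a1212 (sub_zero i).symm
    all_goals assumption

theorem indι_injective (M : GrModA1) : Function.Injective (lin (indι M)) := fun _ _ h =>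
  congrFun (h : (_ : Fin 8 → M.carrier) = _) 7

/-- The universal map from an induced module to a module. -/
noncomputable def indπ (M : GrModA1) : ind M ⟶ M :=
  mkHom (M := ind M) (N := M)
    (linOfSq (M := IndCarrier M) (N := M.carrier)
      { toFun v := v 0 + sq1 • v 1 + sq2 • v 2 + sq1 • sq2 • v 3 + sq2 • sq1 • v 4 +
          sq1 • sq2 • sq1 • v 5 + sq2 • sq1 • sq2 • v 6 + sq1 • sq2 • sq1 • sq2 • v 7
        map_zero' := by simp
        map_add' x y := by simp only [IndCarrier.add_apply, smul_add]; abel }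
      (fun x => by simp)
      (fun x => by simp)) <| by
    intro i v hv
    have h0 := hv 0
    rw [show i - (basisDeg 0 : ℤ) = i from sub_zero i] at h0
    have h1 := sq1_smul_mem (j := i) (hv 1) (sub_add_cancel _ _)
    have h2 := sq2_smul_mem (j := i) (hv 2) (sub_add_cancel _ _)
    have h3 := sq1_smul_mem (j := i) (sq2_smul_mem (j := i - 1) (hv 3) (by simp [basisDeg]; ring))
    have h4 := sq2_smul_mem (j := i) (sq1_smul_mem (j := i - 2) (hv 4) (by simp [basisDeg]; ring))
    have h5 := sq1_smul_mem (j := i) (sq2_smul_mem (j := i - 1) (sq1_smul_mem (j := i - 3) (hv 5)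
      (by simp [basisDeg]; ring)))
    have h6 := sq2_smul_mem (j := i) (sq1_smul_mem (j := i - 2) (sq2_smul_mem (j := i - 3) (hv 6)
      (by simp [basisDeg]; ring)))
    have h7 := sq1_smul_mem (j := i) (sq2_smul_mem (j := i - 1) (sq1_smul_mem (j := i - 3)
      (sq2_smul_mem (j := i - 4) (hv 7) (by simp [basisDeg]; ring))))
    exact add_mem (add_mem (add_mem (add_mem (add_mem (add_mem (add_mem h0 h1) h2) h3) h4) h5) h6)
      h7

theorem indπ_surjective (M : GrModA1) : Function.Surjective (lin (indπ M)) := fun m => by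
  refine ⟨indMk ![m, 0, 0, 0, 0, 0, 0, 0], ?_⟩
  change (_ : M.carrier) + _ + _ + _ + _ + _ + _ + _ = m
  simp

/-- The additive endomorphism of an induced module with trace the identity. -/
def indθ (M : GrModA1) : IndCarrier M →+ IndCarrier M where
  toFun v := indMk ![v 7, 0, 0, 0, 0, 0, 0, 0]
  map_zero' := by apply IndCarrier.ext8 <;> simp
  map_add' v w := by apply IndCarrier.ext8 <;> simp

@[simp] theorem indθ_apply {M : GrModA1} (v : IndCarrier M) :
    indθ M v = indMk ![v 7, 0, 0, 0, 0, 0, 0, 0] := rfl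

theorem isDeg_indθ (M : GrModA1) : IsDeg (M := ind M) (N := ind M) (-6) (indθ M) :=
  fun i v hv k => by
    fin_cases k
    · exact mem_deg_of_eq (hv 7) (by simp [basisDeg]; ring)
    all_goals exact zero_mem _

theorem trLin_indθ (M : GrModA1) (v : IndCarrier M) : trLin (indθ M) v = v := by
  apply IndCarrier.ext8 <;> simp [trLin_apply]

/-- A module for which the identity is a trace. -/
def IsRelProj (P : GrModA1) : Prop :=
  ∃ θ : P.carrier →+ P.carrier, IsDeg (-6) θ ∧ ∀ x, trLin θ x = x

theorem isRelProj_ind (M : GrModA1) : IsRelProj (ind M) := ⟨_, isDeg_indθ M, trLin_indθ M⟩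

theorem isProj_iff {P : GrModA1} : IsProj P ↔ IsRelProj P := by
  constructor
  · intro h
    obtain ⟨g, hg⟩ := h _ _ (indπ P) (𝟙 P) (indπ_surjective P)
    obtain ⟨θ, hθ, hid⟩ := isRelProj_ind P
    refine ⟨((lin (indπ P)).toAddMonoidHom.comp θ).comp (lin g).toAddMonoidHom,
      (((isDeg_lin (indπ P)).comp hθ).comp (isDeg_lin g)).of_eq, fun x => ?_⟩
    rw [← trLin_map, ← map_trLin, hid]
    exact congrArg (fun f => lin f x) hg
  · rintro ⟨θ, hθ, h⟩ X Y p f hp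
    obtain ⟨σ, hσ, hpσ⟩ := exists_gradedSection p hp
    refine ⟨tr ((σ.comp (lin f).toAddMonoidHom).comp θ)
      ((hσ.comp (isDeg_lin f)).comp hθ).of_eq, hom_ext_apply fun x => ?_⟩
    rw [lin_comp, LinearMap.comp_apply, lin_tr, map_trLin]
    have : (lin p).toAddMonoidHom.comp ((σ.comp (lin f).toAddMonoidHom).comp θ) =
        (lin f).toAddMonoidHom.comp θ := AddMonoidHom.ext fun y => hpσ _
    rw [this, ← map_trLin, h]

/-- Projective modules are injective. -/
theorem _root_.GrMod.IsProj.exists_extension {P M N : GrModA1} (hP : IsProj P) (i : M ⟶ N)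
    (hi : Function.Injective (lin i)) (f : M ⟶ P) :
    ∃ g : N ⟶ P, ∀ x, lin g (lin i x) = lin f x := by
  obtain ⟨θ, hθ, h⟩ := isProj_iff.1 hP
  obtain ⟨π, hπ, hπi⟩ := exists_gradedRetraction i hi
  refine ⟨tr (θ.comp ((lin f).toAddMonoidHom.comp π))
    (hθ.comp ((isDeg_lin f).comp hπ)).of_eq, fun x => ?_⟩
  rw [lin_tr, trLin_map]
  have : (θ.comp ((lin f).toAddMonoidHom.comp π)).comp (lin i).toAddMonoidHom =
      θ.comp (lin f).toAddMonoidHom := AddMonoidHom.ext fun y => congrArg (fun z => θ (lin f z))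
        (hπi y)
  rw [this, ← trLin_map, h]

theorem isProj_ind (M : GrModA1) : IsProj (ind M) := isProj_iff.2 (isRelProj_ind M)

/-- Morphisms that factor through projectives are the traces. -/
theorem stableRel_iff {M N : GrModA1} (f g : M ⟶ N) : stableRel A1.degree f g ↔
    ∃ θ : M.carrier →+ N.carrier, IsDeg (-6) θ ∧ lin f - lin g = trLin θ := by
  constructor
  · rintro ⟨P, hP, u, v, h⟩
    obtain ⟨θ, hθ, hid⟩ := isProj_iff.1 hP
    refine ⟨((lin v).toAddMonoidHom.comp θ).comp (lin u).toAddMonoidHom,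
      (((isDeg_lin v).comp hθ).comp (isDeg_lin u)).of_eq, ?_⟩
    rw [h]
    ext x
    rw [← trLin_map, ← map_trLin, hid]
    rfl
  · rintro ⟨θ, hθ, h⟩
    obtain ⟨σ, hσ, hpσ⟩ := exists_gradedSection (indπ N) (indπ_surjective N)
    refine ⟨ind N, isProj_ind N, tr (σ.comp θ) (hσ.comp hθ).of_eq, indπ N, ?_⟩
    rw [h]
    ext x
    rw [lin_comp, LinearMap.comp_apply, lin_tr, map_trLin]
    have : (lin (indπ N)).toAddMonoidHom.comp (σ.comp θ) = θ := AddMonoidHom.ext fun y => hpσ _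
    rw [this]

end Steenrod

/-! ## Stable isomorphisms -/

namespace GrMod

variable {A : Type} [Ring A] {𝒜 : ℕ → AddSubgroup A}

theorem IsProj.of_retract {P Q : GrMod 𝒜} (hQ : IsProj Q) (i : P ⟶ Q) (r : Q ⟶ P)
    (h : i ≫ r = 𝟙 P) : IsProj P := by
  intro X Y p f hp
  obtain ⟨g, hg⟩ := hQ X Y p (r ≫ f) hp
  exact ⟨i ≫ g, by rw [Category.assoc, hg, ← Category.assoc, h, Category.id_comp]⟩

theorem IsProj.prod {P Q : GrMod 𝒜} (hP : IsProj P) (hQ : IsProj Q) : IsProj (P.prod Q) := by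
  intro X Y p f hp
  obtain ⟨g, hg⟩ := hP X Y p (prodInl P Q ≫ f) hp
  obtain ⟨g', hg'⟩ := hQ X Y p (prodInr P Q ≫ f) hp
  refine ⟨prodDesc g g', hom_ext_apply fun x => ?_⟩
  have h1 := congrArg (fun k => lin k x.1) hg
  have h2 := congrArg (fun k => lin k x.2) hg'
  change lin p (lin g x.1 + lin g' x.2) = lin f x
  change lin p (lin g x.1) = lin f (x.1, 0) at h1
  change lin p (lin g' x.2) = lin f (0, x.2) at h2
  rw [map_add, h1, h2]
  exact (map_add (lin f) _ _).symm.trans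
    (congrArg (lin f) (Prod.ext (add_zero x.1) (zero_add x.2)))

theorem isProj_zero : IsProj (zero 𝒜) := fun X Y p f _ =>
  ⟨zeroHom _ _, hom_ext_apply fun x => by
    rw [show x = 0 from rfl, map_zero, map_zero]⟩

theorem stableRel_prodMap {M N M' N' : GrMod 𝒜} {f g : M ⟶ N} {f' g' : M' ⟶ N'}
    (h : stableRel 𝒜 f g) (h' : stableRel 𝒜 f' g') :
    stableRel 𝒜 (prodMap f f') (prodMap g g') := by
  obtain ⟨P, hP, u, v, h⟩ := h
  obtain ⟨P', hP', u', v', h'⟩ := h'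
  refine ⟨P.prod P', hP.prod hP', prodMap u u', prodMap v v', LinearMap.ext fun x => ?_⟩
  exact Prod.ext (LinearMap.congr_fun h x.1) (LinearMap.congr_fun h' x.2)

end GrMod

namespace Steenrod

open GrMod

instance : Congruence (stableRel A1.degree) where
  equivalence :=
    { refl f := (stableRel_iff f f).2 ⟨0, fun _ _ _ => zero_mem _, by
        ext x; simp [trLin_apply]⟩
      symm := by
        rintro f g ⟨P, hP, u, v, h⟩
        refine ⟨P, hP, u, negHom v, ?_⟩
        rw [← neg_sub, h]
        rfl
      trans := by
        intro f g k h1 h2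
        rw [stableRel_iff] at *
        obtain ⟨θ, hθ, h1⟩ := h1
        obtain ⟨η, hη, h2⟩ := h2
        refine ⟨θ + η, fun i x hx => add_mem (hθ i x hx) (hη i x hx), ?_⟩
        rw [trLin_add, ← h1, ← h2]
        abel }
  comp_left := by
    rintro X Y Z f g g' ⟨P, hP, u, v, h⟩
    refine ⟨P, hP, f ≫ u, v, ?_⟩
    ext x
    exact LinearMap.congr_fun h (lin f x)
  comp_right := by
    rintro X Y Z f g k ⟨P, hP, u, v, h⟩
    refine ⟨P, hP, u, v ≫ k, ?_⟩
    ext x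
    have := congrArg (lin k) (LinearMap.congr_fun h x)
    rw [LinearMap.sub_apply, map_sub] at this
    exact this

theorem toSt_map_eq_iff {M N : GrModA1} (f g : M ⟶ N) :
    (toSt A1.degree).map f = (toSt A1.degree).map g ↔ stableRel A1.degree f g :=
  CategoryTheory.Quotient.functor_map_eq_iff _ f g

/-- Isomorphism in the stable module category. -/
def StIso (M N : GrModA1) : Prop := Nonempty ((toSt A1.degree).obj M ≅ (toSt A1.degree).obj N)

theorem StIso.refl (M : GrModA1) : StIso M M := ⟨Iso.refl _⟩

theorem StIso.symm {M N : GrModA1} : StIso M N → StIso N M := fun ⟨e⟩ => ⟨e.symm⟩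

theorem StIso.trans {M N L : GrModA1} : StIso M N → StIso N L → StIso M L :=
  fun ⟨e⟩ ⟨e'⟩ => ⟨e ≪≫ e'⟩

theorem stIso_iff {M N : GrModA1} : StIso M N ↔ ∃ (f : M ⟶ N) (g : N ⟶ M),
    stableRel A1.degree (f ≫ g) (𝟙 M) ∧ stableRel A1.degree (g ≫ f) (𝟙 N) := by
  constructor
  · rintro ⟨e⟩
    obtain ⟨f, hf⟩ := (toSt A1.degree).map_surjective e.hom
    obtain ⟨g, hg⟩ := (toSt A1.degree).map_surjective e.inv
    refine ⟨f, g, (toSt_map_eq_iff _ _).1 ?_, (toSt_map_eq_iff _ _).1 ?_⟩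
    · rw [Functor.map_comp, hf, hg, e.hom_inv_id, CategoryTheory.Functor.map_id]
    · rw [Functor.map_comp, hf, hg, e.inv_hom_id, CategoryTheory.Functor.map_id]
  · rintro ⟨f, g, h, h'⟩
    exact ⟨⟨(toSt _).map f, (toSt _).map g,
      by rw [← Functor.map_comp, (toSt_map_eq_iff _ _).2 h, CategoryTheory.Functor.map_id],
      by rw [← Functor.map_comp, (toSt_map_eq_iff _ _).2 h', CategoryTheory.Functor.map_id]⟩⟩

theorem StIso.prod {M N M' N' : GrModA1} (h : StIso M N) (h' : StIso M' N') :
    StIso (M.prod M') (N.prod N') := by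
  rw [stIso_iff] at *
  obtain ⟨f, g, h1, h2⟩ := h
  obtain ⟨f', g', h1', h2'⟩ := h'
  exact ⟨prodMap f f', prodMap g g', stableRel_prodMap h1 h1', stableRel_prodMap h2 h2'⟩

theorem stableRel_of_eq {M N : GrModA1} {f g : M ⟶ N} (h : f = g) : stableRel A1.degree f g :=
  h ▸ (Congruence.equivalence (r := stableRel A1.degree)).refl f

theorem stIso_of_ses_left {K E M : GrModA1} (h : SES K E M) (hK : IsProj K) : StIso E M := by
  obtain ⟨i, p, h⟩ := h
  obtain ⟨r, hr⟩ := hK.exists_extension i h.1 (𝟙 K)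
  obtain ⟨s, hs⟩ := h.exists_desc (subHom (𝟙 E) (r ≫ i)) fun x => by
    change lin i x - lin i (lin r (lin i x)) = 0
    rw [hr]; exact sub_self _
  have hs' : ∀ x, lin s (lin p x) = x - lin i (lin r x) := hs
  refine stIso_iff.2 ⟨p, s, ⟨K, hK, r, negHom i, ?_⟩, stableRel_of_eq ?_⟩
  · ext x
    change lin s (lin p x) - x = -(lin i (lin r x))
    rw [hs']
    abel
  · refine hom_ext_apply fun y => ?_
    obtain ⟨x, rfl⟩ := h.2.2 y
    change lin p (lin s (lin p x)) = lin p x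
    rw [hs', map_sub, h.apply_apply, sub_zero]

theorem stIso_of_ses_right {M E Q : GrModA1} (h : SES M E Q) (hQ : IsProj Q) : StIso M E := by
  obtain ⟨i, p, h⟩ := h
  obtain ⟨s, hs⟩ := hQ _ _ p (𝟙 Q) h.2.2
  have hs : ∀ x, lin p (lin s x) = x := fun x => congrArg (fun f => lin f x) hs
  obtain ⟨r, hr⟩ := h.exists_lift (subHom (𝟙 E) (p ≫ s)) fun x => by
    change lin p (x - lin s (lin p x)) = 0
    rw [map_sub, hs, sub_self]
  have hr' : ∀ x, lin i (lin r x) = x - lin s (lin p x) := hr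
  refine stIso_iff.2 ⟨i, r, stableRel_of_eq ?_, ⟨Q, hQ, p, negHom s, ?_⟩⟩
  · refine hom_ext_apply fun y => h.1 ?_
    change lin i (lin r (lin i y)) = lin i y
    rw [hr', h.apply_apply, map_zero, sub_zero]
  · ext x
    change lin i (lin r x) - x = -(lin s (lin p x))
    rw [hr']
    abel

theorem stIso_prod_right {M Q : GrModA1} (hQ : IsProj Q) : StIso M (M.prod Q) :=
  stIso_of_ses_right (SES.split M Q) hQ

theorem stIso_of_bijective {M N : GrModA1} (f : M ⟶ N) (hf : Function.Bijective (lin f)) :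
    StIso M N :=
  stIso_of_ses_right (SES.of_bijective f hf) isProj_zero

theorem stIso_zero_iff {M : GrModA1} : StIso M (zero _) ↔ IsProj M := by
  constructor
  · intro h
    obtain ⟨f, g, h, -⟩ := stIso_iff.1 h
    obtain ⟨P, hP, u, v, h⟩ := h
    refine hP.of_retract u (negHom v) (hom_ext_apply fun x => ?_)
    have := LinearMap.congr_fun h x
    change lin g (lin f x) - x = lin v (lin u x) at this
    change -(lin v (lin u x)) = x
    rw [← this, show lin f x = 0 from rfl, map_zero]
    abel
  · intro h
    exact stIso_of_ses_left (SES.right_zero M) h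

/-- Stably isomorphic modules become isomorphic after adding projectives. -/
theorem StIso.exists_splitting {M' M : GrModA1} (h : StIso M' M) :
    ∃ (Q K : GrModA1) (f : M'.prod Q ⟶ M) (s : M ⟶ M'.prod Q) (j : K ⟶ M'.prod Q)
      (r : M'.prod Q ⟶ K), IsProj Q ∧ IsProj K ∧ (∀ x, lin f (lin s x) = x) ∧
      (∀ x, lin r (lin j x) = x) ∧ (∀ x, lin f (lin j x) = 0) ∧ (∀ x, lin r (lin s x) = 0) ∧
      ∀ x, lin s (lin f x) + lin j (lin r x) = x := by
  obtain ⟨φ, ψ, h1, P, hP, u, v, h2⟩ := stIso_iff.1 h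
  obtain ⟨w, hw⟩ := hP _ _ (indπ M) v (indπ_surjective M)
  have hQ := isProj_ind M
  let E := M'.prod (ind M)
  let f : E ⟶ M := prodDesc φ (indπ M)
  have hf : Function.Surjective (lin f) := fun x => by
    obtain ⟨y, hy⟩ := indπ_surjective M x
    refine ⟨((0 : M'.carrier), y), ?_⟩
    change lin φ 0 + lin (indπ M) y = x
    rw [map_zero, zero_add, hy]
  let s : M ⟶ E := prodLift ψ (negHom (u ≫ w))
  have hfs : ∀ x, lin f (lin s x) = x := fun x => by
    change lin φ (lin ψ x) + lin (indπ M) (-(lin w (lin u x))) = x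
    have e1 : lin (indπ M) (lin w (lin u x)) = lin v (lin u x) :=
      congrArg (fun k => lin k (lin u x)) hw
    have e2 : lin φ (lin ψ x) - x = lin v (lin u x) := LinearMap.congr_fun h2 x
    rw [map_neg, e1, ← e2]
    abel
  have hk := isShortExact_ker f hf
  obtain ⟨r, hr⟩ := hk.exists_lift (subHom (𝟙 E) (f ≫ s)) fun x => by
    change lin f (x - lin s (lin f x)) = 0
    rw [map_sub, hfs, sub_self]
  have hr' : ∀ x, lin (kerι f) (lin r x) = x - lin s (lin f x) := hr
  have hrj : ∀ x, lin r (lin (kerι f) x) = x := fun x => hk.1 (by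
    rw [hr', hk.apply_apply, map_zero, sub_zero])
  refine ⟨ind M, ker f, f, s, kerι f, r, hQ, ?_, hfs, hrj, hk.apply_apply, fun x => hk.1 ?_,
    fun x => by rw [hr']; abel⟩
  · have i1 : IsIso ((toSt A1.degree).map (prodInl M' (ind M))) := by
      have : stableRel A1.degree (prodFst M' (ind M) ≫ prodInl M' (ind M)) (𝟙 _) := by
        refine ⟨ind M, hQ, prodSnd M' (ind M), negHom (prodInr M' (ind M)), ?_⟩
        refine LinearMap.ext fun x => ?_
        refine Prod.ext ?_ ?_
        · exact (sub_self x.1).trans neg_zero.symm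
        · exact zero_sub x.2
      refine ⟨(toSt A1.degree).map (prodFst M' (ind M)), ?_, ?_⟩
      · rw [← Functor.map_comp, ← CategoryTheory.Functor.map_id]
        rfl
      · rw [← Functor.map_comp, (toSt_map_eq_iff _ _).2 this, CategoryTheory.Functor.map_id]
    have i2 : IsIso ((toSt A1.degree).map φ) :=
      ⟨(toSt A1.degree).map ψ, by rw [← Functor.map_comp, (toSt_map_eq_iff _ _).2 h1,
        CategoryTheory.Functor.map_id], by rw [← Functor.map_comp, (toSt_map_eq_iff _ _).2 ⟨P, hP, u, v, h2⟩,
        CategoryTheory.Functor.map_id]⟩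
    have i3 : prodInl M' (ind M) ≫ f = φ := hom_ext_apply fun x => by
      change lin φ x + lin (indπ M) 0 = lin φ x
      rw [map_zero, add_zero]
    have i4 : IsIso ((toSt A1.degree).map f) := by
      have : IsIso ((toSt A1.degree).map (prodInl M' (ind M)) ≫ (toSt A1.degree).map f) := by
        rw [← Functor.map_comp, i3]; exact i2
      exact IsIso.of_isIso_comp_left ((toSt A1.degree).map (prodInl M' (ind M))) _
    have i5 : (toSt A1.degree).map s ≫ (toSt A1.degree).map f = 𝟙 _ := by
      rw [← Functor.map_comp, show s ≫ f = 𝟙 _ from hom_ext_apply hfs, CategoryTheory.Functor.map_id]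
    have i6 : (toSt A1.degree).map f ≫ (toSt A1.degree).map s = 𝟙 _ := by
      rw [← cancel_mono ((toSt A1.degree).map f), Category.assoc, i5, Category.comp_id,
        Category.id_comp]
    have i7 : stableRel A1.degree (𝟙 E) (f ≫ s) := by
      rw [← toSt_map_eq_iff, Functor.map_comp, i6, CategoryTheory.Functor.map_id]
    obtain ⟨P', hP', u', v', h'⟩ := i7
    refine hP'.of_retract (kerι f ≫ u') (v' ≫ r) (hom_ext_apply fun x => hk.1 ?_)
    change lin (kerι f) (lin r (lin v' (lin u' (lin (kerι f) x)))) = lin (kerι f) x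
    have h'' : ∀ y, lin v' (lin u' y) = y - lin s (lin f y) := fun y =>
      (LinearMap.congr_fun h' y).symm
    rw [h'', hk.apply_apply, map_zero, sub_zero, hrj]
  · rw [hr', hfs, map_zero, sub_self]

theorem _root_.GrMod.SES.change_left {M N L M' : GrModA1} (h : SES M N L) (e : StIso M' M) :
    ∃ Q N', IsProj Q ∧ SES (M'.prod Q) N' L ∧ StIso N N' := by
  obtain ⟨i, p, h⟩ := h
  obtain ⟨Q, K, f, s, j, r, hQ, hK, hfs, hrj, hfj, hrs, hid⟩ := e.exists_splitting
  refine ⟨Q, N.prod K, hQ, ⟨prodLift (f ≫ i) r, prodFst N K ≫ p, ?_, fun x => ⟨fun hx => ?_, ?_⟩,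
    fun l => ?_⟩, stIso_prod_right hK⟩
  · rw [injective_iff_map_eq_zero]
    intro e he
    have h1 : lin i (lin f e) = 0 := congrArg Prod.fst he
    have h2 : lin r e = 0 := congrArg Prod.snd he
    rw [← hid e, h2, h.1 (h1.trans (map_zero _).symm), map_zero, map_zero, add_zero]
  · obtain ⟨m, hm⟩ := (h.2.1 _).1 hx
    refine ⟨lin s m + lin j x.2, Prod.ext ?_ ?_⟩
    · change lin i (lin f (lin s m + lin j x.2)) = x.1
      rw [map_add, hfs, hfj, add_zero, hm]; rfl
    · change lin r (lin s m + lin j x.2) = x.2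
      rw [map_add, hrs, hrj, zero_add]
  · rintro ⟨e, rfl⟩
    exact h.apply_apply _
  · obtain ⟨n, hn⟩ := h.2.2 l
    exact ⟨(n, (0 : K.carrier)), hn⟩

theorem _root_.GrMod.SES.change_right {M N L L' : GrModA1} (h : SES M N L) (e : StIso L' L) :
    ∃ Q N', IsProj Q ∧ SES M N' (L'.prod Q) ∧ StIso N N' := by
  obtain ⟨i, p, h⟩ := h
  obtain ⟨Q, K, f, s, j, r, hQ, hK, hfs, hrj, hfj, hrs, hid⟩ := e.exists_splitting
  refine ⟨Q, N.prod K, hQ, ⟨i ≫ prodInl N K, prodDesc (p ≫ s) j, fun x y hxy => ?_,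
    fun x => ⟨fun hx => ?_, ?_⟩, fun e => ?_⟩, stIso_prod_right hK⟩
  · exact h.1 (congrArg Prod.fst hxy)
  · change lin s (lin p x.1) + lin j x.2 = 0 at hx
    have h1 := congrArg (lin f) hx
    have h2 := congrArg (lin r) hx
    rw [map_add, hfs, hfj, map_zero, add_zero] at h1
    rw [map_add, hrs, hrj, map_zero, zero_add] at h2
    obtain ⟨m, hm⟩ := (h.2.1 _).1 h1
    exact ⟨m, Prod.ext hm h2.symm⟩
  · rintro ⟨m, rfl⟩
    change lin s (lin p (lin i m)) + lin j 0 = 0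
    rw [h.apply_apply, map_zero, map_zero, add_zero]
  · obtain ⟨n, hn⟩ := h.2.2 (lin f e)
    refine ⟨(n, lin r e), ?_⟩
    change lin s (lin p n) + lin j (lin r e) = e
    rw [hn, hid]

theorem _root_.GrMod.SES.rotate {M N L P M' : GrModA1} (h : SES M N L) (h' : SES M P M') (hP : IsProj P) :
    SES N (L.prod P) M' := by
  obtain ⟨i, p, h⟩ := h
  obtain ⟨j, q, h'⟩ := h'
  obtain ⟨e, he⟩ := hP.exists_extension i h.1 j
  obtain ⟨e', he'⟩ := h.exists_desc (e ≫ q) fun x => by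
    change lin q (lin e (lin i x)) = 0
    rw [he, h'.apply_apply]
  have he' : ∀ x, lin e' (lin p x) = lin q (lin e x) := he'
  refine ⟨prodLift p e, prodDesc (negHom e') q, ?_, fun x => ⟨fun hx => ?_, ?_⟩, fun y => ?_⟩
  · rw [injective_iff_map_eq_zero]
    intro n hn
    obtain ⟨m, rfl⟩ := (h.2.1 n).1 (congrArg Prod.fst hn)
    have : lin j m = 0 := (he m).symm.trans (congrArg Prod.snd hn)
    rw [h'.1 (this.trans (map_zero _).symm), map_zero]
  · obtain ⟨l, y⟩ := x
    obtain ⟨n, rfl⟩ := h.2.2 l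
    change -(lin e' (lin p n)) + lin q y = 0 at hx
    rw [he', ← map_neg, ← map_add] at hx
    obtain ⟨m, hm⟩ := (h'.2.1 _).1 hx
    refine ⟨n + lin i m, Prod.ext ?_ ?_⟩
    · change lin p (n + lin i m) = lin p n
      rw [map_add, h.apply_apply, add_zero]
    · change lin e (n + lin i m) = y
      rw [map_add, he, hm]
      abel
  · rintro ⟨n, rfl⟩
    change -(lin e' (lin p n)) + lin q (lin e n) = 0
    rw [he']
    exact neg_add_cancel _
  · obtain ⟨x, rfl⟩ := h'.2.2 y
    refine ⟨((0 : L.carrier), x), ?_⟩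
    change -(lin e' 0) + lin q x = lin q x
    rw [map_zero, neg_zero, zero_add]

theorem _root_.GrMod.SES.rotate' {M N L P L' : GrModA1} (h : SES M N L) (h' : SES L' P L) (hP : IsProj P) :
    SES L' (M.prod P) N := by
  obtain ⟨i, p, h⟩ := h
  obtain ⟨j, q, h'⟩ := h'
  obtain ⟨e, he⟩ := hP _ _ p q h.2.2
  have he : ∀ x, lin p (lin e x) = lin q x := fun x => congrArg (fun f => lin f x) he
  obtain ⟨e', he'⟩ := h.exists_lift (j ≫ e) fun x => by
    change lin p (lin e (lin j x)) = 0
    rw [he, h'.apply_apply]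
  have he' : ∀ x, lin i (lin e' x) = lin e (lin j x) := he'
  refine ⟨prodLift (negHom e') j, prodDesc i e, fun x y hxy => ?_, fun x => ⟨fun hx => ?_, ?_⟩,
    fun n => ?_⟩
  · exact h'.1 (congrArg Prod.snd hxy)
  · obtain ⟨m, y⟩ := x
    change lin i m + lin e y = 0 at hx
    have h1 := congrArg (lin p) hx
    rw [map_add, h.apply_apply, he, zero_add, map_zero] at h1
    obtain ⟨z, rfl⟩ := (h'.2.1 _).1 h1
    refine ⟨z, Prod.ext (h.1 ?_) rfl⟩
    change lin i (-(lin e' z)) = lin i m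
    rw [map_neg, he']
    exact neg_eq_of_add_eq_zero_left hx
  · rintro ⟨z, rfl⟩
    change lin i (-(lin e' z)) + lin e (lin j z) = 0
    rw [map_neg, he']
    exact neg_add_cancel _
  · obtain ⟨x, hx⟩ := h'.2.2 (lin p n)
    have : lin p (n - lin e x) = 0 := by rw [map_sub, he, hx, sub_self]
    obtain ⟨m, hm⟩ := (h.2.1 _).1 this
    refine ⟨(m, x), ?_⟩
    change lin i m + lin e x = n
    rw [hm]
    abel

/-- The embedding of a module into a projective one. -/
noncomputable def embed (M : GrModA1) : M ⟶ ind (twist (-6) M) :=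
  mkHom (M := M) (lin (M := twist 6 (twist (-6) M)) (indι (twist (-6) M))) fun i m hm =>
    lin_mem (M := twist 6 (twist (-6) M)) (indι (twist (-6) M))
      (show m ∈ M.deg (i - 6 - -6) from mem_deg_of_eq hm (by ring))

theorem embed_injective (M : GrModA1) : Function.Injective (lin (embed M)) :=
  indι_injective (twist (-6) M)

end Steenrod

/-! ## Cofiber sequences up to stable isomorphism -/

namespace Steenrod

open GrMod

/-- There is a cofiber sequence with the given terms. -/
def Cof (M N L : GrModA1) : Prop :=
  ∃ M' N' L', SES M' N' L' ∧ StIso M M' ∧ StIso N N' ∧ StIso L L'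

section

variable {M N L M' N' L' S O : GrModA1}

theorem _root_.GrMod.SES.cof (h : SES M N L) : Cof M N L :=
  ⟨M, N, L, h, StIso.refl _, StIso.refl _, StIso.refl _⟩

theorem Cof.congr (h : Cof M N L) (h1 : StIso M M') (h2 : StIso N N') (h3 : StIso L L') :
    Cof M' N' L' := by
  obtain ⟨M₁, N₁, L₁, hs, e1, e2, e3⟩ := h
  exact ⟨M₁, N₁, L₁, hs, h1.symm.trans e1, h2.symm.trans e2, h3.symm.trans e3⟩

theorem Cof.prod (h : Cof M N L) (h' : Cof M' N' L') :
    Cof (M.prod M') (N.prod N') (L.prod L') := by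
  obtain ⟨M₁, N₁, L₁, hs, e1, e2, e3⟩ := h
  obtain ⟨M₂, N₂, L₂, hs', e1', e2', e3'⟩ := h'
  exact ⟨_, _, _, hs.prod hs', e1.prod e1', e2.prod e2', e3.prod e3'⟩

theorem Cof.split (M N : GrModA1) : Cof M (M.prod N) N := (SES.split M N).cof

theorem Cof.left_zero (M : GrModA1) : Cof (zero _) M M := (SES.left_zero M).cof

theorem Cof.right_zero (M : GrModA1) : Cof M M (zero _) := (SES.right_zero M).cof

theorem StIso.isProj (h : StIso M N) (hM : IsProj M) : IsProj N :=
  stIso_zero_iff.1 (h.symm.trans (stIso_zero_iff.2 hM))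

theorem Cof.stIso_left (h : Cof M N L) (hM : IsProj M) : StIso N L := by
  obtain ⟨M₁, N₁, L₁, hs, e1, e2, e3⟩ := h
  exact (e2.trans (stIso_of_ses_left hs (e1.isProj hM))).trans e3.symm

theorem Cof.stIso_right (h : Cof M N L) (hL : IsProj L) : StIso M N := by
  obtain ⟨M₁, N₁, L₁, hs, e1, e2, e3⟩ := h
  exact (e1.trans (stIso_of_ses_right hs (e3.isProj hL))).trans e2.symm

theorem exists_cof_up (M : GrModA1) : ∃ P L, IsProj P ∧ SES M P L :=
  ⟨_, _, isProj_ind _, _, _, isShortExact_coker _ (embed_injective M)⟩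

theorem exists_cof_down (L : GrModA1) : ∃ M P, IsProj P ∧ SES M P L :=
  ⟨_, _, isProj_ind _, _, _, isShortExact_ker _ (indπ_surjective L)⟩

theorem Cof.exists_ker (h : Cof M N L) (h' : Cof M' L S) : ∃ X, Cof M X M' ∧ Cof X N S := by
  obtain ⟨M₁, N₁, L₁, hs, e1, e2, e3⟩ := h
  obtain ⟨M₂, L₂, S₂, hs', e1', e2', e3'⟩ := h'
  obtain ⟨Q, N₃, hQ, hs3, e⟩ := hs.change_right (e2'.symm.trans e3)
  obtain ⟨X, hX, hX'⟩ := hs3.exists_ker (hs'.prod (SES.right_zero Q))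
  exact ⟨X, hX.cof.congr e1.symm (StIso.refl _) ((stIso_prod_right hQ).symm.trans e1'.symm),
    hX'.cof.congr (StIso.refl _) (e2.trans e).symm
      ((stIso_prod_right isProj_zero).symm.trans e3'.symm)⟩

theorem Cof.exists_coker (h : Cof M N L) (h' : Cof M' M S) : ∃ X, Cof M' N X ∧ Cof S X L := by
  obtain ⟨M₁, N₁, L₁, hs, e1, e2, e3⟩ := h
  obtain ⟨M₂, L₂, S₂, hs', e1', e2', e3'⟩ := h'
  obtain ⟨Q, N₃, hQ, hs3, e⟩ := hs.change_left (e2'.symm.trans e1)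
  obtain ⟨X, hX, hX'⟩ := hs3.exists_coker (hs'.prod (SES.right_zero Q))
  exact ⟨X, hX.cof.congr ((stIso_prod_right hQ).symm.trans e1'.symm) (e2.trans e).symm
    (StIso.refl _), hX'.cof.congr ((stIso_prod_right isProj_zero).symm.trans e3'.symm)
      (StIso.refl _) e3.symm⟩

theorem Cof.rotate (h : Cof M N L) (h' : Cof M O M') (hO : IsProj O) : Cof N L M' := by
  obtain ⟨M₁, N₁, L₁, hs, e1, e2, e3⟩ := h
  obtain ⟨M₂, O₂, L₂, hs', e1', e2', e3'⟩ := h'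
  obtain ⟨Q, N₃, hQ, hs3, e⟩ := hs.change_left (e1'.symm.trans e1)
  have hP := (e2'.isProj hO).prod hQ
  exact (hs3.rotate (hs'.prod (SES.right_zero Q)) hP).cof.congr (e2.trans e).symm
    ((stIso_prod_right hP).symm.trans e3.symm)
    ((stIso_prod_right isProj_zero).symm.trans e3'.symm)

theorem Cof.rotate' (h : Cof M N L) (h' : Cof L' O L) (hO : IsProj O) : Cof L' M N := by
  obtain ⟨M₁, N₁, L₁, hs, e1, e2, e3⟩ := h
  obtain ⟨M₂, O₂, L₂, hs', e1', e2', e3'⟩ := h'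
  obtain ⟨Q, N₃, hQ, hs3, e⟩ := hs.change_right (e3'.symm.trans e3)
  have hP := (e2'.isProj hO).prod hQ
  exact (hs3.rotate' (hs'.prod (SES.left_zero Q)) hP).cof.congr
    ((stIso_prod_right isProj_zero).symm.trans e1'.symm)
    ((stIso_prod_right hP).symm.trans e1.symm) (e2.trans e).symm

theorem Cof.twist (h : Cof M N L) (a : ℤ) : Cof (twist a M) (twist a N) (twist a L) := by
  obtain ⟨M₁, N₁, L₁, hs, e1, e2, e3⟩ := h
  have key : ∀ {X Y : GrModA1}, StIso X Y → StIso (GrMod.twist a X) (GrMod.twist a Y) :=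
    fun ⟨e⟩ => ⟨(twBig A1.degree a).mapIso e⟩
  exact ⟨_, _, _, hs.twist a, key e1, key e2, key e3⟩

end

end Steenrod

/-! ## Compact objects -/

namespace Steenrod

open GrMod

/-- `M` is a direct summand of `N` in the stable module category. -/
def StRetract (M N : GrModA1) : Prop :=
  Nonempty (Retract ((toSt A1.degree).obj M) ((toSt A1.degree).obj N))

theorem StIso.stRetract {M N : GrModA1} : StIso M N → StRetract M N := fun ⟨e⟩ => ⟨.ofIso e⟩

theorem StRetract.trans {M N L : GrModA1} : StRetract M N → StRetract N L → StRetract M L :=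
  fun ⟨e⟩ ⟨e'⟩ => ⟨e.trans e'⟩

theorem stRetract_of_hom {M N : GrModA1} (i : M ⟶ N) (r : N ⟶ M)
    (h : stableRel A1.degree (i ≫ r) (𝟙 M)) : StRetract M N :=
  ⟨⟨(toSt _).map i, (toSt _).map r, by
    rw [← Functor.map_comp, (toSt_map_eq_iff _ _).2 h, CategoryTheory.Functor.map_id]⟩⟩

theorem stRetract_prod_left (M N : GrModA1) : StRetract M (M.prod N) :=
  stRetract_of_hom (prodInl M N) (prodFst M N) (stableRel_of_eq rfl)

theorem StRetract.exists_stIso {M N : GrModA1} (h : StRetract M N) :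
    ∃ M', StIso N (M.prod M') := by
  obtain ⟨e⟩ := h
  obtain ⟨i, hi⟩ := (toSt A1.degree).map_surjective e.i
  obtain ⟨r, hr⟩ := (toSt A1.degree).map_surjective e.r
  obtain ⟨P, hP, u, v, h⟩ : stableRel A1.degree (i ≫ r) (𝟙 M) := by
    rw [← toSt_map_eq_iff, Functor.map_comp, hi, hr, e.retract, CategoryTheory.Functor.map_id]
  have h : ∀ x, lin r (lin i x) - x = lin v (lin u x) := LinearMap.congr_fun h
  let s : M ⟶ N.prod P := prodLift i u
  let q : N.prod P ⟶ M := prodDesc r (negHom v)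
  have hq : ∀ x, lin q (lin s x) = x := fun x => by
    change lin r (lin i x) + -(lin v (lin u x)) = x
    rw [← h]
    abel
  refine ⟨ker q, (stIso_prod_right hP).trans
    (stIso_of_bijective (prodDesc s (kerι q)) ⟨?_, fun y => ?_⟩).symm⟩
  · rw [injective_iff_map_eq_zero]
    rintro ⟨x, y⟩ hxy
    change lin s x + lin (kerι q) y = 0 at hxy
    have h1 := congrArg (lin q) hxy
    rw [map_add, hq, map_zero, show lin q (lin (kerι q) y) = 0 from y.2, add_zero] at h1
    rw [h1, map_zero, zero_add] at hxy
    exact Prod.ext h1 (Subtype.ext hxy)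
  · refine ⟨(lin q y, ⟨y - lin s (lin q y), ?_⟩), ?_⟩
    · rw [LinearMap.mem_ker, map_sub, hq, sub_self]
    · exact add_sub_cancel _ _

theorem isShortExact_finite {M N L : GrModA1} (h : SES M N L) [Finite M.carrier]
    [Finite L.carrier] : Finite N.carrier := by
  obtain ⟨i, p, h⟩ := h
  obtain ⟨π, -, hπ⟩ := exists_gradedRetraction i h.1
  refine Finite.of_injective (fun n => (π n, lin p n)) fun x y hxy => ?_
  obtain ⟨h1, h2⟩ := Prod.ext_iff.1 hxy
  have : lin p (x - y) = 0 := by rw [map_sub, sub_eq_zero]; exact h2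
  obtain ⟨m, hm⟩ := (h.2.1 _).1 this
  have hm0 : m = 0 := by rw [← hπ m, hm, map_sub, sub_eq_zero]; exact h1
  rw [← sub_eq_zero, ← hm, hm0, map_zero]

/-- `M` represents a compact object of the stable module category. -/
def Cpt (M : GrModA1) : Prop := IsCompactObj ((toSt A1.degree).obj M)

theorem Cpt.of_retract {M N : GrModA1} (hN : Cpt N) (h : StRetract M N) : Cpt M := by
  obtain ⟨e⟩ := h
  intro ι X f
  obtain ⟨s, g, hg, hs⟩ := hN ι X (e.r ≫ f)
  obtain ⟨i, hi⟩ := (toSt A1.degree).map_surjective e.i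
  refine ⟨s, i ≫ g, ?_, fun k hk => ?_⟩
  · rw [Functor.map_comp, hi]
    refine (congrArg (fun k => e.i ≫ k) hg).trans ?_
    rw [← Category.assoc, e.retract, Category.id_comp]
  · rw [Category.assoc, lin_comp, hs k hk, LinearMap.zero_comp]

theorem Cpt.of_stIso {M N : GrModA1} (hN : Cpt N) (h : StIso M N) : Cpt M :=
  hN.of_retract h.stRetract

theorem cpt_of_finite (M : GrModA1) [Finite M.carrier] : Cpt M := by
  classical
  intro ι X f
  obtain ⟨g, hg⟩ := (toSt A1.degree).map_surjective f
  have := Fintype.ofFinite M.carrier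
  refine ⟨Finset.univ.biUnion fun m : M.carrier =>
    DFinsupp.support (β := fun i => (X i).carrier) (lin g m), g, hg, fun i hi => ?_⟩
  ext m
  simp only [Finset.mem_biUnion, Finset.mem_univ, true_and, not_exists] at hi
  exact DFinsupp.notMem_support_iff.1 (hi m)

/-! ### The radical -/

section Radical

variable {M : GrModA1}

theorem comp_sq1_smul (i : ℤ) (x : M.carrier) : M.comp i (sq1 • x) = sq1 • M.comp (i - 1) x := by
  refine hom_induction (p := fun x => M.comp i (sq1 • x) = sq1 • M.comp (i - 1) x) x
    (fun j x hx => ?_) (by simp) fun x y hx hy => by simp only [smul_add, map_add, hx, hy]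
  by_cases h : i = j + 1
  · rw [comp_of_mem _ (sq1_smul_mem hx h.symm), comp_of_mem _ (mem_deg_of_eq hx (by omega))]
  · rw [comp_of_mem_ne _ (sq1_smul_mem hx rfl) h, comp_of_mem_ne _ hx (by omega), smul_zero]

theorem comp_sq2_smul (i : ℤ) (x : M.carrier) : M.comp i (sq2 • x) = sq2 • M.comp (i - 2) x := by
  refine hom_induction (p := fun x => M.comp i (sq2 • x) = sq2 • M.comp (i - 2) x) x
    (fun j x hx => ?_) (by simp) fun x y hx hy => by simp only [smul_add, map_add, hx, hy]
  by_cases h : i = j + 2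
  · rw [comp_of_mem _ (sq2_smul_mem hx h.symm), comp_of_mem _ (mem_deg_of_eq hx (by omega))]
  · rw [comp_of_mem_ne _ (sq2_smul_mem hx rfl) h, comp_of_mem_ne _ hx (by omega), smul_zero]

/-- An additive subgroup which is stable under `Sq¹` and `Sq²` is a submodule. -/
def submoduleOfSq {M : Type} [AddCommGroup M] [Module A1 M] (K : AddSubgroup M)
    (h1 : ∀ x ∈ K, sq1 • x ∈ K) (h2 : ∀ x ∈ K, sq2 • x ∈ K) : Submodule A1 M :=
  { K with
    smul_mem' := fun a x hx => by
      refine A1_induction (p := fun a => ∀ x ∈ K, a • x ∈ K) a h1 h2 (fun r x hx => ?_)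
        (fun a b ha hb x hx => ?_) (fun a b ha hb x hx => ?_) x hx
      · rcases zmod_cases r with rfl | rfl
        · rw [map_zero, zero_smul]; exact zero_mem _
        · rwa [map_one, one_smul]
      · rw [add_smul]; exact add_mem (ha x hx) (hb x hx)
      · rw [mul_smul]; exact ha _ (hb x hx) }

/-- The radical `Sq¹ M + Sq² M`. -/
def radical (M : GrModA1) : Submodule A1 M.carrier :=
  submoduleOfSq
    { carrier := {x | ∃ y z : M.carrier, x = sq1 • y + sq2 • z}
      zero_mem' := ⟨0, 0, by simp⟩
      add_mem' := by
        rintro _ _ ⟨y, z, rfl⟩ ⟨y', z', rfl⟩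
        exact ⟨y + y', z + z', by simp only [smul_add]; abel⟩
      neg_mem' := by
        rintro _ ⟨y, z, rfl⟩
        exact ⟨-y, -z, by simp only [smul_neg]; abel⟩ }
    (fun x _ => ⟨x, 0, by simp⟩) (fun x _ => ⟨0, x, by simp⟩)

theorem comp_mem_radical (i : ℤ) (x : M.carrier) (hx : x ∈ radical M) :
    M.comp i x ∈ radical M := by
  obtain ⟨y, z, rfl⟩ := hx
  exact ⟨M.comp (i - 1) y, M.comp (i - 2) z, by rw [map_add, comp_sq1_smul, comp_sq2_smul]⟩

/-- The powers of the augmentation ideal applied to a module. -/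
def radPow (M : GrModA1) : ℕ → Set M.carrier
  | 0 => Set.univ
  | n + 1 => {x | ∃ y ∈ radPow M n, ∃ z ∈ radPow M n, x = sq1 • y + sq2 • z}

theorem eq_zero_of_mem_radPow {x : M.carrier} (hx : x ∈ radPow M 5) : x = 0 := by
  have h2 : ∀ x ∈ radPow M 2, ∃ a b c : M.carrier,
      x = sq1 • sq2 • a + sq2 • sq1 • b + sq1 • sq2 • sq1 • c := by
    rintro _ ⟨_, ⟨y, -, z, -, rfl⟩, _, ⟨y', -, z', -, rfl⟩, rfl⟩
    exact ⟨z, y', z', by simp [add_assoc]⟩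
  have h3 : ∀ x ∈ radPow M 3, ∃ a b c : M.carrier,
      x = sq1 • sq2 • sq1 • a + sq2 • sq1 • sq2 • b + sq1 • sq2 • sq1 • sq2 • c := by
    rintro _ ⟨y, hy, z, hz, rfl⟩
    obtain ⟨a, b, c, rfl⟩ := h2 y hy
    obtain ⟨a', b', c', rfl⟩ := h2 z hz
    exact ⟨b, a', c', by simp [add_assoc]⟩
  have h4 : ∀ x ∈ radPow M 4, ∃ a : M.carrier, x = sq1 • sq2 • sq1 • sq2 • a := by
    rintro _ ⟨y, hy, z, hz, rfl⟩
    obtain ⟨a, b, c, rfl⟩ := h3 y hy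
    obtain ⟨a', b', c', rfl⟩ := h3 z hz
    exact ⟨b + a', by simp⟩
  obtain ⟨y, hy, z, hz, rfl⟩ := hx
  obtain ⟨a, rfl⟩ := h4 y hy
  obtain ⟨b, rfl⟩ := h4 z hz
  simp

end Radical

/-! ### The trivial module -/

/-- The action of `𝒜₁` on `𝔽₂` through the augmentation. -/
noncomputable instance : Module A1 (ZMod 2) :=
  Module.compHom (ZMod 2) (aug.comp A1.val : A1 →ₐ[ZMod 2] ZMod 2).toRingHom

theorem triv_smul (a : A1) (x : ZMod 2) : a • x = aug (a : SteenrodAlgebra) * x := rfl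

/-- The trivial module `𝔽₂`, in degree `0`. -/
noncomputable def triv : GrModA1 where
  carrier := ZMod 2
  deg i := if i = 0 then ⊤ else ⊥
  isInternal := by
    refine isInternal_of_comp _ (fun i => if i = 0 then AddMonoidHom.id _ else 0)
      (fun i x hx => ?_) (fun i j hij x hx => ?_) ?_
    · by_cases h : i = 0
      · simp [h]
      · rw [if_neg h] at hx ⊢
        exact hx.symm
    · by_cases h : j = 0
      · subst h
        rw [if_neg hij.symm] at hx
        simpa using hx
      · rw [if_neg h]; rfl
    · rw [eq_top_iff]
      exact le_iSup_of_le 0 (by simp)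
  smul_mem := by
    intro i j a m ha hm
    by_cases hj : j = 0
    · by_cases hi : i = 0
      · rw [if_pos (by omega)]; trivial
      · rw [triv_smul, show aug (a : SteenrodAlgebra) = 0 from aug_eq_zero hi ha, zero_mul]
        exact zero_mem _
    · rw [if_neg hj] at hm
      rw [show m = 0 from hm, smul_zero]; exact zero_mem _

theorem sq1_smul_triv (x : triv.carrier) : sq1 • x = 0 := by
  refine (triv_smul sq1 x).trans ?_
  rw [show aug (sq1 : SteenrodAlgebra) = 0 by simp [sq1]]
  exact zero_mul (M₀ := ZMod 2) x

theorem sq2_smul_triv (x : triv.carrier) : sq2 • x = 0 := by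
  refine (triv_smul sq2 x).trans ?_
  rw [show aug (sq2 : SteenrodAlgebra) = 0 by simp [sq2]]
  exact zero_mul (M₀ := ZMod 2) x

theorem mem_triv_deg_zero (x : triv.carrier) : x ∈ triv.deg 0 := by
  change x ∈ (if (0 : ℤ) = 0 then (⊤ : AddSubgroup (ZMod 2)) else ⊥)
  rw [if_pos rfl]; trivial

end Steenrod

namespace Steenrod

open GrMod

/-- The module modulo its radical is a direct sum of trivial modules. -/
theorem exists_top_map (M : GrModA1) : ∃ (ι : Type) (d : ι → ℤ)
    (q : M ⟶ directSum fun i => twist (d i) triv), Function.Surjective (lin q) ∧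
      ∀ x, lin q x = 0 → x ∈ radical M := by
  classical
  let V := M.quot (radical M) comp_mem_radical
  let π := M.quotπ (radical M) comp_mem_radical
  have hπ : ∀ x, lin π x = 0 ↔ x ∈ radical M := fun x => Submodule.Quotient.mk_eq_zero _
  let _ : Module (ZMod 2) V.carrier := AddCommGroup.zmodModule two_nsmul_eq_zero
  let D : ℤ → Submodule (ZMod 2) V.carrier := fun i => AddSubgroup.toZModSubmodule 2 (V.deg i)
  have hD : DirectSum.IsInternal D := V.isInternal
  let b := fun i => Module.Basis.ofVectorSpace (ZMod 2) (D i)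
  let B := hD.collectedBasis b
  let ι := Σ i : ℤ, Module.Basis.ofVectorSpaceIndex (ZMod 2) (D i)
  let X : ι → GrModA1 := fun i => twist i.1 triv
  let c : V.carrier →+ (directSum X).carrier :=
    (finsuppAddEquivDFinsupp (ι := ι) (M := ZMod 2)).toAddMonoidHom.comp
      B.repr.toLinearMap.toAddMonoidHom
  have hc : ∀ v i, (show DirectSum ι fun i => (X i).carrier from c v) i = B.repr v i :=
    fun v i => rfl
  have hsm1 : ∀ v : (directSum X).carrier, sq1 • v = 0 := fun v =>
    DFinsupp.ext fun i => sq1_smul_triv _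
  have hsm2 : ∀ v : (directSum X).carrier, sq2 • v = 0 := fun v =>
    DFinsupp.ext fun i => sq2_smul_triv _
  have hr1 : ∀ x : M.carrier, lin π (sq1 • x) = 0 := fun x => (hπ _).2 ⟨x, 0, by simp⟩
  have hr2 : ∀ x : M.carrier, lin π (sq2 • x) = 0 := fun x => (hπ _).2 ⟨0, x, by simp⟩
  let q : M ⟶ directSum X := mkHom (N := directSum X)
    (linOfSq (c.comp (lin π).toAddMonoidHom)
      (fun x => by
        rw [hsm1]
        exact (congrArg c (hr1 x)).trans (map_zero c))
      (fun x => by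
        rw [hsm2]
        exact (congrArg c (hr2 x)).trans (map_zero c)))
    (by
      intro i m hm k
      change B.repr (lin π m) k ∈ triv.deg (i - k.1)
      by_cases h : i = k.1
      · rw [h, sub_self]
        exact mem_triv_deg_zero _
      · have : B.repr (lin π m) k = 0 :=
          hD.collectedBasis_repr_of_mem_ne b h (lin_mem π hm)
        rw [this]
        exact zero_mem _)
  refine ⟨ι, fun i => i.1, q, ?_, fun x hx => ?_⟩
  · refine Function.Surjective.comp (g := c) ?_ (M.quotπ_surjective _ comp_mem_radical)
    exact (finsuppAddEquivDFinsupp (ι := ι) (M := ZMod 2)).surjective.comp B.repr.surjective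
  · rw [← hπ]
    refine B.repr.injective ?_
    rw [map_zero]
    exact (finsuppAddEquivDFinsupp (ι := ι) (M := ZMod 2)).injective
      (hx.trans (map_zero (finsuppAddEquivDFinsupp (ι := ι) (M := ZMod 2))).symm)

/-- Compact objects are direct summands of finite modules. -/
theorem Cpt.exists_finite {M : GrModA1} (hM : Cpt M) :
    ∃ N : GrModA1, Finite N.carrier ∧ StRetract M N := by
  classical
  obtain ⟨ι, d, q, hq, hker⟩ := exists_top_map M
  obtain ⟨s, g, hg, hs⟩ := hM ι _ ((toSt A1.degree).map q)
  obtain ⟨σ, hσ, hqσ⟩ := exists_gradedSection q hq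
  have hqg : stableRel A1.degree q g := (toSt_map_eq_iff _ _).1 hg.symm
  obtain ⟨θ, hθ, h⟩ := (stableRel_iff _ _).1 hqg
  let τ : M ⟶ M := tr (σ.comp θ) (hσ.comp hθ).of_eq
  let φ : M ⟶ M := subHom (𝟙 M) τ
  have hφ : ∀ x, lin φ x = x - lin τ x := fun x => rfl
  have hφ1 : (toSt A1.degree).map φ = 𝟙 _ := by
    rw [← CategoryTheory.Functor.map_id, eq_comm, toSt_map_eq_iff, stableRel_iff]
    refine ⟨σ.comp θ, (hσ.comp hθ).of_eq, LinearMap.ext fun x => ?_⟩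
    exact sub_sub_cancel _ _
  have hqφ : ∀ x, lin q (lin φ x) = lin g x := fun x => by
    have e : (lin q).toAddMonoidHom.comp (σ.comp θ) = θ := AddMonoidHom.ext fun y => hqσ _
    rw [hφ, map_sub, lin_tr, map_trLin, e, ← h]
    exact sub_sub_cancel _ _
  have hfin : (Set.range (lin g)).Finite := by
    let r : (directSum fun i => twist (d i) triv).carrier → (s → ZMod 2) := fun v i =>
      (show DirectSum ι fun i => (twist (d i) triv).carrier from v) i
    refine Set.Finite.of_injOn (f := r) (t := Set.univ) (fun _ _ => trivial) ?_ Set.finite_univ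
    rintro _ ⟨x, rfl⟩ _ ⟨y, rfl⟩ hxy
    refine DFinsupp.ext fun i => ?_
    by_cases hi : i ∈ s
    · exact congrFun hxy ⟨i, hi⟩
    · exact (LinearMap.congr_fun (hs i hi) x).trans (LinearMap.congr_fun (hs i hi) y).symm
  have hW : ∀ x, ∃ w ∈ σ '' Set.range (lin g), ∃ y z : M.carrier,
      lin φ x = w + (sq1 • y + sq2 • z) := fun x => by
    obtain ⟨y, z, h⟩ := hker (lin φ x - σ (lin g x)) (by rw [map_sub, hqφ, hqσ, sub_self])
    exact ⟨_, ⟨_, ⟨x, rfl⟩, rfl⟩, y, z, by rw [← h]; abel⟩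
  have key : ∀ n, ∃ ψ : M ⟶ M, (toSt A1.degree).map ψ = 𝟙 _ ∧
      ∃ F : Set M.carrier, F.Finite ∧ ∀ x, ∃ w ∈ F, ∃ y ∈ radPow M n, lin ψ x = w + y := by
    intro n
    induction n with
    | zero => exact ⟨𝟙 M, CategoryTheory.Functor.map_id _ _, {0}, Set.finite_singleton _,
        fun x => ⟨0, rfl, x, trivial, (zero_add x).symm⟩⟩
    | succ n ih =>
      obtain ⟨ψ, hψ, F, hF, h⟩ := ih
      refine ⟨φ ≫ ψ, by rw [Functor.map_comp, hφ1, hψ, Category.comp_id],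
        (fun p : M.carrier × M.carrier × M.carrier => lin ψ p.1 + sq1 • p.2.1 + sq2 • p.2.2) ''
          ((σ '' Set.range (lin g)) ×ˢ F ×ˢ F),
        (((hfin.image σ).prod (hF.prod hF)).image _), fun x => ?_⟩
      obtain ⟨w, hw, y, z, hx⟩ := hW x
      obtain ⟨a, ha, y', hy', hy⟩ := h y
      obtain ⟨b, hb, z', hz', hz⟩ := h z
      refine ⟨_, ⟨(w, a, b), ⟨hw, ha, hb⟩, rfl⟩, sq1 • y' + sq2 • z', ⟨y', hy', z', hz', rfl⟩, ?_⟩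
      rw [lin_comp, LinearMap.comp_apply, hx, map_add, map_add, map_smul, map_smul, hy, hz]
      simp only [smul_add]
      abel
  obtain ⟨ψ, hψ, F, hF, h⟩ := key 5
  have hr : ∀ x, lin ψ x ∈ F := fun x => by
    obtain ⟨w, hw, y, hy, hx⟩ := h x
    rwa [hx, eq_zero_of_mem_radPow hy, add_zero]
  let N := M.sub (LinearMap.range (lin ψ)) (comp_mem_range ψ)
  have hN : Finite N.carrier := (hF.subset (by rintro _ ⟨x, rfl⟩; exact hr x) :
    (LinearMap.range (lin ψ) : Set M.carrier).Finite).to_subtype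
  refine ⟨N, hN, stRetract_of_hom (mkHom (M := M) (N := N) (lin ψ).rangeRestrict
    fun i x hx => lin_mem ψ hx) (M.subι _ (comp_mem_range ψ)) ?_⟩
  rw [← toSt_map_eq_iff, CategoryTheory.Functor.map_id, ← hψ]
  rfl

theorem finite_ind (M : GrModA1) [Finite M.carrier] : Finite (ind M).carrier :=
  inferInstanceAs (Finite (Fin 8 → M.carrier))

theorem Cof.exists_finite {M N L : GrModA1} (h : Cof M N L) [Finite M.carrier]
    [Finite L.carrier] : ∃ N' : GrModA1, Finite N'.carrier ∧ StIso N N' := by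
  obtain ⟨M₁, N₁, L₁, hs, e1, e2, e3⟩ := h
  obtain ⟨Q, N₂, hQ, hs2, e⟩ := hs.change_right e3
  obtain ⟨N₃, h3, h3'⟩ := hs2.exists_ker (SES.split L Q)
  obtain ⟨Q', N₄, hQ', hs4, e'⟩ := h3.change_left e1
  obtain ⟨Z, h5, h5'⟩ := hs4.exists_coker (M₀ := Q') (S := M)
    ⟨prodInr M Q', prodFst M Q', fun x y h => congrArg Prod.snd h,
      fun x => ⟨fun h => ⟨x.2, Prod.ext h.symm rfl⟩, by rintro ⟨y, rfl⟩; rfl⟩,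
      fun x => ⟨(x, (0 : Q'.carrier)), rfl⟩⟩
  exact ⟨Z, isShortExact_finite h5', e2.trans (e.trans ((stIso_of_ses_right h3' hQ).symm.trans
    (e'.trans (stIso_of_ses_left h5 hQ'))))⟩

theorem Cof.cpt {M N L : GrModA1} (h : Cof M N L) (hM : Cpt M) (hL : Cpt L) : Cpt N := by
  obtain ⟨F, hF, hMF⟩ := hM.exists_finite
  obtain ⟨F', hF', hLF⟩ := hL.exists_finite
  obtain ⟨M', e⟩ := hMF.exists_stIso
  obtain ⟨L', e'⟩ := hLF.exists_stIso
  obtain ⟨X, hX, eX⟩ := ((h.prod (Cof.split M' L')).congr e.symm (StIso.refl _)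
    e'.symm).exists_finite
  exact (cpt_of_finite X).of_retract ((stRetract_prod_left _ _).trans eX.stRetract)

theorem cpt_up {M P L : GrModA1} (h : Cof M P L) (hP : IsProj P) (hM : Cpt M) : Cpt L := by
  obtain ⟨F, hF, hMF⟩ := hM.exists_finite
  obtain ⟨M', e⟩ := hMF.exists_stIso
  obtain ⟨P', L', hP', h'⟩ := exists_cof_up M'
  have hi : Finite (ind (twist (-6) F)).carrier := @finite_ind (twist (-6) F) hF
  have hF' := isShortExact_coker _ (embed_injective F)
  have hfin : Finite (coker (embed F)).carrier := Finite.of_surjective _ hF'.2.2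
  have h2 := (SES.cof ⟨_, _, hF'⟩).rotate
    ((h.prod h'.cof).congr e.symm (StIso.refl _) (StIso.refl _)) (hP.prod hP')
  exact ((cpt_of_finite (coker (embed F))).of_stIso
    (h2.stIso_left (isProj_ind _)).symm).of_retract (stRetract_prod_left _ _)

theorem cpt_down {M P L : GrModA1} (h : Cof M P L) (hP : IsProj P) (hL : Cpt L) : Cpt M := by
  obtain ⟨F, hF, hMF⟩ := hL.exists_finite
  obtain ⟨L', e⟩ := hMF.exists_stIso
  obtain ⟨M', P', hP', h'⟩ := exists_cof_down L'
  have hi := finite_ind F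
  have hF' := isShortExact_ker _ (indπ_surjective F)
  have hfin : Finite (ker (indπ F)).carrier := Finite.of_injective _ hF'.1
  have h2 := (SES.cof ⟨_, _, hF'⟩).rotate'
    ((h.prod h'.cof).congr (StIso.refl _) (StIso.refl _) e.symm) (hP.prod hP')
  exact ((cpt_of_finite (ker (indπ F))).of_stIso
    (h2.stIso_right (isProj_ind _))).of_retract (stRetract_prod_left _ _)

theorem cpt_of_isProj {P : GrModA1} (hP : IsProj P) : Cpt P := by
  have : Finite (zero A1.degree).carrier := inferInstanceAs (Finite PUnit)
  exact (cpt_of_finite (zero _)).of_stIso (stIso_zero_iff.2 hP)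

end Steenrod

/-! ## Filtrations and complexity -/

namespace Steenrod

open GrMod

/-- The object of the stable module category given by a module. -/
abbrev stObj (M : GrModA1) (h : Cpt M) : StModA1 := ⟨(toSt A1.degree).obj M, h⟩

theorem exists_isCofiberSeq_iff {X Y Z : StModA1} :
    (∃ (f : X ⟶ Y) (g : Y ⟶ Z), IsCofiberSeq f g) ↔ Cof X.obj.as Y.obj.as Z.obj.as := by
  constructor
  · rintro ⟨f, g, M, N, L, i, p, eX, eY, eZ, h, -, -⟩
    exact ⟨M, N, L, ⟨i, p, h⟩, ⟨eX.symm⟩, ⟨eY.symm⟩, ⟨eZ.symm⟩⟩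
  · rintro ⟨M, N, L, ⟨i, p, h⟩, ⟨eX⟩, ⟨eY⟩, ⟨eZ⟩⟩
    refine ⟨ObjectProperty.homMk (eX.hom ≫ (toSt _).map i ≫ eY.inv),
      ObjectProperty.homMk (eY.hom ≫ (toSt _).map p ≫ eZ.inv), M, N, L, i, p, eX.symm, eY.symm,
      eZ.symm, h, ?_, ?_⟩
    · exact (Iso.inv_hom_id_assoc eX _).symm
    · exact (Iso.inv_hom_id_assoc eY _).symm

theorem isZero_iff {X : StModA1} : Limits.IsZero X ↔ IsProj X.obj.as := by
  constructor
  · intro h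
    have : (𝟙 X : X ⟶ X) = ObjectProperty.homMk ((toSt _).map (zeroHom X.obj.as X.obj.as)) :=
      h.eq_of_src _ _
    have h' : (toSt A1.degree).map (zeroHom X.obj.as X.obj.as) =
        (toSt A1.degree).map (𝟙 X.obj.as) := (congrArg (fun f => f.hom) this).symm
    rw [toSt_map_eq_iff] at h'
    refine stIso_zero_iff.1 (stIso_iff.2 ⟨zeroHom _ _, zeroHom _ _, ?_, stableRel_of_eq ?_⟩)
    · exact h'
    · exact hom_ext_apply fun x => rfl
  · intro h
    have key : ∀ {Y Z : StModA1} (f : Y ⟶ Z), IsProj Y.obj.as ∨ IsProj Z.obj.as →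
        f = ObjectProperty.homMk ((toSt _).map (zeroHom Y.obj.as Z.obj.as)) := by
      intro Y Z f hYZ
      refine ObjectProperty.hom_ext _ ?_
      obtain ⟨f', hf'⟩ := (toSt A1.degree).map_surjective (X := Y.obj.as) (Y := Z.obj.as) f.hom
      refine hf'.symm.trans ((toSt_map_eq_iff _ _).2 ?_)
      rcases hYZ with hY | hZ
      · exact ⟨_, hY, 𝟙 _, f', sub_zero (lin f')⟩
      · exact ⟨_, hZ, f', 𝟙 _, sub_zero (lin f')⟩
    exact ⟨fun Y => ⟨⟨⟨_⟩, fun f => key f (Or.inl h)⟩⟩, fun Y => ⟨⟨⟨_⟩, fun f => key f (Or.inr h)⟩⟩⟩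

theorem isSuspension_iff {X Z : StModA1} :
    IsSuspension X Z ↔ ∃ P, IsProj P ∧ Cof X.obj.as P Z.obj.as := by
  constructor
  · rintro ⟨O, f, g, hO, h⟩
    exact ⟨O.obj.as, isZero_iff.1 hO, exists_isCofiberSeq_iff.1 ⟨f, g, h⟩⟩
  · rintro ⟨P, hP, h⟩
    obtain ⟨f, g, h⟩ := exists_isCofiberSeq_iff (Y := stObj P (cpt_of_isProj hP)) |>.2 h
    exact ⟨_, f, g, isZero_iff.2 hP, h⟩

/-- `M` is a shift of `G`. -/
def Shifted (G : StModA1) (M : GrModA1) : Prop := ∃ (h : Cpt M) (n : ℤ), IsShift G n (stObj M h)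

/-- `M` has a filtration of length `ℓ` by shifts of `G`. -/
def Fil (G : StModA1) (ℓ : ℕ) (M : GrModA1) : Prop := ∃ h : Cpt M, HasFiltration G ℓ (stObj M h)

section

variable {G : StModA1} {M N L P : GrModA1} {a b ℓ : ℕ}

theorem Shifted.up (h : Shifted G M) (hc : Cof M P L) (hP : IsProj P) : Shifted G L := by
  obtain ⟨hM, n, h⟩ := h
  exact ⟨cpt_up hc hP hM, n + 1, h.up (isSuspension_iff.2 ⟨P, hP, hc⟩)⟩

theorem Shifted.down (h : Shifted G L) (hc : Cof M P L) (hP : IsProj P) : Shifted G M := by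
  obtain ⟨hL, n, h⟩ := h
  exact ⟨cpt_down hc hP hL, n - 1, h.down (isSuspension_iff.2 ⟨P, hP, hc⟩)⟩

theorem shifted_self : Shifted G G.obj.as := ⟨G.property, 0, .iso (Iso.refl _)⟩

theorem fil_zero_iff : Fil G 0 M ↔ IsProj M := by
  constructor
  · rintro ⟨h, ⟨h'⟩⟩
    exact isZero_iff.1 h'
  · intro h
    exact ⟨cpt_of_isProj h, .zero (isZero_iff.2 h)⟩

theorem fil_succ_iff : Fil G (ℓ + 1) N ↔ ∃ M L, Fil G ℓ M ∧ Shifted G L ∧ Cof M N L := by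
  constructor
  · rintro ⟨h, h'⟩
    cases h' with
    | succ f g n h1 h2 h3 =>
      exact ⟨_, _, ⟨_, h1⟩, ⟨_, n, h3⟩, exists_isCofiberSeq_iff.1 ⟨f, g, h2⟩⟩
  · rintro ⟨M, L, ⟨hM, h1⟩, ⟨hL, n, h3⟩, h⟩
    obtain ⟨f, g, h2⟩ := exists_isCofiberSeq_iff (X := stObj M hM)
      (Y := stObj N (h.cpt hM hL)) (Z := stObj L hL) |>.2 h
    exact ⟨h.cpt hM hL, .succ f g n h1 h2 h3⟩

theorem Fil.of_stIso (h : Fil G ℓ M) (e : StIso M N) : Fil G ℓ N := by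
  cases ℓ with
  | zero => exact fil_zero_iff.2 (e.isProj (fil_zero_iff.1 h))
  | succ ℓ =>
    obtain ⟨M', L, h1, h2, h3⟩ := fil_succ_iff.1 h
    exact fil_succ_iff.2 ⟨M', L, h1, h2, h3.congr (StIso.refl _) e (StIso.refl _)⟩

theorem Fil.second (hM : Fil G a M) (hL : Fil G b L) (h : Cof M N L) : Fil G (a + b) N := by
  induction b generalizing N L with
  | zero => exact hM.of_stIso (h.stIso_right (fil_zero_iff.1 hL))
  | succ b ih =>
    obtain ⟨L', S, h1, h2, h3⟩ := fil_succ_iff.1 hL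
    obtain ⟨X, hX, hX'⟩ := h.exists_ker h3
    exact fil_succ_iff.2 ⟨X, S, ih h1 hX, h2, hX'⟩

theorem Shifted.fil (h : Shifted G M) : Fil G 1 M :=
  fil_succ_iff.2 ⟨_, _, fil_zero_iff.2 isProj_zero, h, Cof.left_zero M⟩

theorem Fil.third (hM : Fil G a M) (hN : Fil G b N) (h : Cof M N L) : Fil G (a + b) L := by
  induction a generalizing M L with
  | zero =>
    rw [zero_add]
    exact hN.of_stIso (h.stIso_left (fil_zero_iff.1 hM))
  | succ a ih =>
    obtain ⟨M', S, h1, h2, h3⟩ := fil_succ_iff.1 hM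
    obtain ⟨X, hX, hX'⟩ := h.exists_coker h3
    obtain ⟨P, S', hP, hS⟩ := exists_cof_up S
    rw [Nat.succ_add_eq_add_succ]
    exact fil_succ_iff.2 ⟨X, S', ih h1 hX, h2.up hS.cof hP, hX'.rotate hS.cof hP⟩

theorem Fil.first (hN : Fil G a N) (hL : Fil G b L) (h : Cof M N L) : Fil G (a + b) M := by
  induction b generalizing N L a with
  | zero => exact hN.of_stIso (h.stIso_right (fil_zero_iff.1 hL)).symm
  | succ b ih =>
    obtain ⟨L', S, h1, h2, h3⟩ := fil_succ_iff.1 hL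
    obtain ⟨X, hX, hX'⟩ := h.exists_ker h3
    obtain ⟨S', P, hP, hS⟩ := exists_cof_down S
    have := (h2.down hS.cof hP).fil.second hN (hX'.rotate' hS.cof hP)
    rw [← Nat.succ_add_eq_add_succ, ← Nat.one_add]
    exact ih this h1 hX

end

/-- `M` is a direct summand of a module with a filtration of length `ℓ` by shifts of `G`. -/
def Built (G : StModA1) (ℓ : ℕ) (M : GrModA1) : Prop := ∃ W, Fil G ℓ W ∧ StRetract M W

section

variable {G : StModA1} {M N L P : GrModA1} {a b ℓ : ℕ}

theorem Built.exists_prod (h : Built G ℓ M) : ∃ M', Fil G ℓ (M.prod M') := by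
  obtain ⟨W, hW, h⟩ := h
  obtain ⟨M', e⟩ := h.exists_stIso
  exact ⟨M', hW.of_stIso e⟩

theorem Built.retract (h : Built G ℓ N) (e : StRetract M N) : Built G ℓ M := by
  obtain ⟨W, hW, h⟩ := h
  exact ⟨W, hW, e.trans h⟩

theorem stIso_prod_left (hP : IsProj P) : StIso M (P.prod M) :=
  ((Cof.split P M).stIso_left hP).symm

theorem Built.second (hM : Built G a M) (hL : Built G b L) (h : Cof M N L) :
    Built G (a + b) N := by
  obtain ⟨M', hM⟩ := hM.exists_prod
  obtain ⟨L', hL⟩ := hL.exists_prod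
  exact ⟨_, hM.second hL (h.prod (Cof.split M' L')), stRetract_prod_left _ _⟩

theorem Built.third (hM : Built G a M) (hN : Built G b N) (h : Cof M N L) :
    Built G (a + b) L := by
  obtain ⟨M', hM⟩ := hM.exists_prod
  obtain ⟨N', hN⟩ := hN.exists_prod
  obtain ⟨P, J, hP, hJ⟩ := exists_cof_up M'
  refine ⟨_, Fil.third (hM.of_stIso ((StIso.refl M).prod (stIso_prod_left isProj_zero)))
    (hN.of_stIso ((StIso.refl N).prod (stIso_prod_right hP)))
    (h.prod ((Cof.left_zero N').prod hJ.cof)), stRetract_prod_left _ _⟩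

theorem Built.first (hN : Built G a N) (hL : Built G b L) (h : Cof M N L) :
    Built G (a + b) M := by
  obtain ⟨N', hN⟩ := hN.exists_prod
  obtain ⟨L', hL⟩ := hL.exists_prod
  obtain ⟨J, P, hP, hJ⟩ := exists_cof_down L'
  refine ⟨_, Fil.first (hN.of_stIso ((StIso.refl N).prod (stIso_prod_right hP)))
    (hL.of_stIso ((StIso.refl L).prod (stIso_prod_left isProj_zero)))
    (h.prod ((Cof.right_zero N').prod hJ.cof)), stRetract_prod_left _ _⟩

theorem built_self : Built G 1 G.obj.as := ⟨_, shifted_self.fil, (StIso.refl _).stRetract⟩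

theorem built_of_isProj (h : IsProj M) : Built G 0 M :=
  ⟨M, fil_zero_iff.2 h, (StIso.refl _).stRetract⟩

theorem Built.isProj (h : Built G 0 M) : IsProj M := by
  obtain ⟨M', h⟩ := h.exists_prod
  exact (fil_zero_iff.1 h).of_retract (prodInl M M') (prodFst M M') rfl

theorem stRetract_iff {X Y : StModA1} :
    Nonempty (Retract X Y) ↔ StRetract X.obj.as Y.obj.as := by
  constructor
  · rintro ⟨e⟩
    exact ⟨⟨e.i.hom, e.r.hom, congrArg (fun f => f.hom) e.retract⟩⟩
  · rintro ⟨e⟩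
    exact ⟨⟨ObjectProperty.homMk e.i, ObjectProperty.homMk e.r,
      ObjectProperty.hom_ext _ e.retract⟩⟩

theorem complexity_le_iff {X : StModA1} :
    complexity G X ≤ (ℓ : ℕ∞) ↔ ∃ k ≤ ℓ, Built G k X.obj.as := by
  have hS : ∀ k : ℕ, (∃ W, HasFiltration G k W ∧ Nonempty (Retract X W)) ↔
      Built G k X.obj.as := fun k => by
    constructor
    · rintro ⟨W, h, e⟩
      exact ⟨W.obj.as, ⟨W.property, h⟩, stRetract_iff.1 e⟩
    · rintro ⟨W, ⟨hW, h⟩, e⟩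
      exact ⟨_, h, stRetract_iff.2 e⟩
  constructor
  · intro h
    by_contra hk
    push Not at hk
    have : ((ℓ + 1 : ℕ) : ℕ∞) ≤ complexity G X := by
      refine le_iInf₂ fun k hk' => ?_
      by_contra hlt
      exact hk k (Nat.lt_succ_iff.1 (Nat.cast_lt.1 (not_le.1 hlt))) ((hS k).1 hk')
    have := this.trans h
    exact absurd (Nat.cast_le.1 this) (by omega)
  · rintro ⟨k, hk, h⟩
    exact (iInf₂_le k ((hS k).2 h)).trans (Nat.cast_le.2 hk)

end

end Steenrod

/-! ## Generators -/

namespace Steenrod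

open GrMod

/-- Properties of modules with a cost that is subadditive in cofiber sequences. -/
structure Cost (B : ℕ → GrModA1 → Prop) : Prop where
  proj : ∀ {M}, IsProj M → B 0 M
  retract : ∀ {k M N}, B k N → StRetract M N → B k M
  second : ∀ {a b M N L}, B a M → B b L → Cof M N L → B (a + b) N
  third : ∀ {a b M N L}, B a M → B b N → Cof M N L → B (a + b) L
  first : ∀ {a b M N L}, B a N → B b L → Cof M N L → B (a + b) M

theorem cost_built (G : StModA1) : Cost (Built G) where
  proj := built_of_isProj
  retract := Built.retract
  second := Built.second
  third := Built.third
  first := Built.first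

theorem Cost.of_stIso {B : ℕ → GrModA1 → Prop} (hB : Cost B) {k : ℕ} {M N : GrModA1} (h : B k M)
    (e : StIso M N) : B k N :=
  hB.retract h e.symm.stRetract

theorem Cost.exists {B : ℕ → GrModA1 → Prop} (hB : Cost B) : Cost fun _ M => ∃ k, B k M where
  proj h := ⟨0, hB.proj h⟩
  retract := fun ⟨k, h⟩ e => ⟨k, hB.retract h e⟩
  second := fun ⟨_, h⟩ ⟨_, h'⟩ e => ⟨_, hB.second h h' e⟩
  third := fun ⟨_, h⟩ ⟨_, h'⟩ e => ⟨_, hB.third h h' e⟩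
  first := fun ⟨_, h⟩ ⟨_, h'⟩ e => ⟨_, hB.first h h' e⟩

theorem cost_of_isThick {P : ObjectProperty StModA1} (hP : IsThick P) :
    Cost fun _ M => ∃ h : Cpt M, P (stObj M h) where
  proj h := ⟨cpt_of_isProj h, hP.zero _ (isZero_iff.2 h)⟩
  retract := fun ⟨h, h'⟩ e => ⟨h.of_retract e, hP.retract _ (stObj _ h) (stRetract_iff.2 e) h'⟩
  second := fun {_ _ M N L} ⟨hM, h1⟩ ⟨hL, h2⟩ h => by
    obtain ⟨f, g, hc⟩ := exists_isCofiberSeq_iff (X := stObj M hM)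
      (Y := stObj N (h.cpt hM hL)) (Z := stObj L hL) |>.2 h
    exact ⟨h.cpt hM hL, hP.second f g hc h1 h2⟩
  third := fun {_ _ M N L} ⟨hM, h1⟩ ⟨hN, h2⟩ h => by
    obtain ⟨I, J, hI, hJ⟩ := exists_cof_up M
    have hL : Cpt L := (h.rotate hJ.cof hI).cpt hN (cpt_up hJ.cof hI hM)
    obtain ⟨f, g, hc⟩ := exists_isCofiberSeq_iff (X := stObj M hM)
      (Y := stObj N hN) (Z := stObj L hL) |>.2 h
    exact ⟨hL, hP.third f g hc h1 h2⟩
  first := fun {_ _ M N L} ⟨hN, h1⟩ ⟨hL, h2⟩ h => by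
    obtain ⟨J, I, hI, hJ⟩ := exists_cof_down L
    have hM : Cpt M := (h.rotate' hJ.cof hI).cpt (cpt_down hJ.cof hI hL) hN
    obtain ⟨f, g, hc⟩ := exists_isCofiberSeq_iff (X := stObj M hM)
      (Y := stObj N hN) (Z := stObj L hL) |>.2 h
    exact ⟨hM, hP.first f g hc h1 h2⟩

theorem Cost.isThick {p : GrModA1 → Prop} (hp : Cost fun _ => p) :
    IsThick fun X : StModA1 => p X.obj.as where
  zero _ h := hp.proj (isZero_iff.1 h)
  retract _ _ e h := hp.retract (k := 0) h (stRetract_iff.1 e)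
  third f g hc h1 h2 := hp.third (a := 0) (b := 0) h1 h2 (exists_isCofiberSeq_iff.1 ⟨f, g, hc⟩)
  second f g hc h1 h2 := hp.second (a := 0) (b := 0) h1 h2 (exists_isCofiberSeq_iff.1 ⟨f, g, hc⟩)
  first f g hc h1 h2 := hp.first (a := 0) (b := 0) h1 h2 (exists_isCofiberSeq_iff.1 ⟨f, g, hc⟩)

theorem _root_.IsGenerator.of_cost {G : StModA1} (hG : IsGenerator G) {p : GrModA1 → Prop}
    (hp : Cost fun _ => p) (h : p G.obj.as) {M : GrModA1} (hM : Cpt M) : p M :=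
  hG _ hp.isThick h (stObj M hM)

/-! ### Trivial submodules -/

section Unit

variable {M : GrModA1} {i : ℤ} {m : M.carrier}

/-- The additive map from `𝔽₂` given by an element. -/
def unitAdd (m : M.carrier) : ZMod 2 →+ M.carrier where
  toFun x := if x = 0 then 0 else m
  map_zero' := if_pos rfl
  map_add' x y := by
    rcases zmod_cases x with rfl | rfl <;> rcases zmod_cases y with rfl | rfl
    · simp
    · simp
    · simp
    · rw [if_pos (by decide), if_neg one_ne_zero, add_self_eq_zero]

theorem unitAdd_one (m : M.carrier) : unitAdd m 1 = m := by
  simp [unitAdd]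

theorem smul_unitAdd {a : A1} (h : a • m = 0) (x : ZMod 2) : a • unitAdd m x = 0 := by
  rcases zmod_cases x with rfl | rfl
  · rw [map_zero, smul_zero]
  · rw [unitAdd_one, h]

/-- The map from a twist of the trivial module given by an invariant element. -/
noncomputable def unitMap (hm : m ∈ M.deg i) (h1 : sq1 • m = 0) (h2 : sq2 • m = 0) :
    twist i triv ⟶ M :=
  mkHom (M := twist i triv)
    (linOfSq (M := triv.carrier) (unitAdd m)
      (fun x => by
        rw [sq1_smul_triv]
        exact (map_zero (unitAdd m)).trans (smul_unitAdd h1 x).symm)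
      (fun x => by
        rw [sq2_smul_triv]
        exact (map_zero (unitAdd m)).trans (smul_unitAdd h2 x).symm)) (by
    intro j x hx
    by_cases hj : j = i
    · subst hj
      rcases zmod_cases x with rfl | rfl
      · exact (map_zero (unitAdd m)).symm ▸ zero_mem _
      · exact (unitAdd_one m).symm ▸ hm
    · change x ∈ (if j - i = 0 then (⊤ : AddSubgroup (ZMod 2)) else ⊥) at hx
      rw [if_neg (by omega)] at hx
      rw [show x = 0 from hx]
      exact (map_zero (unitAdd m)).symm ▸ zero_mem _)

theorem unitMap_injective (hm : m ∈ M.deg i) (h1 : sq1 • m = 0) (h2 : sq2 • m = 0) (h : m ≠ 0) :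
    Function.Injective (lin (unitMap hm h1 h2)) := by
  rw [injective_iff_map_eq_zero]
  intro x hx
  rcases zmod_cases x with rfl | rfl
  · rfl
  · exact absurd ((unitAdd_one m).symm.trans hx) h

end Unit

theorem exists_socle {M : GrModA1} (hM : Nontrivial M.carrier) :
    ∃ (i : ℤ) (m : M.carrier), m ∈ M.deg i ∧ m ≠ 0 ∧ sq1 • m = 0 ∧ sq2 • m = 0 := by
  by_contra hcon
  push Not at hcon
  have h0 : ∀ n, (0 : M.carrier) ∈ radPow M n := fun n => by
    induction n with
    | zero => trivial
    | succ n ih => exact ⟨0, ih, 0, ih, by simp⟩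
  have key : ∀ n, ∃ (i : ℤ) (m : M.carrier), m ∈ M.deg i ∧ m ≠ 0 ∧ m ∈ radPow M n := by
    intro n
    induction n with
    | zero =>
      obtain ⟨x, hx⟩ := exists_ne (0 : M.carrier)
      by_contra h
      push Not at h
      exact hx (eq_zero_of_comp fun i => by
        by_contra hi
        exact h i _ (M.comp_mem i x) hi trivial)
    | succ n ih =>
      obtain ⟨i, m, hm, hm0, hmr⟩ := ih
      by_cases h : sq1 • m = 0
      · exact ⟨i + 2, sq2 • m, sq2_smul_mem hm rfl, hcon i m hm hm0 h, 0, h0 n, m, hmr, by simp⟩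
      · exact ⟨i + 1, sq1 • m, sq1_smul_mem hm rfl, h, m, hmr, 0, h0 n, by simp⟩
  obtain ⟨i, m, -, hm, hm5⟩ := key 5
  exact hm (eq_zero_of_mem_radPow hm5)

/-- The twists of the trivial module generate all compact objects. -/
theorem Cost.of_triv {p : GrModA1 → Prop} (hp : Cost fun _ => p) (h : ∀ i, p (twist i triv))
    {M : GrModA1} (hM : Cpt M) : p M := by
  have key : ∀ n, ∀ M : GrModA1, Finite M.carrier → Nat.card M.carrier ≤ n → p M := by
    intro n
    induction n with
    | zero =>
      intro M hM hn
      have := Nat.card_pos (α := M.carrier)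
      omega
    | succ n ih =>
      intro M hM hn
      by_cases hs : Nontrivial M.carrier
      · obtain ⟨i, m, hm, hm0, h1, h2⟩ := exists_socle hs
        have hinj := unitMap_injective hm h1 h2 hm0
        have hc := isShortExact_coker _ hinj
        have hfin : Finite (coker (unitMap hm h1 h2)).carrier := Finite.of_surjective _ hc.2.2
        refine hp.second (a := 0) (b := 0) (h i) (ih _ hfin ?_) (SES.cof ⟨_, _, hc⟩)
        have := Fintype.ofFinite M.carrier
        have := Fintype.ofFinite (coker (unitMap hm h1 h2)).carrier
        rw [Nat.card_eq_fintype_card] at hn ⊢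
        refine Nat.lt_succ_iff.1 (lt_of_lt_of_le
          (Fintype.card_lt_of_surjective_not_injective _ hc.2.2 fun hi => hm0 ?_) hn)
        refine hi (Eq.trans ?_ (map_zero _).symm)
        exact (hc.2.1 m).2 ⟨(1 : ZMod 2), unitAdd_one m⟩
      · rw [not_nontrivial_iff_subsingleton] at hs
        refine hp.proj fun X Y q f _ => ⟨zeroHom _ _, hom_ext_apply fun x => ?_⟩
        rw [Subsingleton.elim x 0, map_zero, map_zero]
  obtain ⟨N, hN, e⟩ := hM.exists_finite
  exact hp.retract (k := 0) (key _ N hN le_rfl) e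

end Steenrod

/-! ## Left ideals of `𝒜₁` -/

namespace Steenrod

open GrMod

theorem ind_comp_apply (M : GrModA1) (i : ℤ) (v : (ind M).carrier) (k : Fin 8) :
    (show IndCarrier M from (ind M).comp i v) k =
      M.comp (i - basisDeg k) ((show IndCarrier M from v) k) := by
  refine hom_induction (M := ind M) (p := fun v => (show IndCarrier M from (ind M).comp i v) k =
      M.comp (i - basisDeg k) ((show IndCarrier M from v) k)) v (fun j v hv => ?_) ?_
      fun x y hx hy => ?_
  · by_cases h : i = j
    · subst h
      exact (congrFun ((ind M).comp_of_mem hv) k).trans (M.comp_of_mem (hv k)).symm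
    · exact (congrFun ((ind M).comp_of_mem_ne hv h) k).trans
        (M.comp_of_mem_ne (hv k) (by omega)).symm
  · exact (congrFun (map_zero ((ind M).comp i)) k).trans (map_zero _).symm
  · refine (congrFun (map_add ((ind M).comp i) x y) k).trans ?_
    exact (congrArg₂ (· + ·) hx hy).trans (map_add (M.comp _) _ _).symm

/-- Sets of coordinates whose vanishing defines a left ideal. -/
def IsStableSet (Z : Finset (Fin 8)) : Prop :=
  (∀ p ∈ sqEntries 1, p.1 ∈ Z → p.2 ∈ Z) ∧ ∀ p ∈ sqEntries 2, p.1 ∈ Z → p.2 ∈ Z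

instance (Z : Finset (Fin 8)) : Decidable (IsStableSet Z) :=
  inferInstanceAs (Decidable (_ ∧ _))

theorem sq_smul_apply_eq_zero {M : GrModA1} {Z : Finset (Fin 8)} {n : ℕ} (a : A1)
    (ha : (a : SteenrodAlgebra) = Sq n) (hZ : ∀ p ∈ sqEntries n, p.1 ∈ Z → p.2 ∈ Z)
    {v : IndCarrier M} (hv : ∀ k ∈ Z, v k = 0) (k : Fin 8) (hk : k ∈ Z) : (a • v) k = 0 := by
  rw [ind_smul_apply, ha, rep_Sq]
  refine Finset.sum_eq_zero fun j _ => ?_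
  by_cases h : (k, j) ∈ sqEntries n
  · rw [hv j (hZ _ h hk), smul_zero]
  · rw [sqMat, Matrix.of_apply, if_neg h, map_zero, zero_smul]

/-- The submodule of vectors with vanishing coordinates in `Z`. -/
noncomputable def coordSubmodule (M : GrModA1) (Z : Finset (Fin 8)) (hZ : IsStableSet Z) :
    Submodule A1 (IndCarrier M) :=
  submoduleOfSq
    { carrier := {v | ∀ k ∈ Z, v k = 0}
      zero_mem' := fun _ _ => rfl
      add_mem' := fun {v w} hv hw k hk => by rw [IndCarrier.add_apply, hv k hk, hw k hk, add_zero]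
      neg_mem' := fun {v} hv k hk => neg_eq_zero.2 (hv k hk) }
    (fun _ hv => sq_smul_apply_eq_zero sq1 rfl hZ.1 hv)
    (fun _ hv => sq_smul_apply_eq_zero sq2 rfl hZ.2 hv)

theorem mem_coordSubmodule {M : GrModA1} {Z : Finset (Fin 8)} {hZ : IsStableSet Z}
    {v : IndCarrier M} : v ∈ coordSubmodule M Z hZ ↔ ∀ k ∈ Z, v k = 0 := Iff.rfl

/-- The graded module of vectors with vanishing coordinates in `Z`. -/
noncomputable def coordSub (M : GrModA1) (Z : Finset (Fin 8)) (hZ : IsStableSet Z) : GrModA1 :=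
  (ind M).sub (coordSubmodule M Z hZ) fun i v hv k hk =>
    (ind_comp_apply M i v k).trans ((congrArg _ (hv k hk)).trans (map_zero _))

/-- Right multiplication by `Sq¹`. -/
noncomputable def rightSq1 (M : GrModA1) : IndCarrier M →ₗ[A1] IndCarrier M :=
  linOfSq
    { toFun v := indMk ![0, v 0, 0, 0, v 2, v 3, 0, v 6]
      map_zero' := by apply IndCarrier.ext8 <;> simp
      map_add' x y := by apply IndCarrier.ext8 <;> simp }
    (fun x => by apply IndCarrier.ext8 <;> simp)
    (fun x => by apply IndCarrier.ext8 <;> simp)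

/-- Right multiplication by `Sq²`. -/
noncomputable def rightSq2 (M : GrModA1) : IndCarrier M →ₗ[A1] IndCarrier M :=
  linOfSq
    { toFun v := indMk ![0, 0, v 0, v 1, 0, v 2, v 4, v 5]
      map_zero' := by apply IndCarrier.ext8 <;> simp
      map_add' x y := by apply IndCarrier.ext8 <;> simp }
    (fun x => by apply IndCarrier.ext8 <;> simp)
    (fun x => by apply IndCarrier.ext8 <;> simp)

theorem rightSq1_apply {M : GrModA1} (v : IndCarrier M) :
    rightSq1 M v = indMk ![0, v 0, 0, 0, v 2, v 3, 0, v 6] := rfl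

theorem rightSq2_apply {M : GrModA1} (v : IndCarrier M) :
    rightSq2 M v = indMk ![0, 0, v 0, v 1, 0, v 2, v 4, v 5] := rfl

theorem rightSq1_mem {M : GrModA1} {i j : ℤ} {v : IndCarrier M} (hv : v ∈ (ind M).deg i)
    (h : i + 1 = j) : rightSq1 M v ∈ (ind M).deg j := by
  subst h
  intro k
  fin_cases k
  · exact zero_mem _
  · exact mem_deg_of_eq (hv 0) (by simp [basisDeg])
  · exact zero_mem _
  · exact zero_mem _
  · exact mem_deg_of_eq (hv 2) (by simp [basisDeg]; ring)
  · exact mem_deg_of_eq (hv 3) (by simp [basisDeg]; ring)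
  · exact zero_mem _
  · exact mem_deg_of_eq (hv 6) (by simp [basisDeg]; ring)

theorem rightSq2_mem {M : GrModA1} {i j : ℤ} {v : IndCarrier M} (hv : v ∈ (ind M).deg i)
    (h : i + 2 = j) : rightSq2 M v ∈ (ind M).deg j := by
  subst h
  intro k
  fin_cases k
  · exact zero_mem _
  · exact zero_mem _
  · exact mem_deg_of_eq (hv 0) (by simp [basisDeg])
  · exact mem_deg_of_eq (hv 1) (by simp [basisDeg]; ring)
  · exact zero_mem _
  · exact mem_deg_of_eq (hv 2) (by simp [basisDeg]; ring)
  · exact mem_deg_of_eq (hv 4) (by simp [basisDeg]; ring)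
  · exact mem_deg_of_eq (hv 5) (by simp [basisDeg]; ring)

theorem ses_coordSub {M : GrModA1} {ZK ZH ZL : Finset (Fin 8)} {hK : IsStableSet ZK}
    {hH : IsStableSet ZH} {hL : IsStableSet ZL} {d : ℤ} (f : IndCarrier M →ₗ[A1] IndCarrier M)
    (hd : ∀ i, ∀ v ∈ (ind M).deg (i - d), f v ∈ (ind M).deg i)
    (h1 : ∀ v ∈ coordSubmodule M ZH hH, f v ∈ coordSubmodule M ZL hL)
    (h2 : ∀ w ∈ coordSubmodule M ZL hL, ∃ v ∈ coordSubmodule M ZH hH, f v = w)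
    (h3 : ∀ v, v ∈ coordSubmodule M ZK hK ↔ v ∈ coordSubmodule M ZH hH ∧ f v = 0) :
    SES (twist d (coordSub M ZK hK)) (twist d (coordSub M ZH hH)) (coordSub M ZL hL) := by
  have hle : coordSubmodule M ZK hK ≤ coordSubmodule M ZH hH := fun v hv => ((h3 v).1 hv).1
  let i : coordSubmodule M ZK hK →ₗ[A1] coordSubmodule M ZH hH := Submodule.inclusion hle
  let p : coordSubmodule M ZH hH →ₗ[A1] coordSubmodule M ZL hL := f.restrict h1
  refine ⟨mkHom (M := twist d (coordSub M ZK hK)) (N := twist d (coordSub M ZH hH))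
      i fun i v hv => hv,
    mkHom (M := twist d (coordSub M ZH hH)) (N := coordSub M ZL hL)
      p fun i v hv => hd i v.1 hv, Submodule.inclusion_injective hle,
    fun v => ⟨fun h => ?_, ?_⟩, fun w => ?_⟩
  · exact ⟨⟨v.1, (h3 _).2 ⟨v.2, congrArg Subtype.val h⟩⟩, rfl⟩
  · rintro ⟨v, rfl⟩
    exact Subtype.ext ((h3 _).1 v.2).2
  · obtain ⟨v, hv, hw⟩ := h2 w.1 w.2
    exact ⟨⟨v, hv⟩, Subtype.ext hw⟩

/-- The left ideal generated by `Sq¹`. -/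
noncomputable abbrev idealS : GrModA1 := coordSub triv {0, 2, 3, 6} (by decide)

/-- The left ideal generated by `Sq² Sq¹`. -/
noncomputable abbrev idealTS : GrModA1 := coordSub triv {0, 1, 2, 3, 6} (by decide)

/-- The left ideal generated by `Sq²`. -/
noncomputable abbrev idealT : GrModA1 := coordSub triv {0, 1, 4} (by decide)

/-- The left ideal generated by `Sq¹ Sq²`. -/
noncomputable abbrev idealST : GrModA1 := coordSub triv {0, 1, 2, 4, 5} (by decide)

/-- The socle of `𝒜₁`. -/
noncomputable abbrev socle : GrModA1 := coordSub triv {0, 1, 2, 3, 4, 5, 6} (by decide)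

/-- The unit ideal. -/
noncomputable abbrev unitIdeal : GrModA1 := coordSub triv ∅ (by decide)

theorem isProj_unitIdeal : IsProj unitIdeal := by
  have h : StIso unitIdeal (ind triv) := stIso_of_bijective ((ind triv).subι _ _)
    ⟨(ind triv).subι_injective _ _, fun v => ⟨⟨v, fun k hk => by simp at hk⟩, rfl⟩⟩
  exact h.symm.isProj (isProj_ind triv)

theorem ses_idealS : SES (twist 1 idealS) (twist 1 unitIdeal) idealS := by
  refine ses_coordSub (rightSq1 triv) (fun i v hv => rightSq1_mem hv (by ring)) ?_ ?_ ?_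
  · intro v _
    simp [mem_coordSubmodule, rightSq1_apply]
  · intro w hw
    simp only [mem_coordSubmodule, Finset.forall_mem_insert, Finset.mem_singleton, forall_eq] at hw
    refine ⟨indMk ![w 1, 0, w 4, w 5, 0, 0, w 7, 0], by simp [mem_coordSubmodule], ?_⟩
    apply IndCarrier.ext8 <;> simp [rightSq1_apply, hw]
  · intro v
    simp only [mem_coordSubmodule, Finset.forall_mem_insert, Finset.mem_singleton, forall_eq,
      Finset.notMem_empty, false_imp_iff, implies_true, true_and]
    constructor
    · intro h
      apply IndCarrier.ext8 <;> simp [rightSq1_apply, h]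
    · intro h
      exact ⟨congrFun h 1, congrFun h 4, congrFun h 5, congrFun h 7⟩

theorem ses_socle : SES (twist 5 idealTS) (twist 5 idealS) socle := by
  refine ses_coordSub (rightSq2 triv ∘ₗ rightSq1 triv ∘ₗ rightSq2 triv) (fun i v hv =>
    rightSq2_mem (rightSq1_mem (rightSq2_mem hv rfl) rfl) (by ring)) ?_ ?_ ?_
  · intro v hv
    simp only [mem_coordSubmodule, Finset.forall_mem_insert, Finset.mem_singleton, forall_eq] at hv
    simp [mem_coordSubmodule, rightSq1_apply, rightSq2_apply, hv]
  · intro w hw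
    simp only [mem_coordSubmodule, Finset.forall_mem_insert, Finset.mem_singleton, forall_eq] at hw
    refine ⟨indMk ![0, w 7, 0, 0, 0, 0, 0, 0], by simp [mem_coordSubmodule], ?_⟩
    apply IndCarrier.ext8 <;> simp [rightSq1_apply, rightSq2_apply, hw]
  · intro v
    simp only [mem_coordSubmodule, Finset.forall_mem_insert, Finset.mem_singleton, forall_eq]
    constructor
    · intro h
      refine ⟨by simp [h], ?_⟩
      apply IndCarrier.ext8 <;> simp [rightSq1_apply, rightSq2_apply, h]
    · rintro ⟨h, h'⟩
      have : v 1 = 0 := congrFun h' 7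
      simp [h, this]

theorem ses_idealTS : SES (twist 3 idealT) (twist 3 unitIdeal) idealTS := by
  refine ses_coordSub (rightSq1 triv ∘ₗ rightSq2 triv) (fun i v hv =>
    rightSq1_mem (rightSq2_mem hv rfl) (by ring)) ?_ ?_ ?_
  · intro v _
    simp [mem_coordSubmodule, rightSq1_apply, rightSq2_apply]
  · intro w hw
    simp only [mem_coordSubmodule, Finset.forall_mem_insert, Finset.mem_singleton, forall_eq] at hw
    refine ⟨indMk ![w 4, w 5, 0, 0, w 7, 0, 0, 0], by simp [mem_coordSubmodule], ?_⟩
    apply IndCarrier.ext8 <;> simp [rightSq1_apply, rightSq2_apply, hw]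
  · intro v
    simp only [mem_coordSubmodule, Finset.forall_mem_insert, Finset.mem_singleton, forall_eq,
      Finset.notMem_empty, false_imp_iff, implies_true, true_and]
    constructor
    · intro h
      apply IndCarrier.ext8 <;> simp [rightSq1_apply, rightSq2_apply, h]
    · intro h
      exact ⟨congrFun h 4, congrFun h 5, congrFun h 7⟩

theorem ses_idealT : SES (twist 2 idealST) (twist 2 unitIdeal) idealT := by
  refine ses_coordSub (rightSq2 triv) (fun i v hv => rightSq2_mem hv (by ring)) ?_ ?_ ?_
  · intro v _
    simp [mem_coordSubmodule, rightSq2_apply]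
  · intro w hw
    simp only [mem_coordSubmodule, Finset.forall_mem_insert, Finset.mem_singleton, forall_eq] at hw
    refine ⟨indMk ![w 2, w 3, w 5, 0, w 6, w 7, 0, 0], by simp [mem_coordSubmodule], ?_⟩
    apply IndCarrier.ext8 <;> simp [rightSq2_apply, hw]
  · intro v
    simp only [mem_coordSubmodule, Finset.forall_mem_insert, Finset.mem_singleton, forall_eq,
      Finset.notMem_empty, false_imp_iff, implies_true, true_and]
    constructor
    · intro h
      apply IndCarrier.ext8 <;> simp [rightSq2_apply, h]
    · intro h
      exact ⟨congrFun h 2, congrFun h 3, congrFun h 5, congrFun h 6, congrFun h 7⟩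

theorem ses_idealST : SES (twist 2 socle) (twist 2 idealS) idealST := by
  refine ses_coordSub (rightSq2 triv) (fun i v hv => rightSq2_mem hv (by ring)) ?_ ?_ ?_
  · intro v hv
    simp only [mem_coordSubmodule, Finset.forall_mem_insert, Finset.mem_singleton, forall_eq] at hv
    simp [mem_coordSubmodule, rightSq2_apply, hv]
  · intro w hw
    simp only [mem_coordSubmodule, Finset.forall_mem_insert, Finset.mem_singleton, forall_eq] at hw
    refine ⟨indMk ![0, w 3, 0, 0, w 6, w 7, 0, 0], by simp [mem_coordSubmodule], ?_⟩
    apply IndCarrier.ext8 <;> simp [rightSq2_apply, hw]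
  · intro v
    simp only [mem_coordSubmodule, Finset.forall_mem_insert, Finset.mem_singleton, forall_eq]
    constructor
    · intro h
      refine ⟨by simp [h], ?_⟩
      apply IndCarrier.ext8 <;> simp [rightSq2_apply, h]
    · rintro ⟨h, h'⟩
      have h1 : v 1 = 0 := congrFun h' 3
      have h4 : v 4 = 0 := congrFun h' 6
      have h5 : v 5 = 0 := congrFun h' 7
      simp [h, h1, h4, h5]

theorem stIso_socle : StIso (twist 6 triv) socle := by
  let e : IndCarrier triv := indMk (M := triv) ![0, 0, 0, 0, 0, 0, 0, (1 : ZMod 2)]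
  have he : e ∈ coordSubmodule triv {0, 1, 2, 3, 4, 5, 6} (by decide) := by
    simp [mem_coordSubmodule, e]
  let m : socle.carrier := ⟨e, he⟩
  have hm : m ∈ socle.deg 6 := by
    change ∀ k, e k ∈ triv.deg (6 - basisDeg k)
    intro k
    fin_cases k
    iterate 7 exact zero_mem _
    exact mem_deg_of_eq (mem_triv_deg_zero _) (by simp [basisDeg])
  have h1 : sq1 • m = 0 := Subtype.ext (by
    change sq1 • e = 0
    apply IndCarrier.ext8 <;> simp [e])
  have h2 : sq2 • m = 0 := Subtype.ext (by
    change sq2 • e = 0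
    apply IndCarrier.ext8 <;> simp [e])
  have hm0 : m ≠ 0 := fun h => one_ne_zero (α := ZMod 2) (congrFun (congrArg Subtype.val h) 7)
  refine stIso_of_bijective (unitMap hm h1 h2) ⟨unitMap_injective hm h1 h2 hm0, fun v => ?_⟩
  obtain ⟨(v : IndCarrier triv), hv⟩ := v
  have hv' : ∀ k ∈ ({0, 1, 2, 3, 4, 5, 6} : Finset (Fin 8)), v k = 0 := hv
  simp only [Finset.forall_mem_insert, Finset.mem_singleton, forall_eq] at hv'
  have h0 : v 7 = 0 → (0 : IndCarrier triv) = v := fun h => by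
    apply IndCarrier.ext8 <;> simp [hv', h]
  have h1 : v 7 = (1 : ZMod 2) → e = v := fun h => by
    apply IndCarrier.ext8 <;> simp [hv', h, e]
    rfl
  rcases zmod_cases (v 7) with h | h
  · exact ⟨(0 : ZMod 2), (map_zero (lin (unitMap hm _ _))).trans (Subtype.ext (h0 h))⟩
  · exact ⟨(1 : ZMod 2), (unitAdd_one m).trans (Subtype.ext (h1 h))⟩

end Steenrod

/-! ## Twists -/

namespace Steenrod

open GrMod

theorem StIso.twist {M N : GrModA1} (a : ℤ) : StIso M N → StIso (twist a M) (twist a N) :=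
  fun ⟨e⟩ => ⟨(twBig A1.degree a).mapIso e⟩

theorem StRetract.twist {M N : GrModA1} (a : ℤ) :
    StRetract M N → StRetract (twist a M) (twist a N) :=
  fun ⟨e⟩ => ⟨e.map (twBig A1.degree a)⟩

theorem stIso_twist_twist (M : GrModA1) {a b c : ℤ} (h : a + b = c) :
    StIso (twist a (twist b M)) (twist c M) :=
  stIso_of_bijective
    (mkHom (M := twist a (twist b M)) (N := twist c M) (LinearMap.id (M := M.carrier))
      fun i _ hm => mem_deg_of_eq (M := M) hm (show i - a - b = i - c by omega))
    Function.bijective_id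

theorem stIso_twist_zero (M : GrModA1) : StIso (twist 0 M) M :=
  stIso_of_bijective
    (mkHom (M := twist 0 M) (N := M) (LinearMap.id (M := M.carrier))
      fun i _ hm => mem_deg_of_eq (M := M) hm (sub_zero i))
    Function.bijective_id

theorem _root_.GrMod.SES.cof_twist {M N L : GrModA1} {d : ℤ}
    (h : SES (twist d M) (twist d N) L) {k m : ℤ} (hm : k + d = m) :
    Cof (twist m M) (twist m N) (twist k L) :=
  (h.twist k).cof.congr (stIso_twist_twist M hm) (stIso_twist_twist N hm) (StIso.refl _)

theorem Cost.twist_idealS {B : ℕ → GrModA1 → Prop} (hB : Cost B) {b : ℕ} (h : B b idealS)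
    (n : ℤ) : B b (twist n idealS) := by
  induction n with
  | zero => exact hB.of_stIso h (stIso_twist_zero _).symm
  | succ n ih =>
    have := hB.first (hB.proj (isProj_unitIdeal.twist _)) ih (ses_idealS.cof_twist rfl)
    rwa [zero_add] at this
  | pred n ih =>
    exact hB.third ih (hB.proj (isProj_unitIdeal.twist _)) (ses_idealS.cof_twist (by ring))

theorem Cost.twist_socle_up {B : ℕ → GrModA1 → Prop} (hB : Cost B) {a b : ℕ}
    (hb : ∀ n, B b (twist n idealS)) {n : ℤ} (h : B a (twist n socle)) :
    B (a + 2 * b) (twist (n + 12) socle) := by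
  have h1 := hB.first (hb _) h (ses_socle.cof_twist rfl)
  have h2 := hB.first (hB.proj (isProj_unitIdeal.twist _)) h1 (ses_idealTS.cof_twist rfl)
  have h3 := hB.first (hB.proj (isProj_unitIdeal.twist _)) h2 (ses_idealT.cof_twist rfl)
  have h4 := hB.first (hb _) h3 (ses_idealST.cof_twist rfl)
  rwa [show b + (0 + (0 + (b + a))) = a + 2 * b by ring,
    show n + 5 + 3 + 2 + 2 = n + 12 by ring] at h4

theorem Cost.twist_socle_down {B : ℕ → GrModA1 → Prop} (hB : Cost B) {a b : ℕ}
    (hb : ∀ n, B b (twist n idealS)) {n : ℤ} (h : B a (twist n socle)) :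
    B (a + 2 * b) (twist (n - 12) socle) := by
  have h1 := hB.third h (hb _) (ses_idealST.cof_twist (k := n - 2) (by ring))
  have h2 := hB.third h1 (hB.proj (isProj_unitIdeal.twist _))
    (ses_idealT.cof_twist (k := n - 4) (by ring))
  have h3 := hB.third h2 (hB.proj (isProj_unitIdeal.twist _))
    (ses_idealTS.cof_twist (k := n - 7) (by ring))
  have h4 := hB.third h3 (hb _) (ses_socle.cof_twist (k := n - 12) (by ring))
  rwa [show a + b + 0 + 0 + b = a + 2 * b by ring] at h4

theorem stIso_twist_socle {n m : ℤ} (h : n + 6 = m) : StIso (twist m triv) (twist n socle) :=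
  (stIso_twist_twist triv h).symm.trans (stIso_socle.twist n)

theorem Cost.twist_triv_up {B : ℕ → GrModA1 → Prop} (hB : Cost B) {a b : ℕ}
    (hb : ∀ n, B b (twist n idealS)) {n : ℤ} (h : B a (twist n triv)) :
    B (a + 2 * b) (twist (n + 12) triv) :=
  hB.of_stIso (hB.twist_socle_up hb (hB.of_stIso h
    (stIso_twist_socle (sub_add_cancel n 6)))) (stIso_twist_socle (by ring)).symm

theorem Cost.twist_triv_down {B : ℕ → GrModA1 → Prop} (hB : Cost B) {a b : ℕ}
    (hb : ∀ n, B b (twist n idealS)) {n : ℤ} (h : B a (twist n triv)) :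
    B (a + 2 * b) (twist (n - 12) triv) :=
  hB.of_stIso (hB.twist_socle_down hb (hB.of_stIso h
    (stIso_twist_socle (sub_add_cancel n 6)))) (stIso_twist_socle (by ring)).symm

theorem Cost.twist_triv_add {B : ℕ → GrModA1 → Prop} (hB : Cost B) {a b : ℕ}
    (hb : ∀ n, B b (twist n idealS)) {i : ℤ} (h : B a (twist i triv)) (q : ℕ) :
    B (a + 2 * b * q) (twist (i + 12 * q) triv) := by
  induction q with
  | zero => simpa using h
  | succ q ih =>
    have := hB.twist_triv_up hb ih
    rwa [show a + 2 * b * q + 2 * b = a + 2 * b * (q + 1) by ring,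
      show i + 12 * q + 12 = i + 12 * (q + 1 : ℕ) by push_cast; ring] at this

/-- Twelve consecutive twists of the trivial module and the ideal generated by `Sq¹` generate. -/
theorem Cost.twist_triv {p : GrModA1 → Prop} (hp : Cost fun _ => p) (hS : p idealS)
    (h : ∀ k : ℕ, k < 12 → p (twist k triv)) (i : ℤ) : p (twist i triv) := by
  have hb := hp.twist_idealS (b := 0) hS
  have key : ∀ q : ℤ, ∀ k : ℕ, k < 12 → p (twist (k + 12 * q) triv) := by
    intro q k hk
    induction q with
    | zero => simpa using h k hk
    | succ q ih =>
      have := hp.twist_triv_up (a := 0) (b := 0) hb ih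
      rwa [show (k : ℤ) + 12 * q + 12 = k + 12 * (q + 1) by ring] at this
    | pred q ih =>
      have := hp.twist_triv_down (a := 0) (b := 0) hb ih
      rwa [show (k : ℤ) + 12 * -q - 12 = k + 12 * (-q - 1) by ring] at this
  have := key (i / 12) (i % 12).toNat (by omega)
  rwa [show ((i % 12).toNat : ℤ) + 12 * (i / 12) = i by omega] at this

/-! ### Existence of a generator -/

/-- The direct sum of the ideal generated by `Sq¹` and of `n` twists of the trivial module. -/
noncomputable def sumTriv : ℕ → GrModA1
  | 0 => idealS
  | n + 1 => (twist n triv).prod (sumTriv n)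

theorem stRetract_prod_right (M N : GrModA1) : StRetract N (M.prod N) :=
  stRetract_of_hom (prodInr M N) (prodSnd M N) (stableRel_of_eq rfl)

theorem finite_sumTriv (n : ℕ) : Finite (sumTriv n).carrier := by
  have h : Finite triv.carrier := inferInstanceAs (Finite (ZMod 2))
  induction n with
  | zero =>
    have : Finite (IndCarrier triv) := finite_ind triv
    exact Finite.of_injective (fun v : coordSubmodule triv {0, 2, 3, 6} (by decide) => v.1)
      Subtype.val_injective
  | succ n ih => exact @Finite.instProd _ _ h ih

theorem stRetract_sumTriv_zero (n : ℕ) : StRetract idealS (sumTriv n) := by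
  induction n with
  | zero => exact (StIso.refl _).stRetract
  | succ n ih => exact ih.trans (stRetract_prod_right _ _)

theorem stRetract_sumTriv {k n : ℕ} (h : k < n) : StRetract (twist k triv) (sumTriv n) := by
  induction n with
  | zero => omega
  | succ n ih =>
    rcases Nat.lt_succ_iff_lt_or_eq.1 h with h | rfl
    · exact (ih h).trans (stRetract_prod_right _ _)
    · exact stRetract_prod_left _ _

theorem exists_isGenerator : ∃ G : StModA1, IsGenerator G := by
  have := finite_sumTriv 12
  refine ⟨stObj (sumTriv 12) (cpt_of_finite _), fun P hP hG X => ?_⟩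
  have hc := cost_of_isThick hP
  have h0 : ∃ h : Cpt (sumTriv 12), P (stObj _ h) := ⟨_, hG⟩
  obtain ⟨_, h⟩ := hc.of_triv (hc.twist_triv (hc.retract (k := 0) h0 (stRetract_sumTriv_zero 12))
    fun k hk => hc.retract (k := 0) h0 (stRetract_sumTriv hk)) X.property
  exact h

/-! ### Linear growth -/

theorem cost_linear {B : ℕ → GrModA1 → Prop} (hB : Cost B) :
    Cost fun _ M => ∃ C : ℕ, ∀ n : ℕ, ∃ k ≤ C * (n + 1), B k (twist n M) where
  proj h := ⟨0, fun n => ⟨0, Nat.zero_le _, hB.proj (h.twist n)⟩⟩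
  retract := fun ⟨C, h⟩ e => ⟨C, fun n => by
    obtain ⟨k, hk, h⟩ := h n
    exact ⟨k, hk, hB.retract h (e.twist n)⟩⟩
  second := fun ⟨C, h⟩ ⟨C', h'⟩ e => ⟨C + C', fun n => by
    obtain ⟨k, hk, h⟩ := h n
    obtain ⟨k', hk', h'⟩ := h' n
    exact ⟨k + k', by rw [add_mul]; exact add_le_add hk hk', hB.second h h' (e.twist n)⟩⟩
  third := fun ⟨C, h⟩ ⟨C', h'⟩ e => ⟨C + C', fun n => by
    obtain ⟨k, hk, h⟩ := h n
    obtain ⟨k', hk', h'⟩ := h' n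
    exact ⟨k + k', by rw [add_mul]; exact add_le_add hk hk', hB.third h h' (e.twist n)⟩⟩
  first := fun ⟨C, h⟩ ⟨C', h'⟩ e => ⟨C + C', fun n => by
    obtain ⟨k, hk, h⟩ := h n
    obtain ⟨k', hk', h'⟩ := h' n
    exact ⟨k + k', by rw [add_mul]; exact add_le_add hk hk', hB.first h h' (e.twist n)⟩⟩

theorem cpt_twist_triv (i : ℤ) : Cpt (twist i triv) :=
  have : Finite (twist i triv).carrier := inferInstanceAs (Finite (ZMod 2))
  cpt_of_finite _

theorem cpt_idealS : Cpt idealS :=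
  have : Finite idealS.carrier := finite_sumTriv 0
  cpt_of_finite _

theorem exists_built_le {G : StModA1} (hG : IsGenerator G) :
    ∃ C : ℕ, ∀ n : ℕ, ∃ k ≤ C * (n + 1), Built G k (twist n G.obj.as) := by
  have hB := cost_built G
  have hfin : ∀ {M : GrModA1}, Cpt M → ∃ k, Built G k M :=
    hG.of_cost hB.exists ⟨1, built_self⟩
  obtain ⟨b, hb⟩ := hfin cpt_idealS
  refine (cost_linear hB).of_triv (fun i => ?_) G.property
  choose a ha using fun k : ℕ => hfin (cpt_twist_triv (k + i))
  refine ⟨∑ k ∈ Finset.range 12, a k + 2 * b, fun n => ?_⟩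
  have h := hB.of_stIso (hB.twist_triv_add (hB.twist_idealS hb) (ha (n % 12)) (n / 12))
    (stIso_twist_twist triv (show (n : ℤ) + i = (n % 12 : ℕ) + i + 12 * (n / 12 : ℕ) by omega)).symm
  refine ⟨_, ?_, h⟩
  have h1 : a (n % 12) ≤ ∑ k ∈ Finset.range 12, a k :=
    Finset.single_le_sum (f := a) (fun _ _ => Nat.zero_le _)
      (Finset.mem_range.2 (Nat.mod_lt n (by norm_num)))
  rw [add_mul]
  exact add_le_add (h1.trans (Nat.le_mul_of_pos_right _ n.succ_pos))
    (Nat.mul_le_mul_left _ ((Nat.div_le_self n 12).trans n.le_succ))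

theorem stIso_iterate_tw (G : StModA1) (n : ℕ) :
    StIso (twist n G.obj.as) (twA1.obj^[n] G).obj.as := by
  induction n with
  | zero => exact stIso_twist_zero _
  | succ n ih =>
    rw [Function.iterate_succ_apply']
    exact (stIso_twist_twist G.obj.as (by push_cast; ring)).symm.trans (ih.twist 1)

theorem exists_complexity_le {G : StModA1} (hG : IsGenerator G) :
    ∃ C : ℕ, ∀ n : ℕ, complexity G (twA1.obj^[n] G) ≤ (C * (n + 1) : ℕ) := by
  obtain ⟨C, h⟩ := exists_built_le hG
  refine ⟨C, fun n => complexity_le_iff.2 ?_⟩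
  obtain ⟨k, hk, h⟩ := h n
  exact ⟨k, hk, (cost_built G).of_stIso h (stIso_iterate_tw G n)⟩

theorem complexity_eq_zero {G : StModA1} (hG : IsProj G.obj.as) (n : ℕ) :
    complexity G (twA1.obj^[n] G) = 0 :=
  nonpos_iff_eq_zero.1 (complexity_le_iff (ℓ := 0).2 ⟨0, le_rfl,
    built_of_isProj ((stIso_iterate_tw G n).isProj (hG.twist n))⟩)

theorem one_le_complexity {G : StModA1} (hG : ¬ IsProj G.obj.as) (n : ℕ) :
    1 ≤ complexity G (twA1.obj^[n] G) := by
  rw [Order.one_le_iff_pos, pos_iff_ne_zero]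
  intro h
  obtain ⟨k, hk, h⟩ := complexity_le_iff (ℓ := 0).1 h.le
  obtain rfl := Nat.le_zero.1 hk
  have h1 : IsProj (twist n G.obj.as) := (stIso_iterate_tw G n).symm.isProj h.isProj
  exact hG (((stIso_twist_twist G.obj.as (neg_add_cancel (n : ℤ))).trans
    (stIso_twist_zero _)).isProj (h1.twist (-n)))

end Steenrod

/-! ## Entropy -/

section Entropy

variable {A : Type} [Ring A] {𝒜 : ℕ → AddSubgroup A} {F : StMod 𝒜 ⥤ StMod 𝒜} {G : StMod 𝒜}

theorem entropy_of_complexity_eq_zero (h : ∀ n, complexity G (F.obj^[n] G) = 0) :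
    Tendsto (fun n : ℕ => logComplexity F G n / (n : EReal)) atTop (𝓝 (catEntropy F G)) ∧
      polEntropy F G ≤ 1 := by
  have hL : ∀ n, logComplexity F G n = ⊥ := fun n => by simp [logComplexity, h n]
  constructor
  · have : Tendsto (fun n : ℕ => logComplexity F G n / (n : EReal)) atTop (𝓝 ⊥) := by
      refine tendsto_const_nhds.congr' ?_
      filter_upwards [eventually_gt_atTop 0] with n hn
      rw [hL, EReal.bot_div_of_pos_ne_top (by exact_mod_cast hn) (EReal.natCast_ne_top n)]
    rwa [show catEntropy F G = ⊥ from this.limsup_eq]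
  · refine limsup_le_of_le (h := ?_)
    filter_upwards [eventually_gt_atTop 1] with n hn
    rw [hL, EReal.bot_sub, EReal.bot_div_of_pos_ne_top _ (EReal.coe_ne_top _)]
    · exact bot_le
    · exact_mod_cast Real.log_pos (by exact_mod_cast hn)

theorem entropy_of_complexity_le {C : ℕ} (h1 : ∀ n, 1 ≤ complexity G (F.obj^[n] G))
    (hC : ∀ n, complexity G (F.obj^[n] G) ≤ (C * (n + 1) : ℕ)) :
    Tendsto (fun n : ℕ => logComplexity F G n / (n : EReal)) atTop (𝓝 (catEntropy F G)) ∧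
      polEntropy F G ≤ 1 := by
  have hC0 : 0 < C := by
    have := (h1 0).trans (hC 0)
    rw [zero_add, mul_one] at this
    exact_mod_cast this
  have hL0 : ∀ n, 0 ≤ logComplexity F G n := fun n =>
    ENNReal.zero_le_log_iff.2 (by exact_mod_cast h1 n)
  have hL : ∀ n : ℕ, 0 < n →
      logComplexity F G n ≤ ((Real.log (2 * C) + Real.log n : ℝ) : EReal) := fun n hn => by
    have hn' : (1 : ℝ) ≤ n := by exact_mod_cast hn
    have hC' : (0 : ℝ) < C := by exact_mod_cast hC0
    rw [← Real.log_mul (by positivity) (by positivity),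
      ← ENNReal.log_ofReal_of_pos (by positivity)]
    refine ENNReal.log_monotone ?_
    have h2 : ((complexity G (F.obj^[n] G) : ℕ∞) : ENNReal) ≤ ((C * (n + 1) : ℕ) : ENNReal) := by
      exact_mod_cast hC n
    refine h2.trans ?_
    rw [← ENNReal.ofReal_natCast]
    refine ENNReal.ofReal_le_ofReal ?_
    push_cast
    nlinarith
  have ht : Tendsto (fun n : ℕ => logComplexity F G n / (n : EReal)) atTop (𝓝 0) := by
    have hlim : Tendsto (fun n : ℕ => (Real.log (2 * C) + Real.log n) / n) atTop (𝓝 0) := by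
      have := (tendsto_const_div_atTop_nhds_zero_nat (Real.log (2 * C))).add
        (Real.isLittleO_log_id_atTop.tendsto_div_nhds_zero.comp tendsto_natCast_atTop_atTop)
      rw [add_zero] at this
      exact this.congr fun n => (add_div _ _ _).symm
    refine tendsto_of_tendsto_of_tendsto_of_le_of_le' tendsto_const_nhds
      (EReal.tendsto_coe.2 hlim) (Eventually.of_forall fun n => EReal.div_nonneg (hL0 n)
        (EReal.coe_nonneg.2 n.cast_nonneg)) ?_
    filter_upwards [eventually_gt_atTop 0] with n hn
    rw [EReal.coe_div]
    exact EReal.div_le_div_right_of_nonneg (EReal.coe_nonneg.2 n.cast_nonneg) (hL n hn)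
  have h0 : catEntropy F G = 0 := ht.limsup_eq
  refine ⟨h0 ▸ ht, ?_⟩
  have hlim : Tendsto (fun n : ℕ => Real.log (2 * C) / Real.log n + 1) atTop (𝓝 1) := by
    have := ((tendsto_const_nhds (x := Real.log (2 * C))).div_atTop
      (Real.tendsto_log_atTop.comp tendsto_natCast_atTop_atTop)).add_const 1
    rwa [zero_add] at this
  refine le_trans (limsup_le_limsup ?_) (EReal.tendsto_coe.2 hlim).limsup_eq.le
  filter_upwards [eventually_gt_atTop 1] with n hn
  have hlog : 0 < Real.log n := Real.log_pos (by exact_mod_cast hn)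
  rw [h0, mul_zero, sub_zero]
  refine (EReal.div_le_div_right_of_nonneg (by exact_mod_cast hlog.le)
    (hL n (by omega))).trans_eq ?_
  rw [← EReal.coe_div, add_div, div_self hlog.ne']

end Entropy

theorem mainTheorem4 :
    (∃ G : Steenrod.StModA1, IsGenerator G) ∧
    ∀ G : Steenrod.StModA1, IsGenerator G →
      Tendsto (fun n : ℕ => logComplexity Steenrod.twA1 G n / (n : EReal)) atTop
        (𝓝 (catEntropy Steenrod.twA1 G)) ∧
      polEntropy Steenrod.twA1 G ≤ 1 := by
  refine ⟨Steenrod.exists_isGenerator, fun G hG => ?_⟩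
  obtain ⟨C, hC⟩ := Steenrod.exists_complexity_le hG
  by_cases h : GrMod.IsProj G.obj.as
  · exact entropy_of_complexity_eq_zero (Steenrod.complexity_eq_zero h)
  · exact entropy_of_complexity_le (Steenrod.one_le_complexity h) hC
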